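/- **Setting.** Let $\Gamma$ be a finite connected graph with oriented edges, and let $f\colon\Gamma\to\Gamma$ be a homotopy equivalence that maps vertices to vertices and edges across edge-paths and fixes a vertex $*$. Let $H\subset\Gamma$ be a subgraph with $f(H)\subseteq H$. Put $\mathbb F=\pi_1(\Gamma,*)$, let $\Phi_f\in\mathrm{Aut}(\mathbb F)$ be induced by $f$, and let $G_\phi=\mathbb F\rtimes\langle t\rangle$ with $t^{-1}xt=\Phi_f(x)$ for $x\in\mathbb F$. Let $\widetilde\Gamma$ be the universal cover, $\widetilde H$ the preimage of $H$, and $\tilde f$ the lift of $f$ fixing a given lift of $*$. Let $C_1(\widetilde\Gamma,\widetilde H;\mathbb Q)$ be the space of finitely supported rational $1$-chains that vanish on the edges of $\widetilde H$, with its $L^2$-inner product and norm, let $\pi_H^\perp$ be the projection of $C_1(\widetilde\Gamma;\mathbb Q)$ onto it, and let $A_{f,H}=\pi_H^\perp\circ\tilde f_*$ on $C_1(\widetilde\Gamma,\widetilde H;\mathbb Q)$. **Nielsen $1$-chains.** Let $\rho=\pi_H^\perp([u,v])$, where $u\ne v$ are vertices of $\widetilde\Gamma$ fixed by $\tilde f$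 and $[u,v]$ is the $1$-chain with boundary $v-u$. It is a *Nielsen $1$-chain* if one of the following holds. (Non-geometric) There is an edge $e\notin\widetilde H$ with $\rho_e=\pm1$ and $\rho_{ge}=0$ for all $1\neq g\in\mathbb F$. (Geometric) For $g_1\ne g_2$ in $\mathbb F$ the set $\mathrm{supp}(g_1\rho)\cap\mathrm{supp}(g_2\rho)$ is empty or a single edge; for each edge $e\notin\widetilde H$ there is exactly one pair $\{g_1,g_2\}$ of distinct elements for which this set is $\{e\}$; and there are non-commuting $g_1,g_2\in\mathbb F$ such that $\mathrm{supp}(\rho)$ meets both $\mathrm{supp}(g_1\rho)$ and $\mathrm{supp}(g_2\rho)$. **Chain flare condition.** There are $\mathbb Q[\mathbb F]$-submodules $V_{\rm h},V_{\rm qf}$ of $C_1(\widetilde\Gamma,\widetilde H;\mathbb Q)$ such that (1) $V_{\rm h}+V_{\rm qf}=C_1(\widetilde\Gamma,\widetilde H;\mathbb Q)$; (2) there are $\lambda>1$ and $0<\theta<1$ with $\lambda\|A_{f,H}x\|\le\max\{\|A_{f,H}^2x\|,\|x\|\}$ for all $x\in N_\theta(V_{\rm h})^\infty$, where $N_\theta(V)=\{x'\mid\langle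 x,x'\rangle>\theta\|x\|\|x'\|\text{ for some }x\in V\}$ and $N^\infty=\bigcup_{k\in\mathbb Z}A_{f,H}^k(N)$ (preimages for $k<0$); (3) if $V_{\rm qf}\ne0$, then $V_{\rm qf}$ is generated as a $\mathbb Q[\mathbb F]$-module by a Nielsen $1$-chain. **Operators.** Choose a lift to $\widetilde\Gamma$ of each of the $n_H$ edges of $\Gamma$ outside $H$. This identifies $C_1(\widetilde\Gamma,\widetilde H;\mathbb Q)$ with $\mathbb Q[\mathbb F]^{n_H}\subset L^2(\mathbb F)^{n_H}\subset L^2(G_\phi)^{n_H}$. Let $J$ be the matrix over $\mathbb Z[\mathbb F]$ whose $i$-th row lists the coordinates of $A_{f,H}$ of the $i$-th basis element, and let $L_{f,H}$ be the operator on $L^2(G_\phi)^{n_H}$ given by right multiplication by $tJ$. Let $V^{(2)}_{\rm qf}$ be the closure of the complex span of $V_{\rm qf}$ in $L^2(\mathbb F)^{n_H}$, and let $W^{(2)}_{\rm qf}$ be the closure of $\sum_{\ell\in\mathbb Z}t^\ell V^{(2)}_{\rm qf}$ in $L^2(G_\phi)^{n_H}$. The Fuglede–Kadison determinant of a morphism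 $A$ of Hilbert $G$-modules is $\det_G(A)=\exp\int_{0^+}^\infty\log r\,dF_A(r)$ if the integral exists and $0$ otherwise, where $F_A(r)$ is the von Neumann trace of the spectral projection of $A^*A$ for $[0,r^2]$. **Theorem.** Suppose that $f$ satisfies the chain flare condition relative to $H$, with submodules $V_{\rm h}$ and $V_{\rm qf}$. Then $W^{(2)}_{\rm qf}$ is invariant under $I-L_{f,H}^k$ for every integer $k\ge0$, and $$\log{\det}_{G_\phi}\bigl(I-L_{f,H}^k\bigr)\big|_{W^{(2)}_{\rm qf}}=0$$ (in particular, this determinant is positive). Moreover, let $P_k$ be right multiplication by $1-t^k$ on $L^2(\langle t\rangle)$. If $W^{(2)}_{\rm qf}\neq0$, there is a $G_\phi$-equivariant bounded isomorphism $O\colon L^2(G_\phi)\to W^{(2)}_{\rm qf}$ such that, for every $k\ge0$, $(I-L_{f,H}^k)|_{W^{(2)}_{\rm qf}}=O\,(\iota'_*P_k)\,O^{-1}$, where $\iota'_*P_k$ is the operator on $L^2(G_\phi)$ induced from $P_k$ along the inclusion $\iota'\colon\langle t\rangle\to G_\phi$; and ${\det}_{\langle t\rangle}(P_k)=1$ for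 every $k\ge0$. -/

import Mathlib

open CategoryTheory MeasureTheory

noncomputable section

namespace FreeByCyclic

/-! ## Graphs, edge-paths, morphisms and homotopy equivalences

A graph (a 1-dimensional CW-complex) is given by its set of vertices `V` and its oriented edges,
that is, by a quiver structure on `V`; `Quiver.Total V` is the set of all edges. -/

section Graphs

variable {V : Type*} [Quiver V]

/-- Edge-paths that start at `a`: each step runs along an edge in the positive or in the negative
direction. -/
inductive EdgePath (a : V) : V → Type _
  | nil : EdgePath a a
  | pos {b c : V} (p : EdgePath a b) (e : b ⟶ c) : EdgePath a c
  | neg {b c : V} (p : EdgePath a b) (e : c ⟶ b) : EdgePath a c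

/-- A vertex, as an object of the fundamental groupoid of the graph, which is the free groupoid on
the quiver. -/
abbrev vtx (a : V) : Quiver.FreeGroupoid V := (Quiver.FreeGroupoid.of V).obj a

/-- Homotopy classes rel endpoints of edge-paths from `a` to `b`: the morphisms of the
fundamental groupoid (edge-paths modulo insertion and deletion of backtracks). -/
abbrev PathClass (a b : V) := vtx a ⟶ vtx b

/-- The class of the edge-path that consists of the single edge `e`. -/
abbrev edgeClass {a b : V} (e : a ⟶ b) : PathClass a b := (Quiver.FreeGroupoid.of V).map e

/-- The homotopy class rel endpoints of an edge-path. -/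
def EdgePath.cls {a : V} : {b : V} → EdgePath a b → PathClass a b
  | _, .nil => 𝟙 (vtx a)
  | _, .pos p e => p.cls ≫ edgeClass e
  | _, .neg p e => p.cls ≫ inv (edgeClass e)

/-- The set of (unoriented) edges crossed by an edge-path. -/
def EdgePath.edges {a : V} : {b : V} → EdgePath a b → Set (Quiver.Total V)
  | _, .nil => ∅
  | _, .pos p e => insert ⟨_, _, e⟩ p.edges
  | _, .neg p e => insert ⟨_, _, e⟩ p.edges

/-- The fundamental group of the graph at a vertex; the product is concatenation. -/
abbrev PiOne (v : V) := PathClass v v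

/-- A graph is connected if any two vertices are joined by an edge-path. -/
def IsConnectedGraph (V : Type*) [Quiver V] : Prop :=
  ∀ a b : V, Nonempty (EdgePath a b)

/-- A morphism of a graph to itself: vertices go to vertices and each edge is mapped across an
edge-path (possibly with backtracking, possibly trivial). -/
structure GraphMorphism (V : Type*) [Quiver V] where
  onV : V → V
  onE : ∀ {a b : V}, (a ⟶ b) → EdgePath (onV a) (onV b)

/-- The functor induced by a morphism on the fundamental groupoid. -/
def GraphMorphism.functor (f : GraphMorphism V) :
    Quiver.FreeGroupoid V ⥤ Quiver.FreeGroupoid V :=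
  Quiver.FreeGroupoid.lift
    { obj := fun a => vtx (f.onV a)
      map := fun e => (f.onE e).cls }

/-- A homotopy between morphisms of graphs is the choice, for every vertex `v`, of a homotopy class
`h v` of paths from `f v` to `g v` such that `f e · h (t e) = h (o e) · g e` up to homotopy rel
endpoints for all edges `e`: a natural isomorphism between the induced functors. This definition
says that `f` has a homotopy inverse. -/
def GraphMorphism.IsHomotopyEquiv (f : GraphMorphism V) : Prop :=
  ∃ g : GraphMorphism V,
    Nonempty (f.functor ⋙ g.functor ≅ 𝟭 (Quiver.FreeGroupoid V)) ∧
      Nonempty (g.functor ⋙ f.functor ≅ 𝟭 (Quiver.FreeGroupoid V))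

/-- A morphism that is a homotopy equivalence and fixes the vertex `base`. -/
structure BasedHomotopyEquiv (V : Type*) [Quiver V] extends GraphMorphism V where
  base : V
  base_fixed : onV base = base
  isHomotopyEquiv : toGraphMorphism.IsHomotopyEquiv

/-- A subgraph: a set of vertices and a set of edges with endpoints among these vertices. -/
structure Subgraph (V : Type*) [Quiver V] where
  verts : Set V
  edges : Set (Quiver.Total V)
  left_mem : ∀ e ∈ edges, e.left ∈ verts
  right_mem : ∀ e ∈ edges, e.right ∈ verts

/-- `f(H) ⊆ H`. -/
def Subgraph.IsInvariant (H : Subgraph V) (f : GraphMorphism V) : Prop :=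
  (∀ v ∈ H.verts, f.onV v ∈ H.verts) ∧ ∀ e ∈ H.edges, (f.onE e.hom).edges ⊆ H.edges

namespace BasedHomotopyEquiv

variable (f : BasedHomotopyEquiv V)

/-- The free group `𝔽 = π₁(Γ, ∗)`. -/
abbrev F := PiOne f.base

lemma functor_obj_base : f.functor.obj (vtx f.base) = vtx f.base :=
  congrArg vtx f.base_fixed

/-- The effect of `f` on classes of paths that start at the fixed vertex `∗`. -/
def mapFromBase {v : V} (p : PathClass f.base v) : PathClass f.base (f.onV v) :=
  eqToHom f.functor_obj_base.symm ≫ f.functor.map p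

/-- The endomorphism of `𝔽` induced by `f` and the trivial path at `∗`. -/
def phiHom : f.F →* f.F where
  toFun g := eqToHom f.functor_obj_base.symm ≫ f.functor.map g ≫ eqToHom f.functor_obj_base
  map_one' := by
    simp [Groupoid.vertexGroup_one]
  map_mul' g h := by
    simp [Groupoid.vertexGroup_mul]

lemma phiHom_bijective : Function.Bijective f.phiHom := by
  obtain ⟨g, ⟨α⟩, ⟨β⟩⟩ := f.isHomotopyEquiv
  have hf : f.functor.IsEquivalence :=
    (CategoryTheory.Equivalence.mk f.functor g.functor α.symm β).isEquivalence_functor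
  constructor
  · intro a b hab
    apply f.functor.map_injective
    simp only [phiHom, MonoidHom.coe_mk, OneHom.coe_mk] at hab
    exact (cancel_mono _).1 ((cancel_epi _).1 hab)
  · intro b
    obtain ⟨a, ha⟩ := f.functor.map_surjective
      (eqToHom f.functor_obj_base ≫ b ≫ eqToHom f.functor_obj_base.symm)
    refine ⟨a, ?_⟩
    simp [phiHom, ha]

/-- The automorphism `Φ_f` of `𝔽` induced by `f` and the trivial path at `∗`. -/
def Phi : MulAut f.F := MulEquiv.ofBijective f.phiHom f.phiHom_bijective

/-- The free-by-cyclic group `G_φ = 𝔽 ⋊ ⟨t⟩`, with `t⁻¹ x t = Φ_f x` for `x ∈ 𝔽`. -/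
abbrev G := f.F ⋊[zpowersHom (MulAut f.F) f.Phi⁻¹] Multiplicative ℤ

/-- The stable letter `t` of `G_φ`. -/
def t : f.G := SemidirectProduct.inr (Multiplicative.ofAdd 1)

lemma t_inv_mul_mul_t (x : f.F) :
    f.t⁻¹ * SemidirectProduct.inl x * f.t = SemidirectProduct.inl (f.Phi x) := by
  have h := SemidirectProduct.inl_aut_inv (φ := zpowersHom (MulAut f.F) f.Phi⁻¹)
    (Multiplicative.ofAdd (1 : ℤ)) x
  simp at h
  rw [t, h]

/-! ## The universal cover and its chains -/

/-- Vertices of the universal cover: homotopy classes of edge-paths that start at `∗`. -/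
abbrev CoverVertex := Σ v : V, PathClass f.base v

/-- Edges of the universal cover: an edge `e` of the graph together with a lift of its initial
vertex. -/
abbrev CoverEdge := Σ e : Quiver.Total V, PathClass f.base e.left

/-- The initial vertex of an edge of the universal cover. -/
def origin (e : f.CoverEdge) : f.CoverVertex := ⟨e.1.left, e.2⟩

/-- The terminal vertex of an edge of the universal cover. -/
def terminus (e : f.CoverEdge) : f.CoverVertex :=
  ⟨e.1.right, e.2 ≫ edgeClass e.1.hom⟩

/-- The action of `𝔽` on the edges of the universal cover by deck transformations. -/
def edgeAct (g : f.F) (e : f.CoverEdge) : f.CoverEdge := ⟨e.1, g ≫ e.2⟩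

/-- The lift of `f` to the universal cover that fixes the lift of `∗`, on vertices. -/
def fTilde (v : f.CoverVertex) : f.CoverVertex := ⟨f.onV v.1, f.mapFromBase v.2⟩

/-- Rational cellular 0-chains of the universal cover. -/
abbrev C0 := f.CoverVertex →₀ ℚ

/-- Rational cellular 1-chains of the universal cover. -/
abbrev C1 := f.CoverEdge →₀ ℚ

/-- The boundary map, `∂ e = t(e) - o(e)`. -/
def boundary : f.C1 →ₗ[ℚ] f.C0 :=
  Finsupp.linearCombination ℚ fun e =>
    Finsupp.single (f.terminus e) (1 : ℚ) - Finsupp.single (f.origin e) (1 : ℚ)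

/-- The action of `g ∈ 𝔽` on 1-chains. -/
def chainAct (g : f.F) : f.C1 →ₗ[ℚ] f.C1 := Finsupp.lmapDomain ℚ ℚ (f.edgeAct g)

/-- The 1-chain of the lift to the universal cover of an edge-path, starting at the vertex given
by `p`: each edge of the lifted path contributes `1` or `-1` according to its direction. -/
def pathChain {a : V} (p : PathClass f.base a) : {b : V} → EdgePath a b → f.C1
  | _, .nil => 0
  | _, .pos q e => pathChain p q + Finsupp.single ⟨⟨_, _, e⟩, p ≫ q.cls⟩ 1
  | _, .neg q e => pathChain p q - Finsupp.single ⟨⟨_, _, e⟩, p ≫ q.cls ≫ inv (edgeClass e)⟩ 1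

/-- The map `A_f` induced by the lift of `f` on 1-chains. -/
def chainMap : f.C1 →ₗ[ℚ] f.C1 :=
  Finsupp.linearCombination ℚ fun e => f.pathChain (f.mapFromBase e.2) (f.onE e.1.hom)

/-! ## Relative chains -/

variable (H : Subgraph V)

/-- The edges of the universal cover that are not lifts of edges of `H`. -/
def relCoverEdges : Set f.CoverEdge := {e | e.1 ∉ H.edges}

/-- The relative 1-chains: those that vanish on all lifts of edges of `H`. -/
abbrev RelC1 : Submodule ℚ f.C1 := Finsupp.supported ℚ ℚ (f.relCoverEdges H)

/-- The projection of 1-chains to relative 1-chains that forgets the lifts of edges of `H`. -/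
def relProj : f.C1 →ₗ[ℚ] f.RelC1 H :=
  letI := Classical.decPred (· ∈ f.relCoverEdges H)
  Finsupp.restrictDom ℚ ℚ (f.relCoverEdges H)

/-- The map `A_{f,H}` on relative 1-chains. -/
def relChainMap : f.RelC1 H →ₗ[ℚ] f.RelC1 H :=
  f.relProj H ∘ₗ f.chainMap ∘ₗ (f.RelC1 H).subtype

/-- The action of `g ∈ 𝔽` on relative 1-chains. -/
def relAct (g : f.F) : f.RelC1 H →ₗ[ℚ] f.RelC1 H :=
  (f.chainAct g).restrict (fun x hx => by
    classical
    rw [Finsupp.mem_supported] at hx ⊢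
    intro e he
    obtain ⟨e', he', rfl⟩ := Finset.mem_image.1 (Finsupp.mapDomain_support he)
    exact (show e' ∈ f.relCoverEdges H from hx he'))

variable {f H}

/-- The set of edges on which a relative 1-chain is non-zero. -/
def supp (x : f.RelC1 H) : Set f.CoverEdge := ↑(x : f.C1).support

/-- The inner product of relative 1-chains. -/
def chainInner (x y : f.RelC1 H) : ℝ :=
  ∑ e ∈ (x : f.C1).support, ((x : f.C1) e : ℝ) * ((y : f.C1) e : ℝ)

/-- The `L²`-norm of relative 1-chains. -/
def chainNorm (x : f.RelC1 H) : ℝ := √(chainInner x x)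

variable (f H)

/-! ## Nielsen 1-chains and the chain flare condition -/

/-- `ρ` is the image of the chain `[u, v]` for two vertices `u, v` of the universal cover that are
fixed by the lift of `f`; here `[u, v]` is the 1-chain with boundary `v - u`. -/
def IsFixedSegment (ρ : f.RelC1 H) : Prop :=
  ∃ u v : f.CoverVertex, u ≠ v ∧ f.fTilde u = u ∧ f.fTilde v = v ∧
    ∃ c : f.C1, f.boundary c = Finsupp.single v 1 - Finsupp.single u 1 ∧ ρ = f.relProj H c

/-- Non-geometric Nielsen 1-chains. -/
def IsNonGeometricNielsen (ρ : f.RelC1 H) : Prop :=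
  f.IsFixedSegment H ρ ∧
    ∃ e ∈ f.relCoverEdges H, ((ρ : f.C1) e = 1 ∨ (ρ : f.C1) e = -1) ∧
      ∀ g : f.F, g ≠ 1 → (ρ : f.C1) (f.edgeAct g e) = 0

/-- Geometric Nielsen 1-chains. -/
structure IsGeometricNielsen (ρ : f.RelC1 H) : Prop where
  fixedSegment : f.IsFixedSegment H ρ
  single : ∀ g₁ g₂ : f.F, g₁ ≠ g₂ →
    supp (f.relAct H g₁ ρ) ∩ supp (f.relAct H g₂ ρ) = ∅ ∨
      ∃ e, supp (f.relAct H g₁ ρ) ∩ supp (f.relAct H g₂ ρ) = {e}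
  pair : ∀ e ∈ f.relCoverEdges H, ∃ g₁ g₂ : f.F, g₁ ≠ g₂ ∧
    supp (f.relAct H g₁ ρ) ∩ supp (f.relAct H g₂ ρ) = {e} ∧
      ∀ h₁ h₂ : f.F, h₁ ≠ h₂ → supp (f.relAct H h₁ ρ) ∩ supp (f.relAct H h₂ ρ) = {e} →
        ({h₁, h₂} : Set f.F) = {g₁, g₂}
  noncommuting : ∃ g₁ g₂ : f.F, g₁ * g₂ ≠ g₂ * g₁ ∧
    (supp ρ ∩ supp (f.relAct H g₁ ρ)).Nonempty ∧ (supp ρ ∩ supp (f.relAct H g₂ ρ)).Nonempty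

/-- Nielsen 1-chains. -/
def IsNielsen (ρ : f.RelC1 H) : Prop := f.IsNonGeometricNielsen H ρ ∨ f.IsGeometricNielsen H ρ

/-- The relative 1-chains that make a small angle with an element of `S`. -/
def angleNhd (θ : ℝ) (S : Set (f.RelC1 H)) : Set (f.RelC1 H) :=
  {x' | ∃ x ∈ S, θ * chainNorm x * chainNorm x' < chainInner x x'}

/-- `N^∞`, the union of the sets `A_{f,H}^k(N)` over all integers `k`; for negative `k` these are
preimages. -/
def saturate (N : Set (f.RelC1 H)) : Set (f.RelC1 H) :=
  {x' | ∃ k : ℕ, (∃ x ∈ N, x' = (f.relChainMap H ^ k) x) ∨ (f.relChainMap H ^ k) x' ∈ N}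

/-- The chain flare condition of `f` relative to `H`, for a given hyperbolic submodule `Vh` and a
given quasi-fixed submodule `Vqf`. A `ℚ[𝔽]`-submodule is an `𝔽`-invariant `ℚ`-subspace. -/
structure ChainFlare (Vh Vqf : Submodule ℚ (f.RelC1 H)) : Prop where
  hyperbolic_invariant : ∀ (g : f.F), ∀ x ∈ Vh, f.relAct H g x ∈ Vh
  quasiFixed_invariant : ∀ (g : f.F), ∀ x ∈ Vqf, f.relAct H g x ∈ Vqf
  sum_eq_top : Vh ⊔ Vqf = ⊤
  flare : ∃ lam θ : ℝ, 1 < lam ∧ 0 < θ ∧ θ < 1 ∧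
    ∀ x ∈ f.saturate H (f.angleNhd H θ Vh),
      lam * chainNorm (f.relChainMap H x) ≤
        max (chainNorm (f.relChainMap H (f.relChainMap H x))) (chainNorm x)
  generated : Vqf ≠ ⊥ → ∃ ρ : f.RelC1 H, f.IsNielsen H ρ ∧
    Vqf = Submodule.span ℚ (Set.range fun g : f.F => f.relAct H g ρ)

end BasedHomotopyEquiv

end Graphs

/-! ## Square summable functions and Hilbert modules -/

section L2

/-- The Hilbert space of square summable complex functions on `X`. -/
abbrev L2 (X : Type*) := lp (fun _ : X => ℂ) 2

/-- The basis vector at `x`. -/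
def delta {X : Type*} (x : X) : L2 X :=
  letI := Classical.decEq X
  lp.single 2 x (1 : ℂ)

lemma orthonormal_delta (X : Type*) : Orthonormal ℂ (delta : X → L2 X) := by
  classical
  rw [orthonormal_iff_ite]
  intro i j
  have : delta i = lp.single (E := fun _ : X => ℂ) 2 i (1 : ℂ) := by
    unfold delta; congr
  rw [this, lp.inner_single_left]
  have : delta j = lp.single (E := fun _ : X => ℂ) 2 j (1 : ℂ) := by
    unfold delta; congr
  rw [this, lp.single_apply]
  by_cases h : i = j
  · subst h; simp
  · simp [h]

/-- The isometry of `L²`-spaces that sends the basis vector at `x` to the one at `σ x`. -/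
def pushforward {X Y : Type*} (σ : X → Y) (hσ : Function.Injective σ) : L2 X →ₗᵢ[ℂ] L2 Y :=
  (((orthonormal_delta Y).comp σ hσ).orthogonalFamily).linearIsometry

lemma pushforward_delta {X Y : Type*} (σ : X → Y) (hσ : Function.Injective σ) (x : X) :
    pushforward σ hσ (delta x) = delta (σ x) := by
  classical
  have : delta x = lp.single (E := fun _ : X => ℂ) 2 x (1 : ℂ) := by
    unfold delta; congr
  rw [this, pushforward, OrthogonalFamily.linearIsometry_apply_single]
  simp

variable {G : Type*} [Group G] {ι : Type*} [Fintype ι]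

/-- The Hilbert space `L²(G)^n`, with `n` the number of elements of `ι`. -/
abbrev L2pow (G : Type*) (ι : Type*) [Fintype ι] := PiLp 2 (fun _ : ι => L2 G)

/-- The vector of `L²(G)^n` with entry the basis vector at the identity in place `i`. -/
def unitVec (G : Type*) [Group G] {ι : Type*} [Fintype ι] (i : ι) : L2pow G ι :=
  letI := Classical.decEq ι
  PiLp.single 2 i (delta (1 : G))

/-- The left action of `g` on `L²(G)`. -/
def leftMul (g : G) : L2 G →L[ℂ] L2 G :=
  (pushforward (g * ·) (mul_right_injective g)).toContinuousLinearMap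

/-- Right multiplication by `a ∈ ℂ[G]` on `L²(G)`. -/
def rightMul (a : MonoidAlgebra ℂ G) : L2 G →L[ℂ] L2 G :=
  a.coeff.sum fun g c =>
    c • (pushforward (· * g) (mul_left_injective g)).toContinuousLinearMap

/-- The operator `(ξ_i)_i ↦ (∑ i, T i j (ξ_i))_j`. -/
def matrixOp {X Y κ : Type*} [Fintype κ] (T : ι → κ → L2 X →L[ℂ] L2 Y) :
    L2pow X ι →L[ℂ] L2pow Y κ :=
  ((PiLp.continuousLinearEquiv 2 ℂ (fun _ : κ => L2 Y)).symm :
      (κ → L2 Y) →L[ℂ] L2pow Y κ) ∘L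
    ContinuousLinearMap.pi
      (fun j => ∑ i, T i j ∘L ContinuousLinearMap.proj (R := ℂ) (φ := fun _ : ι => L2 X) i) ∘L
    ((PiLp.continuousLinearEquiv 2 ℂ (fun _ : ι => L2 X)) : L2pow X ι →L[ℂ] (ι → L2 X))

/-- Right multiplication by a matrix over `ℂ[G]` on (row vectors in) `L²(G)^n`. -/
def rightMulMatrix (M : Matrix ι ι (MonoidAlgebra ℂ G)) : L2pow G ι →L[ℂ] L2pow G ι :=
  matrixOp fun i j => rightMul (M i j)

/-- The restriction of an operator to an invariant subspace. -/
def restrictOp {E : Type*} [NormedAddCommGroup E] [NormedSpace ℂ E] (T : E →L[ℂ] E)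
    (W : Submodule ℂ E) (h : ∀ w ∈ W, T w ∈ W) : W →L[ℂ] W :=
  (T ∘L W.subtypeL).codRestrict W fun w => h w w.2

/-- An operator applied in each coordinate. -/
def diagOp {X Y : Type*} (T : L2 X →L[ℂ] L2 Y) : L2pow X ι →L[ℂ] L2pow Y ι :=
  letI := Classical.decEq ι
  matrixOp fun i j => if i = j then T else 0

end L2

/-! ## The Fuglede–Kadison determinant

A Hilbert `G`-module is given by a Hilbert space `U` with an isometric embedding `j` onto a
`G`-invariant subspace of some `L²(G)^n`. -/

section Determinant

variable {G : Type*} [Group G] {ι : Type*} [Fintype ι]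
variable {U : Type*} [NormedAddCommGroup U] [InnerProductSpace ℂ U] [CompleteSpace U]
variable {U' : Type*} [NormedAddCommGroup U'] [InnerProductSpace ℂ U'] [CompleteSpace U']

/-- The von Neumann trace of an operator `T` on `U`: the sum of the diagonal entries
`⟨T' 1_i, 1_i⟩`, for `T'` the operator on `L²(G)^n` that is `T` on the image of `U` and `0` on its
orthogonal complement. -/
def vnTrace (j : U →ₗᵢ[ℂ] L2pow G ι) (T : U →L[ℂ] U) : ℂ :=
  ∑ i : ι, inner ℂ (unitVec G i)
    (j (T (ContinuousLinearMap.adjoint j.toContinuousLinearMap (unitVec G i))))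

/-- The spectral family of a self-adjoint operator: the orthogonal projection onto the kernel of the
positive part of `T - c`, which is the spectral projection of `T` for `(-∞, c]`. -/
def spectralProj (T : U →L[ℂ] U) (c : ℝ) : U →L[ℂ] U :=
  (LinearMap.ker (cfc (fun s : ℝ => max (s - c) 0) T : U →L[ℂ] U).toLinearMap).starProjection

/-- The spectral density function `F_A(r) = Tr_G(E^{A* A}_{r²})` of an operator, extended by `0` to
negative `r`. -/
def spectralDensity (j : U →ₗᵢ[ℂ] L2pow G ι) (A : U →L[ℂ] U') (r : ℝ) : ℝ :=
  if r < 0 then 0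
  else (vnTrace j (spectralProj (ContinuousLinearMap.adjoint A ∘L A) (r ^ 2))).re

lemma vnTrace_starProjection (j : U →ₗᵢ[ℂ] L2pow G ι) (K : Submodule ℂ U)
    [K.HasOrthogonalProjection] :
    (vnTrace j K.starProjection).re = ∑ i : ι, ‖K.starProjection
      (ContinuousLinearMap.adjoint j.toContinuousLinearMap (unitVec G i))‖ ^ 2 := by
  rw [vnTrace, Complex.re_sum]
  refine Finset.sum_congr rfl fun i _ => ?_
  have h := ContinuousLinearMap.adjoint_inner_left j.toContinuousLinearMap
    (K.starProjection (ContinuousLinearMap.adjoint j.toContinuousLinearMap (unitVec G i)))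
    (unitVec G i)
  rw [LinearIsometry.coe_toContinuousLinearMap] at h
  rw [← h]
  generalize ContinuousLinearMap.adjoint j.toContinuousLinearMap (unitVec G i) = x
  have h2 : inner ℂ x (K.starProjection x) =
      inner ℂ (K.starProjection x) (K.starProjection x) := by
    rw [K.inner_starProjection_left_eq_right,
      Submodule.starProjection_eq_self_iff.2 (K.starProjection_apply_mem x)]
  rw [h2, inner_self_eq_norm_sq_to_K]
  norm_cast

lemma spectralKer_mono (T : U →L[ℂ] U) {c d : ℝ} (h : c ≤ d) :
    LinearMap.ker (cfc (fun s : ℝ => max (s - c) 0) T : U →L[ℂ] U).toLinearMap ≤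
      LinearMap.ker (cfc (fun s : ℝ => max (s - d) 0) T : U →L[ℂ] U).toLinearMap := by
  rcases h.eq_or_lt with rfl | h
  · exact le_rfl
  intro x hx
  have hpos : ∀ s : ℝ, max (s - c) (d - c) ≠ 0 := fun s =>
    (lt_of_lt_of_le (sub_pos.2 h) (le_max_right _ _)).ne'
  have hg : Continuous fun s : ℝ => max (s - d) 0 / max (s - c) (d - c) :=
    Continuous.div (by fun_prop) (by fun_prop) hpos
  have key : (fun s : ℝ => max (s - d) 0) =
      fun s => (max (s - d) 0 / max (s - c) (d - c)) * max (s - c) 0 := by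
    funext s
    rcases le_total s d with hs | hs
    · simp [max_eq_right (sub_nonpos.2 hs)]
    · have hc : (0 : ℝ) < s - c := by linarith
      rw [max_eq_left (sub_nonneg.2 hs), max_eq_left (by linarith : d - c ≤ s - c),
        max_eq_left hc.le]
      field_simp
  have hx' : (cfc (fun s : ℝ => max (s - c) 0) T : U →L[ℂ] U) x = 0 := hx
  change (cfc (fun s : ℝ => max (s - d) 0) T : U →L[ℂ] U) x = 0
  rw [key, cfc_mul _ _ T hg.continuousOn (by fun_prop), mul_apply_eq_comp, hx',
    map_zero]

lemma spectralDensity_mono (j : U →ₗᵢ[ℂ] L2pow G ι) (A : U →L[ℂ] U') :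
    Monotone (spectralDensity j A) := by
  intro r s hrs
  unfold spectralDensity
  split_ifs with h1 h2
  · exact le_rfl
  · rw [spectralProj, vnTrace_starProjection]
    positivity
  · exact absurd (hrs.trans_lt ‹s < 0›) h1
  · rw [spectralProj, spectralProj, vnTrace_starProjection, vnTrace_starProjection]
    refine Finset.sum_le_sum fun i _ => ?_
    have hle := spectralKer_mono (ContinuousLinearMap.adjoint A ∘L A)
      (pow_le_pow_left₀ (not_lt.1 h1) hrs 2)
    rw [← Submodule.starProjection_comp_starProjection_of_le hle]
    gcongr
    exact Submodule.norm_starProjection_apply_le _ _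

/-- The measure `dF_A`. (`F_A` is right-continuous.) -/
def spectralDensityMeasure (j : U →ₗᵢ[ℂ] L2pow G ι) (A : U →L[ℂ] U') : Measure ℝ :=
  (spectralDensity_mono j A).stieltjesFunction.measure

open Classical in
/-- The Fuglede–Kadison determinant `exp ∫_{0+}^∞ log r dF_A(r)` if the integral exists, and `0`
otherwise. -/
def fkDet (j : U →ₗᵢ[ℂ] L2pow G ι) (A : U →L[ℂ] U') : ℝ :=
  if IntegrableOn Real.log (Set.Ioi 0) (spectralDensityMeasure j A) then
    Real.exp (∫ r in Set.Ioi 0, Real.log r ∂(spectralDensityMeasure j A))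
  else 0

/-- The embedding of `L²(G)` in `L²(G)^1`. -/
def regularEmbedding (G : Type*) : L2 G →ₗᵢ[ℂ] L2pow G Unit where
  toFun ξ := WithLp.toLp 2 fun _ => ξ
  map_add' _ _ := rfl
  map_smul' _ _ := rfl
  norm_map' ξ := by
    rw [PiLp.norm_eq_of_L2]
    simp only [Finset.univ_unique, Finset.sum_singleton]
    exact Real.sqrt_sq (norm_nonneg ξ)

end Determinant

/-! ## Induction from a subgroup -/

/-- Right multiplication by `1 - t^k` on `L²(⟨t⟩)`, for the cyclic subgroup `⟨t⟩` of `G`. -/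
def cyclicOp {G : Type*} [Group G] (t : G) (k : ℕ) :
    L2 (Subgroup.zpowers t) →L[ℂ] L2 (Subgroup.zpowers t) :=
  rightMul (1 - MonoidAlgebra.single (⟨t, Subgroup.mem_zpowers t⟩ ^ k : Subgroup.zpowers t) 1)

/-- For a subgroup `K` of `G`, the induced module of `L²(K)` is `L²(G)`, and the induced morphism
of `P` is the unique bounded `G`-equivariant operator that extends `P`. -/
def IsInduced {G : Type*} [Group G] (K : Subgroup G) (P : L2 K →L[ℂ] L2 K) (Q : L2 G →L[ℂ] L2 G) :
    Prop :=
  (∀ (g : G) (ξ : L2 G), Q (leftMul g ξ) = leftMul g (Q ξ)) ∧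
    ∀ ξ : L2 K, Q (pushforward (fun x : K => (x : G)) Subtype.val_injective ξ) =
      pushforward (fun x : K => (x : G)) Subtype.val_injective (P ξ)

/-! ## The operator `L_{f,H}` and the induced quasi-fixed subspace -/

section Operators

variable {V : Type*} [Quiver V] [Finite (Quiver.Total V)]

/-- The edges of the graph outside `H`; there are `n_H` of them. -/
abbrev RelEdge (H : Subgraph V) := {e : Quiver.Total V // e ∉ H.edges}

instance (H : Subgraph V) : Fintype (RelEdge H) := Fintype.ofFinite _

namespace BasedHomotopyEquiv

variable (f : BasedHomotopyEquiv V) (H : Subgraph V)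

/-- A choice of a lift to the universal cover of every edge outside `H`. These lifts form a basis of
the relative 1-chains as a `ℚ[𝔽]`-module. -/
abbrev LiftChoice := ∀ e : RelEdge H, PathClass f.base e.1.left

variable {f H} (lift : f.LiftChoice H)

/-- The chosen lift of an edge, as a relative 1-chain. -/
def basisChain (e : RelEdge H) : f.RelC1 H :=
  ⟨Finsupp.single ⟨e.1, lift e⟩ 1, by
    rw [Finsupp.mem_supported]
    intro e' he'
    have := Finsupp.support_single_subset he'
    simp only [Finset.mem_singleton] at this
    subst this
    exact e.2⟩

/-- The coordinates in `ℂ[𝔽]` of a relative 1-chain with respect to the chosen lifts: the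
coefficient of `g` in coordinate `e` is the coefficient of the chain at the `g`-translate of the
chosen lift of `e`. -/
def coords (x : f.RelC1 H) (e : RelEdge H) : MonoidAlgebra ℂ f.F :=
  .ofCoeff (((x : f.C1).comapDomain (fun g : f.F => f.edgeAct g ⟨e.1, lift e⟩) (by
    intro g _ h _ hgh
    simp only [edgeAct, Sigma.mk.injEq, heq_eq_eq, true_and] at hgh
    exact (cancel_mono _).1 hgh)).mapRange (fun q : ℚ => (q : ℂ)) Rat.cast_zero)

/-- A relative 1-chain as an element of `L²(𝔽)^{n_H}`. -/
def toL2 (x : f.RelC1 H) : L2pow f.F (RelEdge H) :=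
  WithLp.toLp 2 fun e => (coords lift x e).coeff.sum fun g c => c • delta g

/-- The Jacobian: row `i` records the coordinates of `A_{f,H}` of the `i`-th basis element. -/
def jacobian : Matrix (RelEdge H) (RelEdge H) (MonoidAlgebra ℂ f.F) :=
  fun i j => coords lift (f.relChainMap H (basisChain lift i)) j

/-- The operator `L_{f,H}`: right multiplication by `t J` on `L²(G_φ)^{n_H}`. -/
def opL : L2pow f.G (RelEdge H) →L[ℂ] L2pow f.G (RelEdge H) :=
  rightMulMatrix fun i j =>
    MonoidAlgebra.single f.t 1 *
      MonoidAlgebra.mapDomain (SemidirectProduct.inl : f.F →* f.G) (jacobian lift i j)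

/-- `V^{(2)}`: the closure in `L²(𝔽)^{n_H}` of the complex span of a submodule `W` of the relative
1-chains. -/
def completed (W : Submodule ℚ (f.RelC1 H)) : Submodule ℂ (L2pow f.F (RelEdge H)) :=
  (Submodule.span ℂ (toL2 lift '' W)).topologicalClosure

/-- The inclusion of `L²(𝔽)^{n_H}` in `L²(G_φ)^{n_H}`. -/
def inclF : L2pow f.F (RelEdge H) →L[ℂ] L2pow f.G (RelEdge H) :=
  diagOp (pushforward (SemidirectProduct.inl : f.F →* f.G)
    SemidirectProduct.inl_injective).toContinuousLinearMap

/-- `W^{(2)}`: the closure of the sum of the translates `t^ℓ V^{(2)}` in `L²(G_φ)^{n_H}`. -/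
def inducedSpace (W : Submodule ℚ (f.RelC1 H)) : Submodule ℂ (L2pow f.G (RelEdge H)) :=
  (⨆ l : ℤ, (completed lift W).map
    ((diagOp (leftMul (f.t ^ l)) : L2pow f.G (RelEdge H) →L[ℂ] L2pow f.G (RelEdge H)) ∘L
      (inclF : L2pow f.F (RelEdge H) →L[ℂ] L2pow f.G (RelEdge H))).toLinearMap).topologicalClosure

instance (W : Submodule ℚ (f.RelC1 H)) : CompleteSpace (inducedSpace lift W) :=
  inferInstanceAs (CompleteSpace (Submodule.topologicalClosure _))

end BasedHomotopyEquiv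

end Operators

end FreeByCyclic

end

open CategoryTheory MeasureTheory

noncomputable section

namespace FreeByCyclic

/-! ### Words in the edges: the fundamental groupoid of a connected graph inside a free group -/

section Words

variable {V : Type*} [Quiver V]

/-! If $V_{\rm qf}=0$, every operator in sight is zero on the zero space and has determinant $1$.
Otherwise $V_{\rm qf}$ is generated by a Nielsen chain $\rho$, and everything follows from one
intertwining relation.

The universal cover is a tree, so a chain is determined by its boundary, and $[u,v]$ is fixed by
$\tilde f_*$ when $\tilde f$ fixes $u$ and $v$. Since $f(H)\subseteq H$, this descends to
$A_{f,H}\rho=\rho$ (`relChainMap_fixedSegment`). On a relative chain $x$ the operator $L$ acts by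
$x\mapsto t\cdot A_{f,H}x$ (`opL_emb`). Hence the orbit operator $\delta_g\mapsto g\rho$ from
$L^2(G_\phi)$ turns right translation by $t$ into $L$ (`opL_orbitOp`), and $I-L^k$ is conjugate to
$1-R_{t^k}$ as soon as the orbit operator is an isomorphism onto $W^{(2)}_{\rm qf}$.

For that it must be bounded below; its range is then closed and equal to $W^{(2)}_{\rm qf}$. For a
non-geometric $\rho$ one coordinate of the operator is, up to sign, a translation, hence isometric.
For a geometric $\rho$ some coordinates are sums of two signed translations. By the reverse triangle
inequality, a small image of $\xi$ makes $|\xi|$ almost invariant under two non-commuting elements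
of $\mathbb F$. These generate a non-abelian free group, which has a paradoxical set, so $\xi$
itself is small (`exists_spectral_gap`).

It remains to see that an operator similar to $1-R_h$, with $h$ of infinite order, has determinant
$1$ (`fkDet_eq_one_of_similar`). By polar decomposition it is unitarily equivalent to
$B=S(1-u)S^{-1}$ in the group von Neumann algebra, with $S$ positive. Let $\tau$ be the trace. The
quantity $\tau\log(B^*B+\varepsilon)$ lies between the values
$\tau\log((1-u)(1-u)^*+c\,\varepsilon)$ for two constants $c>0$: the logarithm is operator monotone,
conjugation by $S$ shifts $\tau\log$ by a constant, and the shifts from $S$ and $S^{-1}$ cancel. The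
bounds are explicit, $2\,\mathrm{arsinh}(\sqrt{c\varepsilon}/2)$, and tend to $0$. Passing to the
limit in the spectral measure gives $\int\log=0$ (`fkDet_eq_one_of_tendsto`). -/

/-- Induction along the last edge for homotopy classes of edge-paths. -/
theorem PathClass.induction {a : V} {P : ∀ b : V, PathClass a b → Prop}
    (hid : P a (𝟙 (vtx a)))
    (hpos : ∀ (b c : V) (p : PathClass a b) (e : b ⟶ c), P b p → P c (p ≫ edgeClass e))
    (hneg : ∀ (b c : V) (p : PathClass a b) (e : c ⟶ b), P b p → P c (p ≫ inv (edgeClass e)))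
    {b : V} (p : PathClass a b) : P b p := by
  induction p using Quot.inductionOn with
  | h q =>
    change Quiver.Path (V := Quiver.Symmetrify V) a b at q
    induction q with
    | nil => exact hid
    | @cons c d q s ih =>
      rcases s with e | e
      · exact hpos c d _ e ih
      · have := hneg c d _ e ih
        rw [← Groupoid.inv_eq_inv] at this
        exact this

/-- The functor from the fundamental groupoid that labels the edges by the inverses of the
generators of the free group on the set of all edges. -/
def wordFunctor (V : Type*) [Quiver V] :
    Quiver.FreeGroupoid V ⥤ SingleObj (FreeGroup (Quiver.Total V)) :=
  Quiver.FreeGroupoid.lift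
    { obj := fun _ => SingleObj.star _
      -- Composition in `SingleObj` is multiplication in reverse order; the inverse here and the one
      -- in `word` together make `word` multiplicative.
      map := fun {a b} e => ((FreeGroup.of (⟨a, b, e⟩ : Quiver.Total V))⁻¹ :
        FreeGroup (Quiver.Total V)) }

/-- The word in the edges read along a homotopy class of edge-paths. -/
def word {a b : V} (p : PathClass a b) : FreeGroup (Quiver.Total V) :=
  (show FreeGroup (Quiver.Total V) from (wordFunctor V).map p)⁻¹

lemma word_id (a : V) : word (𝟙 (vtx a)) = 1 := by
  unfold word
  rw [CategoryTheory.Functor.map_id]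
  exact inv_one

lemma word_comp {a b c : V} (p : PathClass a b) (q : PathClass b c) :
    word (p ≫ q) = word p * word q := by
  unfold word
  rw [CategoryTheory.Functor.map_comp]
  exact mul_inv_rev _ _

lemma lift_map_edgeClass {C : Type*} [Groupoid C] (φ : V ⥤q C) {a b : V} (e : a ⟶ b) :
    (Quiver.FreeGroupoid.lift φ).map (edgeClass e) = φ.map e :=
  Category.id_comp _

lemma word_edgeClass {a b : V} (e : a ⟶ b) : word (edgeClass e) = FreeGroup.of ⟨a, b, e⟩ := by
  unfold word wordFunctor
  erw [lift_map_edgeClass]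
  exact inv_inv _

lemma word_inv {a b : V} (p : PathClass a b) : word (inv p) = (word p)⁻¹ := by
  rw [eq_inv_iff_mul_eq_one, ← word_comp, IsIso.inv_hom_id, word_id]

/-- The homotopy class of a path, closed up to a loop at `o` by means of the paths `γ`. -/
def closeUp {o : V} (γ : ∀ v : V, PathClass o v) {a b : V} (p : PathClass a b) : PiOne o :=
  γ a ≫ p ≫ inv (γ b)

open Classical in
/-- The permutation of `V × π₁` given by an edge. -/
def edgePerm {o : V} (γ : ∀ v : V, PathClass o v) (e : Quiver.Total V) :
    Equiv.Perm (V × PiOne o) :=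
  -- Only the effect on the fibre over `e.left` matters. The swap and the identity elsewhere
  -- complete this partial map to a permutation, so that the free group can act.
  (Equiv.prodShear (Equiv.refl V) fun v =>
      if v = e.left then Equiv.mulRight (closeUp γ (edgeClass e.hom)) else Equiv.refl _).trans
    (Equiv.prodCongr (Equiv.swap e.left e.right) (Equiv.refl _))

lemma edgePerm_apply {o : V} (γ : ∀ v : V, PathClass o v) {a b : V} (e : a ⟶ b) (x : PiOne o) :
    edgePerm γ ⟨a, b, e⟩ (a, x) = (b, x * closeUp γ (edgeClass e)) := by
  simp [edgePerm, Equiv.prodShear]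

/-- The action of words on `V × π₁`. -/
def wordAction {o : V} (γ : ∀ v : V, PathClass o v) :
    FreeGroup (Quiver.Total V) →* (Equiv.Perm (V × PiOne o))ᵐᵒᵖ :=
  FreeGroup.lift fun e => MulOpposite.op (edgePerm γ e)

/-- Letting the word act recovers the loop `γ a ≫ p ≫ inv (γ b)`, so the word alone determines the
homotopy class. No normal form for reduced edge-paths is needed. -/
lemma wordAction_word {o : V} (γ : ∀ v : V, PathClass o v) {a b : V} (p : PathClass a b)
    (x : PiOne o) : (wordAction γ (word p)).unop (a, x) = (b, x * closeUp γ p) := by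
  induction p using PathClass.induction with
  | hid => simp [word_id, closeUp, Groupoid.vertexGroup_mul]
  | hpos b c p e ih =>
    rw [word_comp, map_mul, MulOpposite.unop_mul, Equiv.Perm.mul_apply, ih, word_edgeClass]
    simp only [wordAction, FreeGroup.lift_apply_of, MulOpposite.unop_op, edgePerm_apply]
    simp [closeUp, Groupoid.vertexGroup_mul]
  | hneg b c p e ih =>
    rw [word_comp, map_mul, MulOpposite.unop_mul, Equiv.Perm.mul_apply, ih, word_inv,
      word_edgeClass, map_inv, MulOpposite.unop_inv, Equiv.Perm.inv_eq_iff_eq]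
    simp only [wordAction, FreeGroup.lift_apply_of, MulOpposite.unop_op, edgePerm_apply]
    simp [closeUp, Groupoid.vertexGroup_mul]

lemma EdgePath.exists_pathClass (h : IsConnectedGraph V) (a b : V) : Nonempty (PathClass a b) :=
  (h a b).map EdgePath.cls

lemma word_injective (h : IsConnectedGraph V) {a b : V} :
    Function.Injective (word : PathClass a b → FreeGroup (Quiver.Total V)) := by
  intro p q hpq
  let γ : ∀ v : V, PathClass a v := fun v => (EdgePath.exists_pathClass h a v).some
  have h1 := wordAction_word γ p 1
  rw [hpq, wordAction_word γ q 1] at h1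
  have h2 : closeUp γ q = closeUp γ p := by simpa using h1
  exact ((cancel_mono _).1 ((cancel_epi _).1 h2)).symm

/-- The embedding of the fundamental group in the free group on the set of edges. -/
def wordHom (o : V) : PiOne o →* FreeGroup (Quiver.Total V) where
  toFun := word
  map_one' := word_id o
  map_mul' p q := word_comp p q

end Words

/-! ### Cuts: each edge of the universal cover separates it -/

section Cuts

/-- A function on a free group that changes its value exactly along one edge of the Cayley graph. -/
lemma FreeGroup_exists_cut {α : Type*} (w₀ : FreeGroup α) (s₀ : α) :
    ∃ b : FreeGroup α → ZMod 2, ∀ w s,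
      (w = w₀ ∧ s = s₀ → b (w * FreeGroup.of s) = b w + 1) ∧
        (¬ (w = w₀ ∧ s = s₀) → b (w * FreeGroup.of s) = b w) := by
  classical
  -- The cut is a cocycle: each generator moves along the Cayley graph and adds `1` in `ZMod 2`
  -- exactly when it crosses the edge `(w₀, s₀)`. Freeness makes this an action, and the second
  -- coordinate of the orbit of `(1, 0)` is the cut.
  let perm : α → Equiv.Perm (FreeGroup α × ZMod 2) := fun s =>
    (Equiv.prodShear (Equiv.mulRight (FreeGroup.of s)) fun w =>
      Equiv.addRight (if w = w₀ ∧ s = s₀ then 1 else 0))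
  let θ : FreeGroup α →* (Equiv.Perm (FreeGroup α × ZMod 2))ᵐᵒᵖ :=
    FreeGroup.lift fun s => MulOpposite.op (perm s)
  have hfst : ∀ w : FreeGroup α, ∀ x, ((θ w).unop x).1 = x.1 * w := by
    intro w
    induction w using FreeGroup.induction_on with
    | C1 => simp
    | of s => intro x; simp [θ, perm, Equiv.prodShear]
    | inv_of s ih =>
      intro x
      obtain ⟨y, rfl⟩ := (θ (FreeGroup.of s)).unop.surjective x
      rw [ih, map_inv, MulOpposite.unop_inv, Equiv.Perm.coe_inv, Equiv.symm_apply_apply]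
      simp
    | mul u v hu hv =>
      intro x
      rw [map_mul, MulOpposite.unop_mul, Equiv.Perm.mul_apply, hv, hu, mul_assoc]
  refine ⟨fun w => ((θ w).unop (1, 0)).2, fun w s => ?_⟩
  have h1 : (θ (w * FreeGroup.of s)).unop (1, 0) = perm s ((θ w).unop (1, 0)) := by
    rw [map_mul, MulOpposite.unop_mul, Equiv.Perm.mul_apply]
    simp [θ]
  have h2 : ((θ w).unop (1, 0)).1 = w := by simp [hfst]
  simp only [h1, perm, Equiv.prodShear, Equiv.coe_fn_mk, h2, Equiv.coe_addRight]
  constructor <;> intro h <;> simp [h]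

variable {V : Type*} [Quiver V] (f : BasedHomotopyEquiv V)

namespace BasedHomotopyEquiv

/-- The indicator function, up to sign, of one side of an edge of the universal cover. -/
lemma exists_cut (hconn : IsConnectedGraph V) (e : f.CoverEdge) :
    ∃ χ : f.CoverVertex → ℚ, ((∀ v, χ v = 0 ∨ χ v = 1) ∨ (∀ v, χ v = 0 ∨ χ v = -1)) ∧
      χ (f.terminus e) - χ (f.origin e) = 1 ∧
      ∀ e', e' ≠ e → χ (f.terminus e') - χ (f.origin e') = 0 := by
  obtain ⟨b, hb⟩ := FreeGroup_exists_cut (word e.2) e.1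
  have hterm : ∀ e' : f.CoverEdge,
      word (f.terminus e').2 = word (f.origin e').2 * FreeGroup.of e'.1 := by
    intro e'
    rw [terminus, word_comp, word_edgeClass]
    rfl
  -- An edge of the cover is determined by its label and the word of its origin, so only `e` lies
  -- over the cut edge of the Cayley graph.
  have hne : ∀ e' : f.CoverEdge, e' ≠ e → ¬ (word e'.2 = word e.2 ∧ e'.1 = e.1) := by
    rintro ⟨e', p'⟩ he' ⟨h1, h2⟩
    obtain ⟨e, p⟩ := e
    dsimp only at h2 h1 he'
    subst h2
    exact he' (by rw [word_injective hconn h1])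
  have hval : ∀ z : ZMod 2, (z.val : ℚ) = 0 ∨ (z.val : ℚ) = 1 := by decide +revert
  have h1 := (hb (word e.2) e.1).1 ⟨rfl, rfl⟩
  let c : f.CoverVertex → ℚ := fun v => ((b (word v.2)).val : ℚ)
  have hc : ∀ v, c v = 0 ∨ c v = 1 := fun v => hval _
  have hsame : ∀ e', e' ≠ e → c (f.terminus e') = c (f.origin e') := by
    intro e' he'
    simp only [c, hterm]
    exact congrArg (fun z : ZMod 2 => ((z.val : ℕ) : ℚ)) ((hb _ _).2 (hne e' he'))
  have hdiff : c (f.terminus e) - c (f.origin e) = 1 ∨ c (f.terminus e) - c (f.origin e) = -1 := by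
    simp only [c, hterm]
    have : b (word (f.origin e).2 * FreeGroup.of e.1) = b (word (f.origin e).2) + 1 := h1
    rw [this]
    have hz : ∀ z : ZMod 2, (z + 1).val = 1 ∧ z.val = 0 ∨ (z + 1).val = 0 ∧ z.val = 1 := by
      decide
    rcases hz (b (word (f.origin e).2)) with ⟨h, h'⟩ | ⟨h, h'⟩ <;> simp [h, h']
  -- Modulo 2 the two sides are not ordered; if `e` runs from the side `1` to the side `0`, the sign
  -- of the function is changed.
  rcases hdiff with hd | hd
  · exact ⟨c, Or.inl hc, hd, fun e' he' => sub_eq_zero.2 (hsame e' he')⟩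
  · refine ⟨fun v => - c v, Or.inr fun v => ?_, by linarith, fun e' he' => ?_⟩
    · rcases hc v with h | h <;> simp [h]
    · simp [hsame e' he']

end BasedHomotopyEquiv

end Cuts

/-! ### Chains of the universal cover and the fixed vector of `A_{f,H}` -/

section Chains

variable {V : Type*} [Quiver V] (f : BasedHomotopyEquiv V)

namespace BasedHomotopyEquiv

lemma boundary_single (e : f.CoverEdge) (q : ℚ) :
    f.boundary (Finsupp.single e q) =
      q • (Finsupp.single (f.terminus e) (1 : ℚ) - Finsupp.single (f.origin e) (1 : ℚ)) :=
  Finsupp.linearCombination_single _ _ _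

/-- The coefficient of a chain at an edge is determined by its boundary and a cut at the edge. -/
lemma cut_boundary {e : f.CoverEdge} {χ : f.CoverVertex → ℚ}
    (h1 : χ (f.terminus e) - χ (f.origin e) = 1)
    (h0 : ∀ e', e' ≠ e → χ (f.terminus e') - χ (f.origin e') = 0) (c : f.C1) :
    Finsupp.linearCombination ℚ χ (f.boundary c) = c e := by
  classical
  induction c using Finsupp.induction_linear with
  | zero => simp
  | add x y hx hy => simp [hx, hy]
  | single e' q =>
    rw [boundary_single, map_smul, map_sub, Finsupp.linearCombination_single,
      Finsupp.linearCombination_single, one_smul, one_smul, Finsupp.single_apply]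
    split_ifs with h
    · subst h; simp [h1]
    · simp [h0 e' h]

/-- The universal cover is a tree: a cut at each edge reads the coefficient there off the boundary.
-/
lemma boundary_injective (hconn : IsConnectedGraph V) : Function.Injective f.boundary := by
  intro x y hxy
  ext e
  obtain ⟨χ, -, h1, h0⟩ := f.exists_cut hconn e
  rw [← f.cut_boundary h1 h0, hxy, f.cut_boundary h1 h0]

/-- The coefficients of the chain `[u, v]` are `0`, `1` and `-1`. -/
lemma segment_coeff (hconn : IsConnectedGraph V) {u v : f.CoverVertex} {c : f.C1}
    (hc : f.boundary c = Finsupp.single v 1 - Finsupp.single u 1) (e : f.CoverEdge) :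
    c e = 0 ∨ c e = 1 ∨ c e = -1 := by
  obtain ⟨χ, hχ, h1, h0⟩ := f.exists_cut hconn e
  have h := f.cut_boundary h1 h0 c
  rw [hc, map_sub, Finsupp.linearCombination_single, Finsupp.linearCombination_single, one_smul,
    one_smul] at h
  rw [← h]
  rcases hχ with hχ | hχ <;> rcases hχ u with hu | hu <;> rcases hχ v with hv | hv <;>
    simp [hu, hv]

lemma boundary_pathChain {a b : V} (p : PathClass f.base a) (q : EdgePath a b) :
    f.boundary (f.pathChain p q) =
      Finsupp.single ⟨b, p ≫ q.cls⟩ 1 - Finsupp.single ⟨a, p⟩ 1 := by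
  induction q with
  | nil => simp [pathChain, EdgePath.cls]
  | pos q e ih =>
    rw [pathChain, map_add, ih, boundary_single, one_smul, terminus, origin, EdgePath.cls]
    simp
  | neg q e ih =>
    rw [pathChain, map_sub, ih, boundary_single, one_smul, terminus, origin, EdgePath.cls]
    simp

lemma mapFromBase_comp {a b : V} (p : PathClass f.base a) (q : PathClass a b) :
    f.mapFromBase (p ≫ q) = f.mapFromBase p ≫ f.functor.map q :=
  (congrArg (eqToHom f.functor_obj_base.symm ≫ ·) (f.functor.map_comp p q)).trans
    (Category.assoc _ _ _).symm

lemma mapFromBase_mul {a : V} (g : f.F) (p : PathClass f.base a) :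
    f.mapFromBase (g ≫ p) = f.Phi g ≫ f.mapFromBase p := by
  have : f.Phi g = eqToHom f.functor_obj_base.symm ≫ f.functor.map g ≫
    eqToHom f.functor_obj_base := rfl
  rw [this]
  refine (congrArg (eqToHom f.functor_obj_base.symm ≫ ·) (f.functor.map_comp g p)).trans ?_
  -- Stated for arbitrary objects so that the equality of objects can be eliminated by `subst`.
  have hcancel : ∀ {C : Type _} [Category C] {W X X' Y Z : C} (h : X = X') (k : W ⟶ Y) (u : Y ⟶ X)
      (v : X ⟶ Z), k ≫ u ≫ v = (k ≫ u ≫ eqToHom h) ≫ eqToHom h.symm ≫ v := by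
    intro C _ W X X' Y Z h k u v
    subst h
    simp
  exact hcancel f.functor_obj_base _ _ _

lemma functor_map_edgeClass {a b : V} (e : a ⟶ b) :
    f.functor.map (edgeClass e) = (f.onE e).cls :=
  lift_map_edgeClass _ e

lemma chainMap_single (e : f.CoverEdge) (q : ℚ) :
    f.chainMap (Finsupp.single e q) =
      q • f.pathChain (f.mapFromBase e.2) (f.onE e.1.hom) :=
  Finsupp.linearCombination_single _ _ _

lemma boundary_chainMap (c : f.C1) :
    f.boundary (f.chainMap c) = Finsupp.mapDomain f.fTilde (f.boundary c) := by
  induction c using Finsupp.induction_linear with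
  | zero => simp
  | add x y hx hy => simp [hx, hy, Finsupp.mapDomain_add]
  | single e q =>
    rw [chainMap_single, map_smul, boundary_pathChain, boundary_single,
      ← Finsupp.lmapDomain_apply ℚ ℚ, map_smul, map_sub, Finsupp.lmapDomain_apply,
      Finsupp.lmapDomain_apply, Finsupp.mapDomain_single, Finsupp.mapDomain_single]
    simp only [fTilde, terminus, origin]
    have h : f.mapFromBase (e.2 ≫ edgeClass e.1.hom) =
        f.mapFromBase e.2 ≫ (f.onE e.1.hom).cls :=
      (f.mapFromBase_comp _ _).trans (congrArg _ (f.functor_map_edgeClass _))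
    rw [h]

lemma pathChain_mem_supported {a b : V} (p : PathClass f.base a) (q : EdgePath a b) :
    f.pathChain p q ∈ Finsupp.supported ℚ ℚ {e : f.CoverEdge | e.1 ∈ q.edges} := by
  induction q with
  | nil => exact Submodule.zero_mem _
  | pos q e ih =>
    refine Submodule.add_mem _ (Finsupp.supported_mono ?_ ih) (Finsupp.single_mem_supported _ _ ?_)
    · exact fun x hx => Set.mem_insert_of_mem _ hx
    · exact Set.mem_insert _ _
  | neg q e ih =>
    refine Submodule.sub_mem _ (Finsupp.supported_mono ?_ ih) (Finsupp.single_mem_supported _ _ ?_)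
    · exact fun x hx => Set.mem_insert_of_mem _ hx
    · exact Set.mem_insert _ _

variable (H : Subgraph V)

lemma relProj_apply_of_mem (c : f.C1) {e : f.CoverEdge} (he : e ∈ f.relCoverEdges H) :
    (f.relProj H c : f.C1) e = c e := by
  classical
  simp [relProj, Finsupp.restrictDom_apply, he]

lemma relProj_apply_of_notMem (c : f.C1) {e : f.CoverEdge} (he : e ∉ f.relCoverEdges H) :
    (f.relProj H c : f.C1) e = 0 := by
  classical
  simp [relProj, Finsupp.restrictDom_apply, he]

variable {H} in
lemma relProj_chainMap_single (hH : H.IsInvariant f.toGraphMorphism) {e : f.CoverEdge}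
    (he : e ∉ f.relCoverEdges H) (q : ℚ) : f.relProj H (f.chainMap (Finsupp.single e q)) = 0 := by
  have heH : e.1 ∈ H.edges := not_not.1 he
  rw [chainMap_single, map_smul]
  refine smul_eq_zero_of_right _ (Subtype.ext (Finsupp.ext fun e' => ?_))
  by_cases h : e' ∈ f.relCoverEdges H
  · rw [relProj_apply_of_mem f H _ h]
    by_contra h'
    exact h (hH.2 _ heH (pathChain_mem_supported f _ _ (Finsupp.mem_support_iff.2 h')))
  · rw [relProj_apply_of_notMem f H _ h]
    rfl

-- Edges over `H` are sent to chains over `H`, which the projection kills; hence the projection may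
-- be applied before or after the chain map.
variable {H} in
lemma relChainMap_relProj (hH : H.IsInvariant f.toGraphMorphism) (c : f.C1) :
    f.relChainMap H (f.relProj H c) = f.relProj H (f.chainMap c) := by
  induction c using Finsupp.induction_linear with
  | zero => simp
  | add x y hx hy => simp [hx, hy]
  | single e q =>
    by_cases he : e ∈ f.relCoverEdges H
    · have : (f.relProj H (Finsupp.single e q) : f.C1) = Finsupp.single e q := by
        classical
        ext e'
        by_cases h' : e' ∈ f.relCoverEdges H
        · rw [relProj_apply_of_mem f H _ h']
        · rw [relProj_apply_of_notMem f H _ h', Finsupp.single_apply, if_neg]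
          rintro rfl; exact h' he
      simp [relChainMap, this]
    · rw [relProj_chainMap_single f hH he]
      have : f.relProj H (Finsupp.single e q) = 0 := by
        classical
        ext e'
        by_cases h' : e' ∈ f.relCoverEdges H
        · rw [relProj_apply_of_mem f H _ h', Finsupp.single_apply, if_neg]
          · rfl
          · rintro rfl; exact he h'
        · rw [relProj_apply_of_notMem f H _ h']
          rfl
      rw [this, map_zero]

variable {H} in
/-- The image in the relative chains of a segment with fixed ends is fixed by `A_{f,H}`. -/
lemma relChainMap_fixedSegment (hconn : IsConnectedGraph V) (hH : H.IsInvariant f.toGraphMorphism)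
    {ρ : f.RelC1 H} (hρ : f.IsFixedSegment H ρ) : f.relChainMap H ρ = ρ := by
  obtain ⟨u, v, -, hu, hv, c, hc, rfl⟩ := hρ
  rw [relChainMap_relProj f hH]
  congr 1
  -- Both chains have boundary `v - u`, because the lift of `f` fixes `u` and `v`.
  apply f.boundary_injective hconn
  rw [boundary_chainMap, hc, ← Finsupp.lmapDomain_apply ℚ ℚ, map_sub, Finsupp.lmapDomain_apply,
    Finsupp.lmapDomain_apply, Finsupp.mapDomain_single, Finsupp.mapDomain_single, hu, hv]

variable {H} in
lemma fixedSegment_coeff (hconn : IsConnectedGraph V) {ρ : f.RelC1 H}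
    (hρ : f.IsFixedSegment H ρ) (e : f.CoverEdge) :
    (ρ : f.C1) e = 0 ∨ (ρ : f.C1) e = 1 ∨ (ρ : f.C1) e = -1 := by
  obtain ⟨u, v, -, hu, hv, c, hc, rfl⟩ := hρ
  by_cases he : e ∈ f.relCoverEdges H
  · rw [relProj_apply_of_mem f H _ he]
    exact f.segment_coeff hconn hc e
  · exact Or.inl (relProj_apply_of_notMem f H _ he)

lemma edgeAct_injective (g : f.F) : Function.Injective (f.edgeAct g) := by
  rintro ⟨e, p⟩ ⟨e', p'⟩ h
  simp only [edgeAct, Sigma.mk.injEq] at h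
  obtain ⟨rfl, h⟩ := h
  rw [heq_eq_eq, cancel_epi] at h
  rw [h]

lemma edgeAct_mul (g h : f.F) (e : f.CoverEdge) :
    f.edgeAct (g * h) e = f.edgeAct g (f.edgeAct h e) := by
  simp [edgeAct, Groupoid.vertexGroup_mul]

lemma edgeAct_one (e : f.CoverEdge) : f.edgeAct 1 e = e := by
  simp [edgeAct, Groupoid.vertexGroup_one]

lemma edgeAct_edgeAct_inv (g : f.F) (e : f.CoverEdge) : f.edgeAct g (f.edgeAct g⁻¹ e) = e := by
  rw [← edgeAct_mul, mul_inv_cancel, edgeAct_one]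

lemma relAct_apply (g : f.F) (x : f.RelC1 H) (e : f.CoverEdge) :
    (f.relAct H g x : f.C1) e = (x : f.C1) (f.edgeAct g⁻¹ e) := by
  have h : (f.relAct H g x : f.C1) = Finsupp.mapDomain (f.edgeAct g) (x : f.C1) := rfl
  conv_lhs => rw [h, ← f.edgeAct_edgeAct_inv g e]
  rw [Finsupp.mapDomain_apply (f.edgeAct_injective g)]

lemma chainAct_pathChain (g : f.F) {a b : V} (p : PathClass f.base a) (q : EdgePath a b) :
    f.pathChain (show PathClass f.base a from g ≫ p) q = f.chainAct g (f.pathChain p q) := by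
  induction q with
  | nil => simp [pathChain]
  | pos q e ih =>
    rw [pathChain, pathChain, map_add, ih]
    simp [chainAct, edgeAct]
  | neg q e ih =>
    rw [pathChain, pathChain, map_sub, ih]
    simp [chainAct, edgeAct]

lemma chainMap_chainAct (g : f.F) (c : f.C1) :
    f.chainMap (f.chainAct g c) = f.chainAct (f.Phi g) (f.chainMap c) := by
  induction c using Finsupp.induction_linear with
  | zero => simp
  | add x y hx hy => simp [hx, hy]
  | single e q =>
    have : f.chainAct g (Finsupp.single e q) = Finsupp.single (f.edgeAct g e) q :=
      Finsupp.mapDomain_single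
    rw [this, chainMap_single, chainMap_single, map_smul, ← chainAct_pathChain,
      ← mapFromBase_mul]
    rfl

lemma relProj_chainAct (g : f.F) (c : f.C1) :
    f.relProj H (f.chainAct g c) = f.relAct H g (f.relProj H c) := by
  ext e
  rw [relAct_apply]
  have key : f.chainAct g c e = c (f.edgeAct g⁻¹ e) := by
    conv_lhs => rw [← f.edgeAct_edgeAct_inv g e]
    exact Finsupp.mapDomain_apply (f.edgeAct_injective g) _ _
  by_cases he : e ∈ f.relCoverEdges H
  · rw [relProj_apply_of_mem f H _ he,
      relProj_apply_of_mem f H _ (show f.edgeAct g⁻¹ e ∈ _ from he),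
      key]
  · rw [relProj_apply_of_notMem f H _ he,
      relProj_apply_of_notMem f H _ (show f.edgeAct g⁻¹ e ∉ _ from he)]

/-- The twist by `Φ` is the one in the relation `x t = t Φ(x)` of `G_φ`; it is what makes `L`
commute with left translations on embedded chains. -/
lemma relChainMap_relAct (g : f.F) (x : f.RelC1 H) :
    f.relChainMap H (f.relAct H g x) = f.relAct H (f.Phi g) (f.relChainMap H x) := by
  have h : ((f.relAct H g x : f.RelC1 H) : f.C1) = f.chainAct g x := rfl
  simp only [relChainMap, LinearMap.comp_apply, Submodule.subtype_apply, h, chainMap_chainAct,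
    relProj_chainAct]

end BasedHomotopyEquiv

end Chains

/-! ### Square summable functions, basis vectors and restriction to subsets -/

section L2Basics

variable {X Y : Type*}

lemma delta_eq_single [DecidableEq X] (x : X) :
    (delta x : L2 X) = lp.single (E := fun _ : X => ℂ) 2 x (1 : ℂ) := by
  unfold delta
  congr
  exact Subsingleton.elim _ _

lemma inner_delta (x : X) (ξ : L2 X) : inner ℂ (delta x) ξ = ξ x := by
  classical
  rw [delta_eq_single, lp.inner_single_left]
  simp

lemma delta_apply_self (x : X) : (delta x : L2 X) x = 1 := by
  classical
  rw [delta_eq_single, lp.single_apply_self]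

lemma delta_apply_of_ne {x y : X} (h : y ≠ x) : (delta x : L2 X) y = 0 := by
  classical
  rw [delta_eq_single, lp.single_apply_ne _ _ _ h]

lemma closure_span_delta (X : Type*) :
    (Submodule.span ℂ (Set.range (delta : X → L2 X))).topologicalClosure = ⊤ := by
  classical
  rw [eq_top_iff]
  intro ξ _
  have h := lp.hasSum_single (E := fun _ : X => ℂ) (p := 2) (by norm_num) ξ
  refine mem_closure_of_tendsto h (Filter.Eventually.of_forall fun s => ?_)
  refine Submodule.sum_mem _ fun x _ => ?_
  have : lp.single (E := fun _ : X => ℂ) 2 x (ξ x) = ξ x • delta x := by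
    rw [delta_eq_single, ← lp.single_smul]
    simp
  rw [this]
  exact Submodule.smul_mem _ _ (Submodule.subset_span ⟨x, rfl⟩)

lemma ext_delta {E : Type*} [NormedAddCommGroup E] [NormedSpace ℂ E] {S T : L2 X →L[ℂ] E}
    (h : ∀ x, S (delta x) = T (delta x)) : S = T := by
  refine ContinuousLinearMap.ext_on (s := Set.range delta) ?_ ?_
  · rw [Submodule.dense_iff_topologicalClosure_eq_top]
    exact closure_span_delta X
  · rintro _ ⟨x, rfl⟩
    exact h x

lemma pushforward_apply (σ : X → Y) (hσ : Function.Injective σ) (ξ : L2 X) (x : X) :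
    pushforward σ hσ ξ (σ x) = ξ x := by
  rw [← inner_delta, ← pushforward_delta σ hσ, LinearIsometry.inner_map_map, inner_delta]

lemma hasSum_norm_sq (ξ : L2 X) : HasSum (fun x => ‖ξ x‖ ^ 2) (‖ξ‖ ^ 2) := by
  have := lp.hasSum_norm (E := fun _ : X => ℂ) (p := 2) (by norm_num) ξ
  simpa using this

lemma norm_apply_le (ξ : L2 X) (x : X) : ‖ξ x‖ ≤ ‖ξ‖ :=
  lp.norm_apply_le_norm (by norm_num) ξ x

/-- The square summable function given by a function that is dominated by a square summable one. -/
lemma memℓp_of_norm_le (ξ : L2 X) (a : X → ℂ) (h : ∀ x, ‖a x‖ ≤ ‖ξ x‖) : Memℓp a 2 := by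
  refine memℓp_gen ?_
  have := (hasSum_norm_sq ξ).summable
  refine Summable.of_nonneg_of_le (fun x => by positivity) (fun x => ?_) this
  simpa using pow_le_pow_left₀ (norm_nonneg _) (h x) 2

open Classical in
/-- The restriction of a square summable function to a subset. -/
def restr (S : Set X) : L2 X →ₗ[ℂ] L2 X where
  toFun ξ := ⟨fun x => if x ∈ S then ξ x else 0, memℓp_of_norm_le ξ _ fun x => by
    split_ifs <;> simp⟩
  map_add' ξ η := by
    ext x
    change (if x ∈ S then ξ x + η x else 0) = (if x ∈ S then ξ x else 0) + if x ∈ S then η x else 0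
    split_ifs <;> simp
  map_smul' c ξ := by
    ext x
    change (if x ∈ S then c * ξ x else 0) = c * (if x ∈ S then ξ x else 0)
    split_ifs <;> simp

lemma restr_apply_of_mem {S : Set X} (ξ : L2 X) {x : X} (h : x ∈ S) : restr S ξ x = ξ x :=
  if_pos h

lemma restr_apply_of_notMem {S : Set X} (ξ : L2 X) {x : X} (h : x ∉ S) : restr S ξ x = 0 :=
  if_neg h

lemma norm_restr_le (S : Set X) (ξ : L2 X) : ‖restr S ξ‖ ≤ ‖ξ‖ := by
  refine (sq_le_sq₀ (norm_nonneg _) (norm_nonneg _)).1 ?_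
  refine hasSum_le (fun x => ?_) (hasSum_norm_sq _) (hasSum_norm_sq _)
  by_cases h : x ∈ S
  · rw [restr_apply_of_mem ξ h]
  · rw [restr_apply_of_notMem ξ h]
    simp

lemma norm_sq_le_restr {S T : Set X} (h : ∀ x, x ∈ S ∨ x ∈ T) (ξ : L2 X) :
    ‖ξ‖ ^ 2 ≤ ‖restr S ξ‖ ^ 2 + ‖restr T ξ‖ ^ 2 := by
  refine hasSum_le (fun x => ?_) (hasSum_norm_sq ξ)
    ((hasSum_norm_sq (restr S ξ)).add (hasSum_norm_sq (restr T ξ)))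
  rcases h x with h | h
  · rw [restr_apply_of_mem ξ h]
    exact le_add_of_nonneg_right (by positivity)
  · rw [restr_apply_of_mem ξ h]
    exact le_add_of_nonneg_left (by positivity)

lemma restr_le_norm_sq {S T U : Set X} (hST : ∀ x ∈ S, x ∉ T) (hSU : ∀ x ∈ S, x ∉ U)
    (hTU : ∀ x ∈ T, x ∉ U) (ξ : L2 X) :
    ‖restr S ξ‖ ^ 2 + ‖restr T ξ‖ ^ 2 + ‖restr U ξ‖ ^ 2 ≤ ‖ξ‖ ^ 2 := by
  refine hasSum_le (fun x => ?_) (((hasSum_norm_sq (restr S ξ)).add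
    (hasSum_norm_sq (restr T ξ))).add (hasSum_norm_sq (restr U ξ))) (hasSum_norm_sq ξ)
  by_cases hS : x ∈ S
  · simp [restr_apply_of_mem ξ hS, restr_apply_of_notMem ξ (hST x hS),
      restr_apply_of_notMem ξ (hSU x hS)]
  by_cases hT : x ∈ T
  · simp [restr_apply_of_mem ξ hT, restr_apply_of_notMem ξ hS, restr_apply_of_notMem ξ (hTU x hT)]
  by_cases hU : x ∈ U
  · simp [restr_apply_of_mem ξ hU, restr_apply_of_notMem ξ hS, restr_apply_of_notMem ξ hT]
  · simp [restr_apply_of_notMem ξ hU, restr_apply_of_notMem ξ hS, restr_apply_of_notMem ξ hT]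

end L2Basics

/-! ### Non-amenability: no almost invariant vectors for two non-commuting elements of a free group
-/

section Gap

variable {G : Type*} [Group G]

/-- The right translation of square summable functions that sends the basis vector at `g` to the
one at `g * s`. -/
def rshift (s : G) : L2 G →ₗᵢ[ℂ] L2 G := pushforward (· * s) (mul_left_injective s)

lemma rshift_delta (s g : G) : rshift s (delta g) = delta (g * s) := pushforward_delta _ _ _

lemma rshift_apply (s : G) (ξ : L2 G) (g : G) : rshift s ξ g = ξ (g * s⁻¹) := by
  have := pushforward_apply (· * s) (mul_left_injective s) ξ (g * s⁻¹)
  simpa [rshift] using this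

lemma rshift_mul (s r : G) (ξ : L2 G) : rshift (s * r) ξ = rshift r (rshift s ξ) := by
  ext g
  simp [rshift_apply, mul_assoc]

lemma rshift_one (ξ : L2 G) : rshift 1 ξ = ξ := by
  ext g
  simp [rshift_apply]

lemma norm_restr_rshift (S : Set G) (s : G) (ξ : L2 G) :
    ‖restr S (rshift s ξ)‖ = ‖restr {g | g * s ∈ S} ξ‖ := by
  refine (pow_left_inj₀ (norm_nonneg _) (norm_nonneg _) two_ne_zero).1 ?_
  have h := (Equiv.mulRight s).hasSum_iff.2 (hasSum_norm_sq (restr S (rshift s ξ)))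
  refine h.unique ?_
  convert hasSum_norm_sq (restr {g | g * s ∈ S} ξ) using 2 with g
  simp only [Function.comp_apply, Equiv.coe_mulRight]
  by_cases hg : g * s ∈ S
  · rw [restr_apply_of_mem _ hg, restr_apply_of_mem ξ (show g ∈ {g | g * s ∈ S} from hg),
      rshift_apply, mul_inv_cancel_right]
  · rw [restr_apply_of_notMem _ hg, restr_apply_of_notMem ξ (show g ∉ {g | g * s ∈ S} from hg)]

lemma norm_rshift_mul_sub_le (s r : G) (ξ : L2 G) :
    ‖rshift (s * r) ξ - ξ‖ ≤ ‖rshift s ξ - ξ‖ + ‖rshift r ξ - ξ‖ := by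
  have h : rshift (s * r) ξ - ξ = rshift r (rshift s ξ - ξ) + (rshift r ξ - ξ) := by
    rw [map_sub, rshift_mul]
    abel
  rw [h]
  refine (norm_add_le _ _).trans ?_
  rw [LinearIsometry.norm_map]

lemma norm_rshift_inv_sub (s : G) (ξ : L2 G) : ‖rshift s⁻¹ ξ - ξ‖ = ‖rshift s ξ - ξ‖ := by
  rw [← (rshift s).norm_map (rshift s⁻¹ ξ - ξ), map_sub, ← rshift_mul, inv_mul_cancel, rshift_one,
    norm_sub_rev]

/-- A paradoxical set prevents the existence of almost invariant square summable functions. -/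
lemma norm_le_of_paradoxical {S : Set G} {x y : G} (hx : ∀ g, g ∈ S ∨ g * x ∈ S)
    (hy : ∀ g ∈ S, g * y ∉ S) (hyy : ∀ g ∈ S, g * (y * y) ∉ S) (ξ : L2 G) :
    ‖ξ‖ ≤ 100 * (‖rshift x ξ - ξ‖ + ‖rshift y ξ - ξ‖) := by
  -- Two translates of `S` cover the group and three are disjoint. For an invariant `ξ` with mass
  -- `m²` on `S` this would say `‖ξ‖² ≤ 2m²` and `3m² ≤ ‖ξ‖²`; the rest is the same argument with
  -- error terms.
  have h1 := norm_sq_le_restr (T := {g | g * x ∈ S}) hx ξ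
  have h2 := restr_le_norm_sq (T := {g | g * y ∈ S}) (U := {g | g * (y * y) ∈ S}) hy hyy
    (fun g hg hg' => hy _ hg (by simpa [mul_assoc] using hg')) ξ
  rw [← norm_restr_rshift] at h1
  rw [← norm_restr_rshift, ← norm_restr_rshift] at h2
  have hsub : ∀ s : G, |‖restr S (rshift s ξ)‖ - ‖restr S ξ‖| ≤ ‖rshift s ξ - ξ‖ := by
    intro s
    refine (abs_norm_sub_norm_le _ _).trans ?_
    rw [← map_sub]
    exact norm_restr_le _ _
  have hX := abs_le.1 (hsub x)
  have hY := abs_le.1 (hsub y)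
  have hYY := abs_le.1 ((hsub (y * y)).trans (norm_rshift_mul_sub_le y y ξ))
  have hm0 : 0 ≤ ‖restr S ξ‖ := norm_nonneg _
  have hmn : ‖restr S ξ‖ ≤ ‖ξ‖ := norm_restr_le _ _
  have hNx : 0 ≤ ‖rshift x ξ - ξ‖ := norm_nonneg _
  have hNy : 0 ≤ ‖rshift y ξ - ξ‖ := norm_nonneg _
  have ha : 0 ≤ ‖restr S (rshift x ξ)‖ := norm_nonneg _
  have hb : 0 ≤ ‖restr S (rshift y ξ)‖ := norm_nonneg _
  have hc : 0 ≤ ‖restr S (rshift (y * y) ξ)‖ := norm_nonneg _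
  generalize ‖restr S (rshift x ξ)‖ = a at *
  generalize ‖restr S (rshift y ξ)‖ = b at *
  generalize ‖restr S (rshift (y * y) ξ)‖ = c at *
  generalize ‖rshift x ξ - ξ‖ = X at *
  generalize ‖rshift y ξ - ξ‖ = Y at *
  generalize ‖restr S ξ‖ = m at *
  generalize ‖ξ‖ = n at *
  -- With displacements `X`, `Y` and norm `n` the errors add up to `n² ≤ 9nX + 12nY`, so the
  -- constant `100` is generous.
  by_contra! hcon
  have hn : 0 ≤ n := hm0.trans hmn
  have ha2 : a ^ 2 ≤ m ^ 2 + 2 * n * X + X * n := by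
    have : X ≤ n := by linarith
    have : a ^ 2 ≤ (m + X) ^ 2 := pow_le_pow_left₀ ha (by linarith) 2
    nlinarith
  have key : ∀ {r N : ℝ}, 0 ≤ r → 0 ≤ N → m - N ≤ r → m ^ 2 - 2 * n * N ≤ r ^ 2 := by
    intro r N hr hN hmr
    rcases le_total m N with h | h
    · nlinarith
    · have : (m - N) ^ 2 ≤ r ^ 2 := pow_le_pow_left₀ (by linarith) hmr 2
      nlinarith
  have hb2 := key hb hNy (by linarith)
  have hc2 := key hc (by linarith : 0 ≤ Y + Y) (by linarith)
  have hnn : n * (100 * (X + Y)) ≤ n * n := mul_le_mul_of_nonneg_left hcon.le hn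
  have hnX : 0 ≤ n * X := mul_nonneg hn hNx
  have hnY : 0 ≤ n * Y := mul_nonneg hn hNy
  have hpos : 0 < n * n := by nlinarith
  nlinarith

/-- The reduced words whose inverse starts with `x` or its inverse. -/
lemma FreeGroup_exists_paradoxical {α : Type*} {x y : α} (hxy : x ≠ y) :
    ∃ S : Set (FreeGroup α), (∀ w, w ∈ S ∨ w * FreeGroup.of x ∈ S) ∧
      (∀ w ∈ S, w * FreeGroup.of y ∉ S) ∧
      ∀ w ∈ S, w * (FreeGroup.of y * FreeGroup.of y) ∉ S := by
  classical
  have hstart : ∀ {v w : α × Bool} {g : FreeGroup α}, g ∈ FreeGroup.startsWith v →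
      g ∈ FreeGroup.startsWith w → v = w := by
    intro v w g hv hw
    by_contra h
    exact Set.disjoint_left.1 (FreeGroup.startsWith.disjoint_iff_ne.2 h) hv hw
  have hinv : ∀ s : α, (FreeGroup.of s)⁻¹ = FreeGroup.mk [(s, false)] := fun s => rfl
  have hmul : ∀ (s : α) (g : FreeGroup α), g ∉ FreeGroup.startsWith (s, true) →
      (FreeGroup.of s)⁻¹ * g ∈ FreeGroup.startsWith (s, false) := by
    intro s g hg
    rw [hinv]
    exact FreeGroup.startsWith_mk_mul g hg
  -- These are the words that end in `x` or its inverse. Passing to inverses turns right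
  -- multiplication into the left multiplication that `startsWith` controls.
  let S : Set (FreeGroup α) := {w | ∃ b : Bool, w⁻¹ ∈ FreeGroup.startsWith (x, b)}
  have hy : ∀ w ∈ S, (w * FreeGroup.of y)⁻¹ ∈ FreeGroup.startsWith (y, false) := by
    rintro w ⟨b, hb⟩
    rw [mul_inv_rev]
    refine hmul y _ fun h => hxy ?_
    exact congrArg Prod.fst (hstart hb h)
  have hyS : ∀ w : FreeGroup α, w⁻¹ ∈ FreeGroup.startsWith (y, false) → w ∉ S := by
    rintro w hw ⟨b, hb⟩
    exact hxy (congrArg Prod.fst (hstart hb hw))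
  refine ⟨S, fun w => ?_, fun w hw => hyS _ (hy w hw), fun w hw => hyS _ ?_⟩
  · by_cases h : w⁻¹ ∈ FreeGroup.startsWith (x, true)
    · exact Or.inl ⟨true, h⟩
    · refine Or.inr ⟨false, ?_⟩
      rw [mul_inv_rev]
      exact hmul x _ h
  · rw [← mul_assoc, mul_inv_rev]
    refine hmul y _ fun h => ?_
    simpa using hstart h (hy w hw)

/-- A paradoxical set of a subgroup, propagated to the cosets. -/
lemma exists_paradoxical_of_injective {K : Type*} [Group K] (κ : K →* G)
    (hκ : Function.Injective κ) {S : Set K} {x y : K} (hx : ∀ w, w ∈ S ∨ w * x ∈ S)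
    (hy : ∀ w ∈ S, w * y ∉ S) (hyy : ∀ w ∈ S, w * (y * y) ∉ S) :
    ∃ S' : Set G, (∀ g, g ∈ S' ∨ g * κ x ∈ S') ∧ (∀ g ∈ S', g * κ y ∉ S') ∧
      ∀ g ∈ S', g * (κ y * κ y) ∉ S' := by
  -- A representative of each left coset of the image of `κ`. Right multiplication by the image
  -- preserves these cosets, so a copy of `S` can be put in every one of them.
  let r : G → G := fun g => (QuotientGroup.mk g : G ⧸ κ.range).out
  have hr : ∀ g w, r (g * κ w) = r g := by
    intro g w
    have : (QuotientGroup.mk (g * κ w) : G ⧸ κ.range) = QuotientGroup.mk g :=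
      QuotientGroup.mk_mul_of_mem g ⟨w, rfl⟩
    simp only [r, this]
  have hrep : ∀ g, ∃ w, g = r g * κ w := by
    intro g
    have h : (QuotientGroup.mk (r g) : G ⧸ κ.range) = QuotientGroup.mk g := Quotient.out_eq _
    obtain ⟨w, hw⟩ := QuotientGroup.eq.1 h
    exact ⟨w, by rw [hw]; group⟩
  let S' : Set G := {g | ∃ w ∈ S, g = r g * κ w}
  have hmem : ∀ g w v, g = r g * κ w → (g * κ v ∈ S' ↔ w * v ∈ S) := by
    intro g w v hg
    constructor
    · rintro ⟨u, hu, h⟩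
      rw [hr] at h
      have h' : r g * κ (w * v) = r g * κ u := by
        rw [← h, map_mul, ← mul_assoc, ← hg]
      rw [hκ (mul_left_cancel h')]
      exact hu
    · intro h
      refine ⟨w * v, h, ?_⟩
      rw [hr, map_mul, ← mul_assoc, ← hg]
  refine ⟨S', fun g => ?_, ?_, ?_⟩
  · obtain ⟨w, hw⟩ := hrep g
    exact (hx w).imp (fun h => ⟨w, h, hw⟩) (hmem g w x hw).2
  · rintro g ⟨w, hw, hg⟩
    rw [hmem g w y hg]
    exact hy w hw
  · rintro g ⟨w, hw, hg⟩
    rw [← map_mul, hmem g w _ hg]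
    exact hyy w hw

/-- The elements that are controlled by the displacement by `s₁` and `s₂` form a subgroup. -/
def controlled (s₁ s₂ : G) : Subgroup G where
  carrier := {s | ∃ C : ℝ, 0 ≤ C ∧ ∀ ξ : L2 G,
    ‖rshift s ξ - ξ‖ ≤ C * (‖rshift s₁ ξ - ξ‖ + ‖rshift s₂ ξ - ξ‖)}
  one_mem' := ⟨0, le_rfl, fun ξ => by simp [rshift_one]⟩
  mul_mem' := by
    rintro s r ⟨C, hC, h⟩ ⟨D, hD, h'⟩
    exact ⟨C + D, add_nonneg hC hD, fun ξ => (norm_rshift_mul_sub_le s r ξ).trans (by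
      rw [add_mul]; exact add_le_add (h ξ) (h' ξ))⟩
  inv_mem' := by
    rintro s ⟨C, hC, h⟩
    exact ⟨C, hC, fun ξ => by rw [norm_rshift_inv_sub]; exact h ξ⟩

/-- Two elements of a free group that do not commute have no common almost invariant square summable
functions. -/
theorem exists_spectral_gap {F : Type*} [Group F] {α : Type*} (ψ : F →* FreeGroup α)
    (hψ : Function.Injective ψ) (κ : F →* G) (hκ : Function.Injective κ) {g₁ g₂ : F}
    (hg : g₁ * g₂ ≠ g₂ * g₁) :
    ∃ C : ℝ, 0 ≤ C ∧ ∀ ξ : L2 G,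
      ‖ξ‖ ≤ C * (‖rshift (κ g₁) ξ - ξ‖ + ‖rshift (κ g₂) ξ - ξ‖) := by
  let K : Subgroup F := Subgroup.closure {g₁, g₂}
  have hfree : IsFreeGroup K := IsFreeGroup.ofMulEquiv (K.equivMapOfInjective ψ hψ).symm
  -- The freeness of `K` just obtained is the Nielsen–Schreier theorem, applied to its image under
  -- `ψ`.
  let ε : FreeGroup (IsFreeGroup.Generators K) ≃* K := IsFreeGroup.mulEquiv K
  have hg₁ : g₁ ∈ K := Subgroup.subset_closure (by simp)
  have hg₂ : g₂ ∈ K := Subgroup.subset_closure (by simp)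
  -- With at most one free generator `K` would be abelian.
  have hnontriv : ¬ Subsingleton (IsFreeGroup.Generators K) := by
    intro hsub
    have hcomm : ∀ a b : FreeGroup (IsFreeGroup.Generators K), a * b = b * a := by
      intro a b
      rcases isEmpty_or_nonempty (IsFreeGroup.Generators K) with hE | ⟨⟨x⟩⟩
      · exact Subsingleton.elim _ _
      · have hmem : ∀ a : FreeGroup (IsFreeGroup.Generators K),
            a ∈ Subgroup.zpowers (FreeGroup.of x) := by
          intro a
          induction a using FreeGroup.induction_on with
          | C1 => exact one_mem _
          | of y => rw [Subsingleton.elim y x]; exact Subgroup.mem_zpowers _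
          | inv_of y h => exact inv_mem h
          | mul a b ha hb => exact mul_mem ha hb
        obtain ⟨m, rfl⟩ := hmem a
        obtain ⟨n, rfl⟩ := hmem b
        exact (Commute.refl _).zpow_zpow m n
    apply hg
    have h := congrArg ε (hcomm (ε.symm ⟨g₁, hg₁⟩) (ε.symm ⟨g₂, hg₂⟩))
    simpa [Subtype.ext_iff] using h
  obtain ⟨x, y, hxy⟩ := (not_subsingleton_iff_nontrivial.1 hnontriv).exists_pair_ne
  obtain ⟨S, hS1, hS2, hS3⟩ := FreeGroup_exists_paradoxical hxy
  let θ : FreeGroup (IsFreeGroup.Generators K) →* G := κ.comp (K.subtype.comp ε.toMonoidHom)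
  have hθ : Function.Injective θ :=
    hκ.comp (Subtype.val_injective.comp ε.injective)
  obtain ⟨S', h1, h2, h3⟩ := exists_paradoxical_of_injective θ hθ hS1 hS2 hS3
  -- The free generators of `K` need not be `g₁` and `g₂`, but they are words in them, so their
  -- displacements are bounded by those of `g₁` and `g₂`.
  have hcontr : ∀ w, θ w ∈ controlled (κ g₁) (κ g₂) := by
    intro w
    have hle : K ≤ (controlled (κ g₁) (κ g₂)).comap κ := by
      rw [Subgroup.closure_le]
      rintro g (rfl | rfl)
      · exact ⟨1, zero_le_one, fun ξ => by
          rw [one_mul]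
          exact le_add_of_nonneg_right (norm_nonneg _)⟩
      · exact ⟨1, zero_le_one, fun ξ => by
          rw [one_mul]
          exact le_add_of_nonneg_left (norm_nonneg _)⟩
    exact hle (ε w).2
  obtain ⟨C, hC, hCx⟩ := hcontr (FreeGroup.of x)
  obtain ⟨D, hD, hDy⟩ := hcontr (FreeGroup.of y)
  refine ⟨100 * (C + D), by positivity, fun ξ => (norm_le_of_paradoxical h1 h2 h3 ξ).trans ?_⟩
  rw [mul_assoc, add_mul]
  exact mul_le_mul_of_nonneg_left (add_le_add (hCx ξ) (hDy ξ)) (by norm_num)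

end Gap

/-! ### The trace of the logarithm as a power series, and its derivative -/

section TraceLog

open Filter Topology

variable {M : Type*} [CStarAlgebra M]

/-- The value of a functional `τ` at the power series of `- log (1 - a)`. -/
def logSeries (τ : M →L[ℂ] ℂ) (a : M) : ℂ := ∑' n : ℕ, τ (a ^ (n + 1)) / (n + 1)

lemma norm_apply_pow_div_le (τ : M →L[ℂ] ℂ) (a : M) {r : ℝ} (hr : ‖a‖ ≤ r) (n : ℕ) :
    ‖τ (a ^ (n + 1)) / (n + 1)‖ ≤ ‖τ‖ * r ^ (n + 1) := by
  have h1 : ‖τ (a ^ (n + 1))‖ ≤ ‖τ‖ * r ^ (n + 1) :=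
    (τ.le_opNorm _).trans (mul_le_mul_of_nonneg_left
      ((norm_pow_le' a n.succ_pos).trans (pow_le_pow_left₀ (norm_nonneg _) hr _)) (norm_nonneg _))
  rw [norm_div]
  refine (div_le_self (norm_nonneg _) ?_).trans h1
  have : ((n : ℂ) + 1) = ((n + 1 : ℕ) : ℂ) := by push_cast; rfl
  rw [this, Complex.norm_natCast]
  exact_mod_cast Nat.succ_le_succ (Nat.zero_le n)

lemma summable_logSeries (τ : M →L[ℂ] ℂ) {a : M} (ha : ‖a‖ < 1) :
    Summable fun n : ℕ => τ (a ^ (n + 1)) / (n + 1) := by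
  refine Summable.of_norm_bounded (g := fun n : ℕ => ‖τ‖ * ‖a‖ ^ (n + 1)) ?_
    (norm_apply_pow_div_le τ a le_rfl)
  exact ((summable_nat_add_iff 1).2 (summable_geometric_of_lt_one (norm_nonneg _) ha)).mul_left _

/-- The derivative of a power, seen by a trace. -/
lemma exists_hasDerivAt_pow {τ : M →L[ℂ] ℂ} (hτ : ∀ a b, τ (a * b) = τ (b * a)) {k : ℝ → M}
    {k' : M} {s : ℝ} (hk : HasDerivAt k k' s) (n : ℕ) :
    ∃ D : M, HasDerivAt (fun s => k s ^ (n + 1)) D s ∧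
      ∀ m : ℕ, τ (k s ^ m * D) = (n + 1) * τ (k s ^ (m + n) * k') := by
  induction n with
  | zero => exact ⟨k', by simpa using hk, fun m => by simp⟩
  | succ n ih =>
    obtain ⟨D, hD, hDτ⟩ := ih
    refine ⟨D * k s + k s ^ (n + 1) * k', ?_, fun m => ?_⟩
    · simp_rw [pow_succ _ (n + 1)]
      exact hD.mul hk
    -- The trace moves the last factor of `k^m D k` to the front, which turns `m` into `m + 1`; this
    -- is why the induction carries an arbitrary `m`.
    · rw [mul_add, map_add, ← mul_assoc, hτ, ← mul_assoc, ← pow_succ', hDτ, ← mul_assoc, ← pow_add,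
        show m + 1 + n = m + (n + 1) by ring]
      push_cast
      ring

lemma hasDerivAt_apply_pow_div {τ : M →L[ℂ] ℂ} (hτ : ∀ a b, τ (a * b) = τ (b * a)) {k : ℝ → M}
    {k' : M} {s : ℝ} (hk : HasDerivAt k k' s) (n : ℕ) :
    HasDerivAt (fun s => τ (k s ^ (n + 1)) / (n + 1)) (τ (k s ^ n * k')) s := by
  obtain ⟨D, hD, hDτ⟩ := exists_hasDerivAt_pow hτ hk n
  have h := ((τ.restrictScalars ℝ).hasFDerivAt.comp_hasDerivAt s hD).div_const ((n : ℂ) + 1)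
  have h0 := hDτ 0
  rw [pow_zero, one_mul, zero_add] at h0
  have h1 : τ D / ((n : ℂ) + 1) = τ (k s ^ n * k') := by
    rw [h0, mul_div_cancel_left₀]
    exact_mod_cast Nat.succ_ne_zero n
  rw [← h1]
  exact h

/-- Formally the derivative of `-τ(log (1 - k))` is `τ(k' (1 - k)⁻¹)`, even though `k` and `k'` need
not commute, because `τ` is a trace. The series may be differentiated termwise, since near `s` it is
dominated by a geometric series, and a right inverse `w` must be the Neumann series. -/
lemma hasDerivAt_logSeries {τ : M →L[ℂ] ℂ} (hτ : ∀ a b, τ (a * b) = τ (b * a)) {k k' : ℝ → M}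
    (hk : ∀ s, HasDerivAt k (k' s) s) (hk' : Continuous k') {s : ℝ} (hs : ‖k s‖ < 1) {w : M}
    (hw : (1 - k s) * w = 1) :
    HasDerivAt (fun s => logSeries τ (k s)) (τ (k' s * w)) s := by
  obtain ⟨r, hr1, hr2⟩ := exists_between hs
  have hr0 : 0 ≤ r := (norm_nonneg _).trans hr1.le
  have hkc : Continuous k := continuous_iff_continuousAt.2 fun s => (hk s).continuousAt
  have hnear : ∀ᶠ x in 𝓝 s, ‖k x‖ < r ∧ ‖k' x‖ < ‖k' s‖ + 1 :=
    (hkc.norm.continuousAt.eventually_lt continuousAt_const hr1).and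
      (hk'.norm.continuousAt.eventually_lt continuousAt_const (lt_add_one _))
  obtain ⟨δ, hδ, hball⟩ := Metric.eventually_nhds_iff_ball.1 hnear
  have hsum : Summable fun n : ℕ => ‖τ‖ * (r ^ n * (‖k' s‖ + 1)) :=
    ((summable_geometric_of_lt_one hr0 hr2).mul_right _).mul_left _
  have hmem : s ∈ Metric.ball s δ := Metric.mem_ball_self hδ
  have main := hasDerivAt_tsum_of_isPreconnected (t := Metric.ball s δ)
    (g := fun (n : ℕ) x => τ (k x ^ (n + 1)) / (n + 1)) (g' := fun n x => τ (k x ^ n * k' x))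
    (y₀ := s) (y := s) hsum Metric.isOpen_ball (convex_ball s δ).isPreconnected
    (fun n y _ => hasDerivAt_apply_pow_div hτ (hk y) n)
    (fun n y hy => by
      refine (τ.le_opNorm _).trans (mul_le_mul_of_nonneg_left ?_ (norm_nonneg _))
      refine (norm_mul_le _ _).trans ?_
      have hy' := hball y hy
      rcases n with _ | n
      · have h1 : ‖(1 : M)‖ ≤ 1 := by
          rcases subsingleton_or_nontrivial M with h | h
          · rw [Subsingleton.elim (1 : M) 0, norm_zero]; exact zero_le_one
          · exact (norm_one).le
        rw [pow_zero, pow_zero]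
        exact mul_le_mul h1 hy'.2.le (norm_nonneg _) zero_le_one
      · exact mul_le_mul ((norm_pow_le' _ n.succ_pos).trans
          (pow_le_pow_left₀ (norm_nonneg _) hy'.1.le _)) hy'.2.le (norm_nonneg _) (by positivity))
    hmem (summable_logSeries τ hs) hmem
  have hgeom : HasSum (fun n : ℕ => k s ^ n) w := by
    have h := (summable_geometric_of_norm_lt_one hs).hasSum
    have hw' : ∑' i : ℕ, k s ^ i = w := by
      rw [← mul_one (∑' i : ℕ, k s ^ i), ← hw, ← mul_assoc, geom_series_mul_neg _ hs, one_mul]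
    rwa [hw'] at h
  have hτsum : HasSum (fun n : ℕ => τ (k s ^ n * k' s)) (τ (w * k' s)) :=
    (hgeom.mul_right (k' s)).mapL τ
  rw [hτsum.tsum_eq, hτ] at main
  exact main

variable [PartialOrder M] [StarOrderedRing M]

/-- The spectrum of `a` lies in `(0, C]`, so that of `1 - a / C` lies in `[0, 1)`. This brings every
strictly positive element into the domain of the logarithmic series. -/
lemma norm_one_sub_smul_lt_one {a : M} (ha : IsStrictlyPositive a) {C : ℝ} (hC : ‖a‖ ≤ C)
    (hC0 : 0 < C) : ‖1 - C⁻¹ • a‖ < 1 := by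
  have hsa : IsSelfAdjoint a := ha.isSelfAdjoint
  have h : (1 : M) - C⁻¹ • a = cfc (fun x : ℝ => 1 - C⁻¹ * x) a := by
    rw [cfc_sub (fun _ : ℝ => (1 : ℝ)) (fun x : ℝ => C⁻¹ * x) a, cfc_const_one ℝ a,
      cfc_const_mul_id C⁻¹ a]
  rw [h]
  refine norm_cfc_lt zero_lt_one fun x hx => ?_
  have hx0 : 0 < x := ha.spectrum_pos hx
  have hxC : x ≤ C := by
    rcases subsingleton_or_nontrivial M with h | h
    · exact absurd hx (by simp [spectrum.of_subsingleton])
    · exact (le_abs_self x).trans ((spectrum.norm_le_norm_of_mem hx).trans hC)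
  have h1 : 0 < C⁻¹ * x := by positivity
  have h2 : C⁻¹ * x ≤ 1 := by rw [inv_mul_le_iff₀ hC0]; simpa using hxC
  rw [Real.norm_eq_abs, abs_lt]
  constructor <;> linarith

/-- The value of a functional at the logarithm of a positive element, as a power series. -/
lemma apply_log (τ : M →L[ℂ] ℂ) {a : M} (ha : IsStrictlyPositive a) {C : ℝ} (hC : ‖a‖ ≤ C)
    (hC0 : 0 < C) :
    τ (CFC.log a) = Real.log C * τ 1 - logSeries τ (1 - C⁻¹ • a) := by
  have hsa : IsSelfAdjoint a := ha.isSelfAdjoint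
  have hk := norm_one_sub_smul_lt_one ha hC hC0
  set k : M := 1 - C⁻¹ • a with hkdef
  have hksa : IsSelfAdjoint k := by
    rw [hkdef]
    exact (IsSelfAdjoint.one M).sub (IsSelfAdjoint.smul (IsSelfAdjoint.all _) hsa)
  -- Scaling by `C` splits off `log C` and leaves the logarithm of `1 - k` with `‖k‖ < 1`.
  have hlog : CFC.log a = algebraMap ℝ M (Real.log C) + CFC.log (1 - k) := by
    have h1 : a = C • (1 - k) := by
      rw [hkdef, sub_sub_cancel, smul_smul, mul_inv_cancel₀ hC0.ne', one_smul]
    have h2 : IsStrictlyPositive (1 - k) := by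
      rw [hkdef, sub_sub_cancel]
      exact ha.smul (inv_pos.2 hC0)
    conv_lhs => rw [h1]
    rw [CFC.log_smul' (1 - k) hC0 h2]
  have hbound : ∀ x ∈ spectrum ℝ k, |x| ≤ ‖k‖ := by
    intro x hx
    rcases subsingleton_or_nontrivial M with h | h
    · exact absurd hx (by simp [spectrum.of_subsingleton])
    · exact spectrum.norm_le_norm_of_mem hx
  have hlog1 : CFC.log (1 - k) = cfc (fun x : ℝ => Real.log (1 - x)) k := by
    have h1 : (1 : M) - k = cfc (fun x : ℝ => 1 - x) k := by
      rw [cfc_sub (fun _ : ℝ => (1 : ℝ)) (fun x : ℝ => x) k, cfc_const_one ℝ k, cfc_id' ℝ k]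
    have hcont : ContinuousOn Real.log ((fun x : ℝ => 1 - x) '' spectrum ℝ k) := by
      rintro y ⟨x, hx, rfl⟩
      refine (Real.continuousAt_log ?_).continuousWithinAt
      have := (abs_lt.1 ((hbound x hx).trans_lt hk)).2
      dsimp only
      linarith
    rw [CFC.log, h1, ← cfc_comp' Real.log (fun x : ℝ => 1 - x) k hcont]
  -- The Taylor polynomials of `-log (1 - x)` converge uniformly for `|x| ≤ ‖k‖`, hence in norm
  -- through the functional calculus.
  have htend : Tendsto (fun n : ℕ => ∑ i ∈ Finset.range n, ((i : ℝ) + 1)⁻¹ • k ^ (i + 1)) atTop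
      (𝓝 (- CFC.log (1 - k))) := by
    have hpart : ∀ n : ℕ, ∑ i ∈ Finset.range n, ((i : ℝ) + 1)⁻¹ • k ^ (i + 1) =
        cfc (fun x : ℝ => ∑ i ∈ Finset.range n, ((i : ℝ) + 1)⁻¹ * x ^ (i + 1)) k := by
      intro n
      rw [← Finset.sum_fn, cfc_sum _ _ _ (fun i _ => by fun_prop)]
      refine Finset.sum_congr rfl fun i _ => ?_
      rw [cfc_const_mul _ _ _ (by fun_prop), cfc_pow_id k (i + 1)]
    simp_rw [hpart]
    rw [hlog1, ← cfc_neg]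
    refine tendsto_cfc_fun ?_ (Eventually.of_forall fun n => by fun_prop)
    rw [Metric.tendstoUniformlyOn_iff]
    intro ε hε
    have h0 : Tendsto (fun n : ℕ => ‖k‖ ^ (n + 1) / (1 - ‖k‖)) atTop (𝓝 0) := by
      have := ((tendsto_pow_atTop_nhds_zero_of_lt_one (norm_nonneg k) hk).comp
        (tendsto_add_atTop_nat 1)).div_const (1 - ‖k‖)
      simpa using this
    filter_upwards [h0.eventually_lt_const hε] with n hn x hx
    have hx1 := hbound x hx
    have h1 := Real.abs_log_sub_add_sum_range_le (hx1.trans_lt hk) n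
    rw [dist_comm, Real.dist_eq, sub_neg_eq_add]
    have h2 : ∑ i ∈ Finset.range n, ((i : ℝ) + 1)⁻¹ * x ^ (i + 1) =
        ∑ i ∈ Finset.range n, x ^ (i + 1) / ((i : ℝ) + 1) :=
      Finset.sum_congr rfl fun i _ => by rw [div_eq_inv_mul]
    rw [h2]
    refine (h1.trans ?_).trans_lt hn
    exact div_le_div₀ (by positivity) (pow_le_pow_left₀ (abs_nonneg x) hx1 _) (by linarith)
      (by linarith)
  have hseries : logSeries τ k = τ (- CFC.log (1 - k)) := by
    have h1 := (τ.continuous.tendsto _).comp htend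
    have h2 := (summable_logSeries τ hk).hasSum.tendsto_sum_nat
    refine tendsto_nhds_unique h2 (h1.congr fun n => ?_)
    rw [Function.comp_apply, map_sum]
    refine Finset.sum_congr rfl fun i _ => ?_
    have h3 : ((i : ℝ) + 1)⁻¹ • k ^ (i + 1) = (((i : ℂ) + 1)⁻¹ : ℂ) • k ^ (i + 1) := by
      rw [← Complex.coe_smul]
      push_cast
      rfl
    rw [h3, map_smul, smul_eq_mul, div_eq_inv_mul]
  rw [hlog, map_add, hseries, map_neg, sub_neg_eq_add]
  congr 1
  rw [Algebra.algebraMap_eq_smul_one, ← Complex.coe_smul, map_smul, smul_eq_mul]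

end TraceLog

/-! ### The trace of the logarithm under conjugation, and its value for `1 - u` -/

section TraceLogInequalities

open Filter Topology

variable {M : Type*} [CStarAlgebra M]

/-- The reason is `(ab)^(n+1) = a (ba)^n b` together with the trace property; the constant terms
agree trivially. -/
lemma apply_pow_mul_comm {τ : M →L[ℂ] ℂ} (hτ : ∀ a b, τ (a * b) = τ (b * a)) (a b : M)
    (p : Polynomial ℂ) : τ (Polynomial.aeval (a * b) p) = τ (Polynomial.aeval (b * a) p) := by
  have hpow : ∀ n : ℕ, (a * b) ^ (n + 1) = a * ((b * a) ^ n * b) := by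
    intro n
    induction n with
    | zero => simp
    | succ n ih =>
      rw [pow_succ, ih, pow_succ]
      simp only [mul_assoc]
  induction p using Polynomial.induction_on with
  | C c => simp
  | add p q hp hq => simp only [map_add, hp, hq]
  | monomial n c _ =>
    simp only [map_mul, Polynomial.aeval_C, map_pow, Polynomial.aeval_X, ← Algebra.smul_def,
      map_smul]
    congr 1
    rw [hpow, hτ, mul_assoc, ← pow_succ]

lemma algebraMap_mul_comm_smul (c : ℝ) (a b : M) :
    a * algebraMap ℝ M c * b = c • (a * b) := by
  rw [Algebra.algebraMap_eq_smul_one, mul_smul_comm, mul_one, smul_mul_assoc]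

/-- Only positive powers of `u` occur in the series. Such expressions are the derivatives of the
trace of the logarithm along `q ↦ 1 - q u`. -/
lemma apply_mul_geometric_eq_zero {τ : M →L[ℂ] ℂ} {u : M} (hu : ∀ n : ℕ, τ (u ^ (n + 1)) = 0)
    {q : ℝ} (hq : ‖q • u‖ < 1) : τ (u * ∑' n : ℕ, (q • u) ^ n) = 0 := by
  have h := ((summable_geometric_of_norm_lt_one hq).hasSum.mul_left u).mapL τ
  refine h.unique ?_
  have h0 : ∀ n : ℕ, τ (u * (q • u) ^ n) = 0 := by
    intro n
    have : u * (q • u) ^ n = ((q ^ n : ℝ) : ℂ) • u ^ (n + 1) := by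
      rw [smul_pow, mul_smul_comm, ← pow_succ', Complex.coe_smul]
    rw [this, map_smul, hu, smul_zero]
  simp only [h0]
  exact hasSum_zero

variable [PartialOrder M] [StarOrderedRing M]

/-- The trace of the logarithm is multiplicative under conjugation by invertible elements, up to a
constant. -/
lemma apply_log_conjugate {τ : M →L[ℂ] ℂ} (hτ : ∀ a b, τ (a * b) = τ (b * a)) {X Y S T : M}
    (hX : IsStrictlyPositive X) (hY : IsStrictlyPositive Y) (hST : S * T = 1) (hTS : T * S = 1) :
    τ (CFC.log (star S * X * S)) - τ (CFC.log X) =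
      τ (CFC.log (star S * Y * S)) - τ (CFC.log Y) := by
  have hS : IsUnit S := ⟨⟨S, T, hST, hTS⟩, rfl⟩
  have hSX : IsStrictlyPositive (star S * X * S) :=
    (hS.isStrictlyPositive_star_left_conjugate_iff).2 hX
  have hSY : IsStrictlyPositive (star S * Y * S) :=
    (hS.isStrictlyPositive_star_left_conjugate_iff).2 hY
  obtain ⟨C, hC0, hC1, hC2, hC3, hC4⟩ : ∃ C : ℝ, 0 < C ∧ ‖X‖ ≤ C ∧ ‖Y‖ ≤ C ∧
      ‖star S * X * S‖ ≤ C ∧ ‖star S * Y * S‖ ≤ C := by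
    refine ⟨1 + ‖X‖ + ‖Y‖ + ‖star S * X * S‖ + ‖star S * Y * S‖, ?_⟩
    have h1 := norm_nonneg X
    have h2 := norm_nonneg Y
    have h3 := norm_nonneg (star S * X * S)
    have h4 := norm_nonneg (star S * Y * S)
    refine ⟨?_, ?_, ?_, ?_, ?_⟩ <;> linarith
  rw [apply_log τ hX hC1 hC0, apply_log τ hY hC2 hC0, apply_log τ hSX hC3 hC0,
    apply_log τ hSY hC4 hC0]
  -- Join `X` to `Y` by a segment, and conjugate the segment by `S`. One constant `C` for all four
  -- elements cancels the terms `log C`, and convexity keeps both paths in the open unit ball.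
  set d : M := C⁻¹ • (X - Y) with hd
  let k : ℝ → M := fun s => (1 - C⁻¹ • X) + s • d
  let l : ℝ → M := fun s => (1 - C⁻¹ • (star S * X * S)) + s • (star S * d * S)
  have hk : ∀ s, HasDerivAt k d s := fun s => by
    have h := ((hasDerivAt_id s).smul_const d).const_add (1 - C⁻¹ • X)
    rwa [one_smul] at h
  have hl : ∀ s, HasDerivAt l (star S * d * S) s := fun s => by
    have h := ((hasDerivAt_id s).smul_const (star S * d * S)).const_add
      (1 - C⁻¹ • (star S * X * S))
    rwa [one_smul] at h
  have hk1 : k 1 = 1 - C⁻¹ • Y := by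
    simp only [k, hd, smul_sub, one_smul]
    abel
  have hl1 : l 1 = 1 - C⁻¹ • (star S * Y * S) := by
    simp only [l, hd, smul_sub, one_smul, mul_sub, sub_mul, mul_smul_comm, smul_mul_assoc]
    abel
  have hk0 : k 0 = 1 - C⁻¹ • X := by simp [k]
  have hl0 : l 0 = 1 - C⁻¹ • (star S * X * S) := by simp [l]
  have hconv : ∀ (u v : M), ‖u‖ < 1 → ‖u + v‖ < 1 → ∀ s ∈ Set.Icc (0 : ℝ) 1, ‖u + s • v‖ < 1 := by
    intro u v hu hv s hs
    have h := (convex_ball (0 : M) 1) (by simpa using hu : u ∈ Metric.ball (0 : M) 1)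
      (by simpa using hv : u + v ∈ Metric.ball (0 : M) 1) (sub_nonneg.2 hs.2) hs.1 (by ring)
    have h2 : (1 - s) • u + s • (u + v) = u + s • v := by
      rw [sub_smul, one_smul, smul_add]
      abel
    rw [h2] at h
    simpa using h
  have hknorm : ∀ s ∈ Set.Icc (0 : ℝ) 1, ‖k s‖ < 1 := by
    refine hconv _ _ (norm_one_sub_smul_lt_one hX hC1 hC0) ?_
    have := norm_one_sub_smul_lt_one hY hC2 hC0
    rw [← hk1] at this
    simpa [k] using this
  have hlnorm : ∀ s ∈ Set.Icc (0 : ℝ) 1, ‖l s‖ < 1 := by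
    refine hconv _ _ (norm_one_sub_smul_lt_one hSX hC3 hC0) ?_
    have := norm_one_sub_smul_lt_one hSY hC4 hC0
    rw [← hl1] at this
    simpa [l] using this
  have hrel : ∀ s, 1 - l s = star S * (1 - k s) * S := by
    intro s
    simp only [l, k, mul_sub, sub_mul, mul_add, add_mul, mul_one, mul_smul_comm, smul_mul_assoc]
    abel
  have hST' : star T * star S = 1 := by rw [← star_mul, hST, star_one]
  have hTS' : star S * star T = 1 := by rw [← star_mul, hTS, star_one]
  have hder : ∀ s ∈ Set.Icc (0 : ℝ) 1,
      HasDerivAt (fun s => logSeries τ (l s) - logSeries τ (k s)) 0 s := by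
    intro s hs
    set w : M := ∑' i : ℕ, k s ^ i
    have hw : (1 - k s) * w = 1 := mul_neg_geom_series _ (hknorm s hs)
    have hw' : (1 - l s) * (T * w * star T) = 1 := by
      rw [hrel]
      calc star S * (1 - k s) * S * (T * w * star T)
          = star S * ((1 - k s) * (S * T) * w) * star T := by simp only [mul_assoc]
        _ = 1 := by rw [hST, mul_one, hw, mul_one, hTS']
    have h1 := hasDerivAt_logSeries hτ hk continuous_const (hknorm s hs) hw
    have h2 := hasDerivAt_logSeries hτ hl continuous_const (hlnorm s hs) hw'
    -- By the trace property the factors `S` and `T` cancel, so both paths have the same derivative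
    -- and the difference of the traces does not depend on the endpoint.
    have h3 : τ (star S * d * S * (T * w * star T)) = τ (d * w) := by
      calc τ (star S * d * S * (T * w * star T))
          = τ (star S * (d * (S * T) * w * star T)) := by simp only [mul_assoc]
        _ = τ (d * (S * T) * w * (star T * star S)) := by rw [hτ]; simp only [mul_assoc]
        _ = τ (d * w) := by rw [hST, hST', mul_one, mul_one]
    have h := h2.sub h1
    rw [h3, sub_self] at h
    exact h
  have hconst := constant_of_has_deriv_right_zero
    (fun s hs => (hder s hs).continuousAt.continuousWithinAt)
    (fun s hs => (hder s (Set.Ico_subset_Icc_self hs)).hasDerivWithinAt) 1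
    (Set.right_mem_Icc.2 zero_le_one)
  rw [hk1, hk0, hl1, hl0] at hconst
  linear_combination hconst

/-- After scaling by a common constant, the terms of the two series are traces of the same
polynomial at `star B * B` and at `B * star B`. -/
lemma apply_log_star_mul_add {τ : M →L[ℂ] ℂ} (hτ : ∀ a b, τ (a * b) = τ (b * a)) (B : M) {δ : ℝ}
    (hδ : 0 < δ) :
    τ (CFC.log (star B * B + algebraMap ℝ M δ)) = τ (CFC.log (B * star B + algebraMap ℝ M δ)) := by
  have h1 : IsStrictlyPositive (star B * B + algebraMap ℝ M δ) :=
    (isStrictlyPositive_algebraMap hδ).nonneg_add (star_mul_self_nonneg B)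
  have h2 : IsStrictlyPositive (B * star B + algebraMap ℝ M δ) :=
    (isStrictlyPositive_algebraMap hδ).nonneg_add (mul_star_self_nonneg B)
  set C : ℝ := 1 + ‖star B * B + algebraMap ℝ M δ‖ + ‖B * star B + algebraMap ℝ M δ‖ with hC
  have hn1 := norm_nonneg (star B * B + algebraMap ℝ M δ)
  have hn2 := norm_nonneg (B * star B + algebraMap ℝ M δ)
  rw [apply_log τ h1 (C := C) (by linarith) (by linarith),
    apply_log τ h2 (C := C) (by linarith) (by linarith)]
  congr 1
  unfold logSeries
  congr 1
  funext n
  congr 1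
  have key : ∀ a : M, (1 - C⁻¹ • (a + algebraMap ℝ M δ)) ^ (n + 1) =
      Polynomial.aeval a ((1 - Polynomial.C ((C⁻¹ : ℝ) : ℂ) *
        (Polynomial.X + Polynomial.C (δ : ℂ))) ^ (n + 1)) := by
    intro a
    simp only [map_pow, map_sub, map_one, map_mul, map_add, Polynomial.aeval_C, Polynomial.aeval_X,
      ← Algebra.smul_def, Complex.coe_smul]
    congr 4
  rw [key, key, apply_pow_mul_comm hτ]

/-- A positive trace is monotone on logarithms. -/
lemma re_apply_log_le {τ : M →L[ℂ] ℂ} (hpos : ∀ a : M, 0 ≤ a → 0 ≤ (τ a).re) {a b : M}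
    (ha : IsStrictlyPositive a) (hab : a ≤ b) : (τ (CFC.log a)).re ≤ (τ (CFC.log b)).re := by
  have h := hpos _ (sub_nonneg.2 (CFC.log_le_log hab ha))
  rw [map_sub, Complex.sub_re] at h
  linarith

/-- Conjugation by an invertible self-adjoint element changes the regularized traces of the
logarithm only by a change of the parameter. -/
lemma re_apply_log_similar {τ : M →L[ℂ] ℂ} (hτ : ∀ a b, τ (a * b) = τ (b * a))
    (hpos : ∀ a : M, 0 ≤ a → 0 ≤ (τ a).re) {S T : M} (hS : IsSelfAdjoint S) (hT : IsSelfAdjoint T)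
    (hST : S * T = 1) (hTS : T * S = 1) (P : M) :
    ∃ c₁ c₂ : ℝ, 0 < c₁ ∧ 0 < c₂ ∧ ∀ ε : ℝ, 0 < ε →
      (τ (CFC.log (P * star P + algebraMap ℝ M (c₁ * ε)))).re ≤
          (τ (CFC.log (star (S * P * T) * (S * P * T) + algebraMap ℝ M ε))).re ∧
        (τ (CFC.log (star (S * P * T) * (S * P * T) + algebraMap ℝ M ε))).re ≤
          (τ (CFC.log (P * star P + algebraMap ℝ M (c₂ * ε)))).re := by
  have hS' : star S = S := hS
  have hT' : star T = T := hT
  set C : ℝ := ‖S‖ ^ 2 + 1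
  set D : ℝ := ‖T‖ ^ 2 + 1
  have hC : 0 < C := by positivity
  have hD : 0 < D := by positivity
  have hSS : S * S ≤ algebraMap ℝ M C := by
    have h := CStarAlgebra.star_mul_le_algebraMap_norm_sq (a := S)
    rw [hS'] at h
    refine h.trans (algebraMap_mono M ?_)
    simp [C]
  have hTT : T * T ≤ algebraMap ℝ M D := by
    have h := CStarAlgebra.star_mul_le_algebraMap_norm_sq (a := T)
    rw [hT'] at h
    refine h.trans (algebraMap_mono M ?_)
    simp [D]
  have hTSST : T * (S * S) * T = 1 := by
    rw [← mul_assoc, hTS, one_mul, hST]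
  have hSTTS : S * (T * T) * S = 1 := by
    rw [← mul_assoc, hST, one_mul, hTS]
  have one_le_T : (1 : M) ≤ C • (T * T) := by
    have h := star_left_conjugate_le_conjugate hSS T
    rwa [hT', hTSST, algebraMap_mul_comm_smul] at h
  have one_le_S : (1 : M) ≤ D • (S * S) := by
    have h := star_left_conjugate_le_conjugate hTT S
    rwa [hS', hSTTS, algebraMap_mul_comm_smul] at h
  have T_le_one : D⁻¹ • (T * T) ≤ 1 := by
    have h := smul_le_smul_of_nonneg_left hTT (inv_pos.2 hD).le
    rwa [Algebra.algebraMap_eq_smul_one, smul_smul, inv_mul_cancel₀ hD.ne', one_smul] at h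
  have S_le_one : C⁻¹ • (S * S) ≤ 1 := by
    have h := smul_le_smul_of_nonneg_left hSS (inv_pos.2 hC).le
    rwa [Algebra.algebraMap_eq_smul_one, smul_smul, inv_mul_cancel₀ hC.ne', one_smul] at h
  have hposadd : ∀ (a : M) {δ : ℝ}, 0 ≤ a → 0 < δ → IsStrictlyPositive (a + algebraMap ℝ M δ) :=
    fun a δ ha hδ => (isStrictlyPositive_algebraMap hδ).nonneg_add ha
  -- the traces of the logarithms of `S²` and `T²` cancel
  have hcancel : τ (CFC.log (S * S)) + τ (CFC.log (T * T)) = 0 := by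
    have hTTpos : IsStrictlyPositive (T * T) := by
      have h := (IsUnit.isStrictlyPositive_star_left_conjugate_iff (u := T) (a := (1 : M))
        ⟨⟨T, S, hTS, hST⟩, rfl⟩).2 isStrictlyPositive_one
      rwa [hT', mul_one] at h
    have h := apply_log_conjugate hτ hTTpos isStrictlyPositive_one hST hTS
    rw [hS', hSTTS, mul_one, CFC.log_one, map_zero] at h
    linear_combination -h
  have hconjS : ∀ X : M, IsStrictlyPositive X →
      τ (CFC.log (S * X * S)) = τ (CFC.log X) + τ (CFC.log (S * S)) := by
    intro X hX
    have h := apply_log_conjugate hτ hX isStrictlyPositive_one hST hTS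
    rw [hS', mul_one, CFC.log_one, map_zero] at h
    linear_combination h
  have hconjT : ∀ X : M, IsStrictlyPositive X →
      τ (CFC.log (T * X * T)) = τ (CFC.log X) + τ (CFC.log (T * T)) := by
    intro X hX
    have h := apply_log_conjugate hτ hX isStrictlyPositive_one hTS hST
    rw [hT', mul_one, CFC.log_one, map_zero] at h
    linear_combination h
  have hBB : star (S * P * T) * (S * P * T) = T * (star (S * P) * (S * P)) * T := by
    rw [star_mul _ T, hT']
    simp only [mul_assoc]
  have hBB0 : 0 ≤ star (S * P) * (S * P) := star_mul_self_nonneg _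
  have hPP0 : 0 ≤ P * star P := mul_star_self_nonneg _
  have hSPPS : S * P * star (S * P) = S * (P * star P) * S := by
    rw [star_mul, hS']
    simp only [mul_assoc]
  -- the common form of both bounds
  have hchain : ∀ δ η : ℝ, 0 < δ → 0 < η →
      τ (CFC.log (T * (star (S * P) * (S * P) + algebraMap ℝ M δ) * T)) =
        τ (CFC.log (S * (P * star P) * S + algebraMap ℝ M δ)) + τ (CFC.log (T * T)) ∧
      τ (CFC.log (S * (P * star P + algebraMap ℝ M η) * S)) =
        τ (CFC.log (P * star P + algebraMap ℝ M η)) + τ (CFC.log (S * S)) := by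
    intro δ η hδ hη
    refine ⟨?_, hconjS _ (hposadd _ hPP0 hη)⟩
    rw [hconjT _ (hposadd _ hBB0 hδ), apply_log_star_mul_add hτ _ hδ, hSPPS]
  have hexpT : ∀ (a : M) (δ : ℝ), T * (a + algebraMap ℝ M δ) * T = T * a * T + δ • (T * T) := by
    intro a δ
    rw [mul_add, add_mul, algebraMap_mul_comm_smul]
  have hexpS : ∀ (a : M) (δ : ℝ), S * (a + algebraMap ℝ M δ) * S = S * a * S + δ • (S * S) := by
    intro a δ
    rw [mul_add, add_mul, algebraMap_mul_comm_smul]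
  have hTconj0 : 0 ≤ T * (star (S * P) * (S * P)) * T := by
    have h := star_left_conjugate_nonneg hBB0 T
    rwa [hT'] at h
  have hSconj0 : 0 ≤ S * (P * star P) * S := by
    have h := star_left_conjugate_nonneg hPP0 S
    rwa [hS'] at h
  -- `C` and `D` bound `S²` and `T²`. Pulling the scalar `ε` under the conjugation by `T` and then,
  -- after exchanging the two factors, under the one by `S`, costs `D⁻¹` and `C⁻¹` for the lower
  -- bound, `C` and `D` for the upper one. The terms `τ(log S²)` and `τ(log T²)` picked up on the
  -- way cancel.
  refine ⟨C⁻¹ * D⁻¹, D * C, by positivity, by positivity, fun ε hε => ⟨?_, ?_⟩⟩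
  · obtain ⟨h1, h2⟩ := hchain (D⁻¹ * ε) (C⁻¹ * (D⁻¹ * ε)) (by positivity) (by positivity)
    have h3 : (τ (CFC.log (T * (star (S * P) * (S * P) + algebraMap ℝ M (D⁻¹ * ε)) * T))).re ≤
        (τ (CFC.log (star (S * P * T) * (S * P * T) + algebraMap ℝ M ε))).re := by
      refine re_apply_log_le hpos ?_ ?_
      · have h := (IsUnit.isStrictlyPositive_star_left_conjugate_iff (u := T)
          ⟨⟨T, S, hTS, hST⟩, rfl⟩).2 (hposadd _ hBB0 (show 0 < D⁻¹ * ε by positivity))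
        rwa [hT'] at h
      · rw [hexpT, hBB, Algebra.algebraMap_eq_smul_one, mul_comm, mul_smul]
        gcongr
    have h4 : (τ (CFC.log (S * (P * star P + algebraMap ℝ M (C⁻¹ * (D⁻¹ * ε))) * S))).re ≤
        (τ (CFC.log (S * (P * star P) * S + algebraMap ℝ M (D⁻¹ * ε)))).re := by
      refine re_apply_log_le hpos ?_ ?_
      · have h := (IsUnit.isStrictlyPositive_star_left_conjugate_iff (u := S)
          ⟨⟨S, T, hST, hTS⟩, rfl⟩).2 (hposadd _ hPP0 (show 0 < C⁻¹ * (D⁻¹ * ε) by positivity))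
        rwa [hS'] at h
      · rw [hexpS, Algebra.algebraMap_eq_smul_one, mul_comm C⁻¹, mul_smul]
        gcongr
    rw [h1] at h3
    rw [h2] at h4
    have h5 := congrArg Complex.re hcancel
    simp only [Complex.add_re, Complex.zero_re] at h3 h4 h5
    rw [mul_assoc C⁻¹]
    linarith
  · obtain ⟨h1, h2⟩ := hchain (C * ε) (D * (C * ε)) (by positivity) (by positivity)
    have h3 : (τ (CFC.log (star (S * P * T) * (S * P * T) + algebraMap ℝ M ε))).re ≤
        (τ (CFC.log (T * (star (S * P) * (S * P) + algebraMap ℝ M (C * ε)) * T))).re := by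
      refine re_apply_log_le hpos ?_ ?_
      · rw [hBB]
        exact hposadd _ hTconj0 hε
      · rw [hexpT, hBB, Algebra.algebraMap_eq_smul_one, mul_comm, mul_smul]
        gcongr
    have h4 : (τ (CFC.log (S * (P * star P) * S + algebraMap ℝ M (C * ε)))).re ≤
        (τ (CFC.log (S * (P * star P + algebraMap ℝ M (D * (C * ε))) * S))).re := by
      refine re_apply_log_le hpos (hposadd _ hSconj0 (by positivity)) ?_
      rw [hexpS, Algebra.algebraMap_eq_smul_one, mul_comm D, mul_smul (C * ε) D]
      gcongr
    rw [h1] at h3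
    rw [h2] at h4
    have h5 := congrArg Complex.re hcancel
    simp only [Complex.add_re, Complex.zero_re] at h3 h4 h5
    rw [mul_assoc D]
    linarith

/-- The trace of the logarithm of `(1 - q u)(1 - q u)*` vanishes for a unitary `u` all of whose
powers have trace zero. -/
lemma apply_log_one_sub_unitary {τ : M →L[ℂ] ℂ} (hτ : ∀ a b, τ (a * b) = τ (b * a)) {u : M}
    (hu : u ∈ unitary M) (hτu : ∀ n : ℕ, τ (u ^ (n + 1)) = 0)
    (hτu' : ∀ n : ℕ, τ (star u ^ (n + 1)) = 0) {q : ℝ} (hq0 : 0 ≤ q) (hq1 : q < 1) :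
    τ (CFC.log ((1 - q • u) * star (1 - q • u))) = 0 := by
  have hu1 : star u * u = 1 := (Unitary.mem_iff.1 hu).1
  have hu2 : u * star u = 1 := (Unitary.mem_iff.1 hu).2
  have hun : ‖u‖ ≤ 1 := by
    rcases subsingleton_or_nontrivial M with h | h
    · rw [Subsingleton.elim u 0, norm_zero]; exact zero_le_one
    · exact (CStarRing.norm_of_mem_unitary hu).le
  have hone : ‖(1 : M)‖ ≤ 1 := by
    rcases subsingleton_or_nontrivial M with h | h
    · rw [Subsingleton.elim (1 : M) 0, norm_zero]; exact zero_le_one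
    · exact norm_one.le
  have hsmul : ∀ s ∈ Set.Icc 0 q, ∀ v : M, ‖v‖ ≤ 1 → ‖s • v‖ < 1 := by
    intro s hs v hv
    rw [norm_smul, Real.norm_of_nonneg hs.1]
    calc s * ‖v‖ ≤ s * 1 := mul_le_mul_of_nonneg_left hv hs.1
      _ < 1 := by linarith [hs.2]
  have hstar : ∀ s : ℝ, star (1 - s • u) = 1 - s • star u := by
    intro s
    rw [star_sub, star_one, star_smul, star_trivial]
  -- Deform `q` to `0`. The derivative of `τ(log (X s))` is a sum of traces of `u` and `star u`
  -- times geometric series, all zero, and `X 0 = 1`. The bound `4` on the norm of `X s` is the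
  -- scaling constant for the series.
  let X : ℝ → M := fun s => (1 - s • u) * (1 - s • star u)
  have hXpos : ∀ s ∈ Set.Icc 0 q, IsStrictlyPositive (X s) := by
    intro s hs
    have hunit : IsUnit (1 - s • u) := isUnit_one_sub_of_norm_lt_one (hsmul s hs u hun)
    have h := (IsUnit.isStrictlyPositive_star_right_conjugate_iff (a := (1 : M)) hunit).2
      isStrictlyPositive_one
    rwa [mul_one, hstar] at h
  have hXnorm : ∀ s ∈ Set.Icc 0 q, ‖X s‖ ≤ 4 := by
    intro s hs
    have h1 : ‖1 - s • u‖ ≤ 2 := (norm_sub_le _ _).trans (by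
      linarith [hsmul s hs u hun])
    have h2 : ‖1 - s • star u‖ ≤ 2 := (norm_sub_le _ _).trans (by
      linarith [hsmul s hs (star u) (by rwa [norm_star])])
    calc ‖X s‖ ≤ ‖1 - s • u‖ * ‖1 - s • star u‖ := norm_mul_le _ _
      _ ≤ 2 * 2 := mul_le_mul h1 h2 (norm_nonneg _) (by norm_num)
      _ = 4 := by norm_num
  let X' : ℝ → M := fun s => (-u) * (1 - s • star u) + (1 - s • u) * (- star u)
  have hlin : ∀ (v : M) (s : ℝ), HasDerivAt (fun s : ℝ => 1 - s • v) (-v) s := by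
    intro v s
    have h := ((hasDerivAt_id s).smul_const v).const_sub 1
    rwa [one_smul] at h
  have hX : ∀ s, HasDerivAt X (X' s) s := fun s => (hlin u s).mul (hlin (star u) s)
  have hk : ∀ s, HasDerivAt (fun s => 1 - (4 : ℝ)⁻¹ • X s) (-((4 : ℝ)⁻¹ • X' s)) s := fun s =>
    ((hX s).const_smul (4 : ℝ)⁻¹).const_sub 1
  have hX'c : Continuous fun s => -((4 : ℝ)⁻¹ • X' s) := by
    simp only [X']
    fun_prop
  have hder : ∀ s ∈ Set.Icc 0 q,
      HasDerivAt (fun s => logSeries τ (1 - (4 : ℝ)⁻¹ • X s)) 0 s := by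
    intro s hs
    have hn1 := hsmul s hs u hun
    have hn2 := hsmul s hs (star u) (by rwa [norm_star])
    set a : M := 1 - s • u
    set b : M := 1 - s • star u
    set v : M := ∑' n : ℕ, (s • u) ^ n
    set v' : M := ∑' n : ℕ, (s • star u) ^ n
    have hav : a * v = 1 := mul_neg_geom_series _ hn1
    have hva : v * a = 1 := geom_series_mul_neg _ hn1
    have hbv : b * v' = 1 := mul_neg_geom_series _ hn2
    have hvb : v' * b = 1 := geom_series_mul_neg _ hn2
    have hw : (1 - (1 - (4 : ℝ)⁻¹ • X s)) * ((4 : ℝ) • (v' * v)) = 1 := by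
      rw [sub_sub_cancel, smul_mul_smul_comm]
      norm_num
      calc a * b * (v' * v) = a * (b * v') * v := by simp only [mul_assoc]
        _ = 1 := by rw [hbv, mul_one, hav]
    have h := hasDerivAt_logSeries hτ hk hX'c
      (norm_one_sub_smul_lt_one (hXpos s hs) (hXnorm s hs) (by norm_num)) hw
    have h0 : τ (-((4 : ℝ)⁻¹ • X' s) * ((4 : ℝ) • (v' * v))) = 0 := by
      have h1 : -((4 : ℝ)⁻¹ • X' s) * ((4 : ℝ) • (v' * v)) =
          u * v + (a * (star u * v')) * v := by
        rw [neg_mul, smul_mul_smul_comm]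
        norm_num
        change -((-u * b + a * (- star u)) * (v' * v)) = _
        calc -((-u * b + a * (- star u)) * (v' * v))
            = u * (b * v') * v + (a * (star u * v')) * v := by noncomm_ring
          _ = _ := by rw [hbv, mul_one]
      rw [h1, map_add, apply_mul_geometric_eq_zero hτu hn1, zero_add, hτ, ← mul_assoc, hva, one_mul,
        apply_mul_geometric_eq_zero hτu' hn2]
    rwa [h0] at h
  have hconst := constant_of_has_deriv_right_zero
    (fun s hs => (hder s hs).continuousAt.continuousWithinAt)
    (fun s hs => (hder s (Set.Ico_subset_Icc_self hs)).hasDerivWithinAt) q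
    (Set.right_mem_Icc.2 hq0)
  have hlog : ∀ s ∈ Set.Icc 0 q, τ (CFC.log (X s)) =
      Real.log 4 * τ 1 - logSeries τ (1 - (4 : ℝ)⁻¹ • X s) := fun s hs =>
    apply_log τ (hXpos s hs) (hXnorm s hs) (by norm_num)
  rw [hstar]
  change τ (CFC.log (X q)) = 0
  rw [hlog q (Set.right_mem_Icc.2 hq0), hconst, ← hlog 0 (Set.left_mem_Icc.2 hq0)]
  simp [X]

/-- The regularized traces of the logarithm for `1 - u`. -/
lemma re_apply_log_one_sub_add {τ : M →L[ℂ] ℂ} (hτ : ∀ a b, τ (a * b) = τ (b * a)) (hτ1 : τ 1 = 1)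
    {u : M} (hu : u ∈ unitary M) (hτu : ∀ n : ℕ, τ (u ^ (n + 1)) = 0)
    (hτu' : ∀ n : ℕ, τ (star u ^ (n + 1)) = 0) {ε : ℝ} (hε : 0 < ε) :
    (τ (CFC.log ((1 - u) * star (1 - u) + algebraMap ℝ M ε))).re =
      2 * Real.arsinh (√ε / 2) := by
  have hu2 : u * star u = 1 := (Unitary.mem_iff.1 hu).2
  -- With `q = exp (-2y)` one has `q⁻¹ + q = 2 + ε`, so that `(1 - u)(1 - u)* + ε = q⁻¹ (1 - q u)(1
  -- - q u)*`. Its logarithm has trace `-log q = 2y`.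
  set y : ℝ := Real.arsinh (√ε / 2) with hy
  have hypos : 0 < y := Real.arsinh_pos_iff.2 (by positivity)
  set q : ℝ := Real.exp (-(2 * y)) with hq
  have hq0 : 0 < q := Real.exp_pos _
  have hq1 : q < 1 := by
    rw [hq, ← Real.exp_zero]
    exact Real.exp_lt_exp.2 (by linarith)
  have hsinh : ε = 4 * Real.sinh y ^ 2 := by
    rw [hy, Real.sinh_arsinh, div_pow, Real.sq_sqrt hε.le]
    ring
  have hqε : q⁻¹ + q = 2 + ε := by
    have h1 : q = Real.exp (-y) ^ 2 := by rw [hq, ← Real.exp_nat_mul]; congr 1; push_cast; ring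
    have h2 : q⁻¹ = Real.exp y ^ 2 := by
      rw [hq, ← Real.exp_neg, ← Real.exp_nat_mul]; congr 1; push_cast; ring
    have h3 : Real.exp y * Real.exp (-y) = 1 := by rw [← Real.exp_add]; simp
    rw [hsinh, Real.sinh_eq, h2, h1]
    linear_combination 2 * h3
  have hstar : ∀ s : ℝ, star (1 - s • u) = 1 - s • star u := by
    intro s
    rw [star_sub, star_one, star_smul, star_trivial]
  have hfac : (1 - u) * star (1 - u) + algebraMap ℝ M ε =
      q⁻¹ • ((1 - q • u) * star (1 - q • u)) := by
    have h1 := hstar 1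
    rw [one_smul, one_smul] at h1
    have h2 : (1 - q • u) * (1 - q • star u) = (1 + q ^ 2) • (1 : M) - q • (u + star u) := by
      rw [sub_mul, mul_sub, mul_sub, mul_one, one_mul, mul_one, smul_mul_smul_comm, hu2, add_smul,
        one_smul, smul_add, pow_two]
      abel
    have h3 : (1 - u) * (1 - star u) = (2 : ℝ) • (1 : M) - (u + star u) := by
      rw [sub_mul, mul_sub, mul_sub, mul_one, one_mul, mul_one, hu2, two_smul]
      abel
    rw [h1, hstar, h2, h3, smul_sub, smul_smul, smul_smul, inv_mul_cancel₀ hq0.ne', one_smul,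
      Algebra.algebraMap_eq_smul_one]
    have h4 : q⁻¹ * (1 + q ^ 2) = 2 + ε := by
      rw [← hqε]
      field_simp
    rw [h4, add_smul]
    abel
  have hpos : IsStrictlyPositive ((1 - q • u) * star (1 - q • u)) := by
    have hn : ‖q • u‖ < 1 := by
      rcases subsingleton_or_nontrivial M with h | h
      · rw [Subsingleton.elim (q • u) 0, norm_zero]; exact zero_lt_one
      · rw [norm_smul, Real.norm_of_nonneg hq0.le, CStarRing.norm_of_mem_unitary hu, mul_one]
        exact hq1
    have h := (IsUnit.isStrictlyPositive_star_right_conjugate_iff (a := (1 : M))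
      (isUnit_one_sub_of_norm_lt_one hn)).2 isStrictlyPositive_one
    rwa [mul_one] at h
  rw [hfac, CFC.log_smul' _ (inv_pos.2 hq0) hpos, map_add,
    apply_log_one_sub_unitary hτ hu hτu hτu' hq0.le hq1, add_zero, Algebra.algebraMap_eq_smul_one,
    ← Complex.coe_smul, map_smul, hτ1, smul_eq_mul, mul_one, Complex.ofReal_re, Real.log_inv, hq,
    Real.log_exp]
  ring

end TraceLogInequalities

/-! ### The limit of the regularized traces, by squeezing -/

section

open Filter Topology

variable {M : Type*} [CStarAlgebra M]

/-- For an operator that is similar to `1 - u`, with `u` a unitary all of whose powers have trace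
zero, the regularized traces of the logarithm tend to zero. -/
theorem tendsto_re_apply_log {τ : M →L[ℂ] ℂ} (hτ : ∀ a b, τ (a * b) = τ (b * a)) (hτ1 : τ 1 = 1)
    (hpos : ∀ a : M, 0 ≤ (τ (star a * a)).re) {u : M} (hu : u ∈ unitary M)
    (hτu : ∀ n : ℕ, τ (u ^ (n + 1)) = 0) (hτu' : ∀ n : ℕ, τ (star u ^ (n + 1)) = 0)
    {S T : M} (hS : IsSelfAdjoint S) (hT : IsSelfAdjoint T) (hST : S * T = 1) (hTS : T * S = 1) :
    Tendsto (fun ε : ℝ => (τ (CFC.log (star (S * (1 - u) * T) * (S * (1 - u) * T) +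
      algebraMap ℝ M ε))).re) (𝓝[>] 0) (𝓝 0) := by
  let : PartialOrder M := CStarAlgebra.spectralOrder M
  let : StarOrderedRing M := CStarAlgebra.spectralOrderedRing M
  have hpos' : ∀ a : M, 0 ≤ a → 0 ≤ (τ a).re := by
    intro a ha
    obtain ⟨b, rfl⟩ := CStarAlgebra.nonneg_iff_eq_star_mul_self.1 ha
    exact hpos b
  obtain ⟨c₁, c₂, hc₁, hc₂, h⟩ := re_apply_log_similar hτ hpos' hS hT hST hTS (1 - u)
  have hlim : ∀ c : ℝ, Tendsto (fun ε : ℝ => 2 * Real.arsinh (√(c * ε) / 2)) (𝓝[>] 0) (𝓝 0) := by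
    intro c
    have hcont : Continuous fun ε : ℝ => 2 * Real.arsinh (√(c * ε) / 2) :=
      continuous_const.mul (Real.continuous_arsinh.comp (by fun_prop))
    have h0 := hcont.tendsto 0
    simp only [mul_zero, Real.sqrt_zero, zero_div, Real.arsinh_zero] at h0
    exact h0.mono_left nhdsWithin_le_nhds
  refine tendsto_of_tendsto_of_tendsto_of_le_of_le' (hlim c₁) (hlim c₂) ?_ ?_
  · filter_upwards [self_mem_nhdsWithin] with ε hε
    rw [← re_apply_log_one_sub_add hτ hτ1 hu hτu hτu' (mul_pos hc₁ hε)]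
    exact (h ε hε).1
  · filter_upwards [self_mem_nhdsWithin] with ε hε
    rw [← re_apply_log_one_sub_add hτ hτ1 hu hτu hτu' (mul_pos hc₂ hε)]
    exact (h ε hε).2

end

/-! ### Removing the regularization from the integral of the logarithm -/

section LogIntegral

open Filter Topology

/-- Monotone convergence for the regularizations of the logarithm. -/
lemma integral_log_of_tendsto (μ : Measure ℝ) [IsFiniteMeasure μ] {B : ℝ}
    (hB : ∀ᵐ s ∂μ, 0 ≤ s ∧ s ≤ B)
    (h : Tendsto (fun n : ℕ => ∫ s, Real.log (s + 1 / ((n : ℝ) + 1)) ∂μ) atTop (𝓝 0)) :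
    (∀ᵐ s ∂μ, 0 < s) ∧ Integrable Real.log μ ∧ ∫ s, Real.log s ∂μ = 0 := by
  -- A common upper bound for all regularized logarithms, as the regularization parameters are at
  -- most `1`; the functions `D - log (s + ε)` are then nonnegative.
  set D : ℝ := Real.log (B + 1)
  have hε0 : ∀ n : ℕ, 0 < 1 / ((n : ℝ) + 1) := fun n => by positivity
  have hε1 : ∀ n : ℕ, 1 / ((n : ℝ) + 1) ≤ 1 := fun n => by
    rw [div_le_one (by positivity)]
    exact le_add_of_nonneg_left (Nat.cast_nonneg n)
  have hle : ∀ (n : ℕ) (s : ℝ), 0 ≤ s ∧ s ≤ B → Real.log (s + 1 / ((n : ℝ) + 1)) ≤ D := by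
    intro n s hs
    exact Real.log_le_log (by linarith [hε0 n, hs.1]) (by linarith [hε1 n, hs.2])
  have hge : ∀ (n : ℕ) (s : ℝ), 0 ≤ s ∧ s ≤ B →
      Real.log (1 / ((n : ℝ) + 1)) ≤ Real.log (s + 1 / ((n : ℝ) + 1)) := by
    intro n s hs
    exact Real.log_le_log (hε0 n) (by linarith [hs.1])
  have hmeas : ∀ n : ℕ, Measurable fun s : ℝ => Real.log (s + 1 / ((n : ℝ) + 1)) := fun n =>
    Real.measurable_log.comp (measurable_id.add_const _)
  have hint : ∀ n : ℕ, Integrable (fun s : ℝ => Real.log (s + 1 / ((n : ℝ) + 1))) μ := by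
    intro n
    refine Integrable.of_bound (hmeas n).aestronglyMeasurable
      (|D| + |Real.log (1 / ((n : ℝ) + 1))|) ?_
    filter_upwards [hB] with s hs
    rw [Real.norm_eq_abs, abs_le]
    have h1 := hle n s hs
    have h2 := hge n s hs
    constructor
    · linarith [neg_abs_le (Real.log (1 / ((n : ℝ) + 1))), abs_nonneg D]
    · linarith [le_abs_self D, abs_nonneg (Real.log (1 / ((n : ℝ) + 1)))]
  have hsub : ∀ n : ℕ, ∫ s, (D - Real.log (s + 1 / ((n : ℝ) + 1))) ∂μ =
      D * μ.real Set.univ - ∫ s, Real.log (s + 1 / ((n : ℝ) + 1)) ∂μ := by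
    intro n
    rw [integral_sub (integrable_const _) (hint n), integral_const, smul_eq_mul, mul_comm]
  have hlim : Tendsto (fun n : ℕ => ∫ s, (D - Real.log (s + 1 / ((n : ℝ) + 1))) ∂μ) atTop
      (𝓝 (D * μ.real Set.univ)) := by
    simp_rw [hsub]
    simpa using h.const_sub (D * μ.real Set.univ)
  obtain ⟨C, hC⟩ := hlim.bddAbove_range
  have hCn : ∀ n : ℕ, ∫ s, (D - Real.log (s + 1 / ((n : ℝ) + 1))) ∂μ ≤ C := fun n => hC ⟨n, rfl⟩
  -- An atom at `0` would contribute its mass times `log ε`, which tends to `-∞`, against the bound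
  -- `C`. It has to be excluded because `Real.log 0 = 0` is not the limit of `log ε`.
  have hzero : μ {0} = 0 := by
    by_contra hne
    have hpos : 0 < μ.real {0} := ENNReal.toReal_pos hne (measure_ne_top _ _)
    have hbound : ∀ n : ℕ, (D - Real.log (1 / ((n : ℝ) + 1))) * μ.real {0} ≤ C := by
      intro n
      refine le_trans ?_ (hCn n)
      have h1 : (D - Real.log (1 / ((n : ℝ) + 1))) * μ.real {0} =
          ∫ s in ({0} : Set ℝ), (D - Real.log (s + 1 / ((n : ℝ) + 1))) ∂μ := by
        rw [integral_singleton, zero_add, smul_eq_mul, mul_comm]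
      rw [h1]
      refine setIntegral_le_integral ((integrable_const _).sub (hint n)) ?_
      filter_upwards [hB] with s hs
      exact sub_nonneg.2 (hle n s hs)
    have hlog : Tendsto (fun n : ℕ => Real.log ((n : ℝ) + 1)) atTop atTop :=
      Real.tendsto_log_atTop.comp (tendsto_atTop_add_const_right _ _ tendsto_natCast_atTop_atTop)
    obtain ⟨n, hn⟩ := (hlog.eventually_gt_atTop (C / μ.real {0} - D)).exists
    have h2 := hbound n
    rw [one_div, Real.log_inv, sub_neg_eq_add, ← le_div_iff₀ hpos] at h2
    linarith
  have hae : ∀ᵐ s ∂μ, 0 < s := by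
    have h0 : ∀ᵐ s ∂μ, s ≠ 0 := by
      rw [ae_iff]
      simpa using hzero
    filter_upwards [hB, h0] with s hs hs0
    exact lt_of_le_of_ne hs.1 (Ne.symm hs0)
  have hεlim : Tendsto (fun n : ℕ => 1 / ((n : ℝ) + 1)) atTop (𝓝 0) :=
    tendsto_one_div_add_atTop_nhds_zero_nat
  have hpt : ∀ s : ℝ, 0 < s →
      Tendsto (fun n : ℕ => Real.log (s + 1 / ((n : ℝ) + 1))) atTop (𝓝 (Real.log s)) := by
    intro s hs
    have h1 : Tendsto (fun n : ℕ => s + 1 / ((n : ℝ) + 1)) atTop (𝓝 s) := by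
      simpa using hεlim.const_add s
    exact (Real.continuousAt_log hs.ne').tendsto.comp h1
  -- Fatou's lemma: the integrals of the nonnegative functions `D - log (s + ε)` are bounded by `C`.
  have hintD : Integrable (fun s => D - Real.log s) μ := by
    refine integrable_of_tendsto (G := fun n s => D - Real.log (s + 1 / ((n : ℝ) + 1))) ?_
      (fun n => (measurable_const.sub (hmeas n)).aestronglyMeasurable) ?_
    · filter_upwards [hae] with s hs
      exact (hpt s hs).const_sub D
    · have hb : ∀ n : ℕ, ∫⁻ s, ‖D - Real.log (s + 1 / ((n : ℝ) + 1))‖ₑ ∂μ ≤ ENNReal.ofReal C := by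
        intro n
        have hi : Integrable (fun s => D - Real.log (s + 1 / ((n : ℝ) + 1))) μ :=
          (integrable_const _).sub (hint n)
        rw [← ofReal_integral_norm_eq_lintegral_enorm hi]
        refine ENNReal.ofReal_le_ofReal (le_trans (le_of_eq ?_) (hCn n))
        refine integral_congr_ae ?_
        filter_upwards [hB] with s hs
        exact Real.norm_of_nonneg (sub_nonneg.2 (hle n s hs))
      refine ne_top_of_le_ne_top (ENNReal.ofReal_ne_top (r := C)) ?_
      exact liminf_le_of_frequently_le' (Frequently.of_forall hb)
  have hlogint : Integrable Real.log μ := by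
    have h1 := (integrable_const D).sub hintD
    refine h1.congr (Eventually.of_forall fun s => ?_)
    simp
  refine ⟨hae, hlogint, ?_⟩
  have hdom := tendsto_integral_of_dominated_convergence (μ := μ)
    (F := fun (n : ℕ) s => Real.log (s + 1 / ((n : ℝ) + 1))) (f := Real.log)
    (fun s => |Real.log s| + |D|) (fun n => (hmeas n).aestronglyMeasurable)
    (hlogint.abs.add (integrable_const _))
    (fun n => by
      filter_upwards [hB, hae] with s hs hs0
      rw [Real.norm_eq_abs, abs_le]
      have h1 := hle n s hs
      have h2 : Real.log s ≤ Real.log (s + 1 / ((n : ℝ) + 1)) :=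
        Real.log_le_log hs0 (by linarith [hε0 n])
      constructor
      · linarith [neg_abs_le (Real.log s), abs_nonneg D]
      · linarith [le_abs_self D, abs_nonneg (Real.log s)])
    (by filter_upwards [hae] with s hs using hpt s hs)
  exact tendsto_nhds_unique hdom h

end LogIntegral

/-! ### The spectral measure of the trace, and the determinant as an integral against it -/

section SpectralMeasure

open Filter Topology

variable {G : Type*} [Group G] {ι : Type*} [Fintype ι]
variable {U : Type*} [NormedAddCommGroup U] [InnerProductSpace ℂ U] [CompleteSpace U]
variable {U' : Type*} [NormedAddCommGroup U'] [InnerProductSpace ℂ U'] [CompleteSpace U']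

lemma vnTrace_eq (j : U →ₗᵢ[ℂ] L2pow G ι) (T : U →L[ℂ] U) :
    vnTrace j T = ∑ i : ι,
      inner ℂ (ContinuousLinearMap.adjoint j.toContinuousLinearMap (unitVec G i))
        (T (ContinuousLinearMap.adjoint j.toContinuousLinearMap (unitVec G i))) := by
  refine Finset.sum_congr rfl fun i _ => ?_
  rw [ContinuousLinearMap.adjoint_inner_left]
  rfl

lemma vnTrace_re_nonneg (j : U →ₗᵢ[ℂ] L2pow G ι) {T : U →L[ℂ] U} (hT : 0 ≤ T) :
    0 ≤ (vnTrace j T).re := by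
  rw [vnTrace_eq, Complex.re_sum]
  refine Finset.sum_nonneg fun i _ => ?_
  exact ((ContinuousLinearMap.nonneg_iff_isPositive T).1 hT).re_inner_nonneg_right _

/-- The real part of the von Neumann trace, as a linear map. -/
def reTrace (j : U →ₗᵢ[ℂ] L2pow G ι) : (U →L[ℂ] U) →ₗ[ℝ] ℝ where
  toFun T := (vnTrace j T).re
  map_add' S T := by
    simp [vnTrace_eq, Finset.sum_add_distrib]
  map_smul' c T := by
    simp only [vnTrace_eq, smul_apply, Complex.re_sum, Finset.smul_sum,
      RingHom.id_apply]
    refine Finset.sum_congr rfl fun i _ => ?_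
    rw [inner_smul_right_eq_smul]
    simp

/-- The spectral measure of a self-adjoint operator for the von Neumann trace. -/
lemma exists_spectralMeasure (j : U →ₗᵢ[ℂ] L2pow G ι) {T : U →L[ℂ] U} (hT : IsSelfAdjoint T) :
    ∃ μ : Measure ℝ, IsFiniteMeasure μ ∧ (∀ᵐ s ∂μ, s ∈ spectrum ℝ T) ∧
      ∀ f : ℝ → ℝ, ContinuousOn f (spectrum ℝ T) →
        ∫ s, f s ∂μ = (vnTrace j (cfc f T)).re := by
  have hcomp : IsCompact (spectrum ℝ T) := spectrum.isCompact T
  have : CompactSpace (spectrum ℝ T) := isCompact_iff_compactSpace.1 hcomp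
  -- The trace of the functional calculus is a positive functional on the continuous functions on
  -- the compact spectrum; its Riesz measure, pushed to the line, is the measure wanted.
  let Λ₀ : CompactlySupportedContinuousMap (spectrum ℝ T) ℝ →ₗ[ℝ] ℝ :=
    { toFun := fun f => reTrace j (cfcHom (R := ℝ) hT f.toContinuousMap)
      map_add' := fun f g => by
        have : (f + g).toContinuousMap = f.toContinuousMap + g.toContinuousMap := rfl
        rw [this, map_add, map_add]
      map_smul' := fun c f => by
        have : (c • f).toContinuousMap = c • f.toContinuousMap := rfl
        rw [this, map_smul, map_smul]; rfl }
  let Λ : CompactlySupportedContinuousMap (spectrum ℝ T) ℝ →ₚ[ℝ] ℝ :=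
    PositiveLinearMap.mk₀ Λ₀ fun f hf => vnTrace_re_nonneg j
      ((cfcHom_nonneg_iff (R := ℝ) hT).2 hf)
  have hemb : MeasurableEmbedding (Subtype.val : spectrum ℝ T → ℝ) :=
    MeasurableEmbedding.subtype_coe hcomp.isClosed.measurableSet
  refine ⟨(RealRMK.rieszMeasure Λ).map Subtype.val, inferInstance, ?_, fun f hf => ?_⟩
  · rw [hemb.ae_map_iff]
    exact Eventually.of_forall fun s => s.2
  · rw [hemb.integral_map, cfc_apply f T hT hf]
    exact RealRMK.integral_rieszMeasure Λ (CompactlySupportedContinuousMap.continuousMapEquiv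
      ⟨(spectrum ℝ T).domRestrict f, hf.domRestrict⟩)

/-- Continuous cutoffs at `c`. -/
def cutoff (c : ℝ) (n : ℕ) (s : ℝ) : ℝ := max (1 - (n + 1) * max (s - c) 0) 0

lemma continuous_cutoff (c : ℝ) (n : ℕ) : Continuous (cutoff c n) := by
  unfold cutoff
  fun_prop

lemma cutoff_nonneg (c : ℝ) (n : ℕ) (s : ℝ) : 0 ≤ cutoff c n s := le_max_right _ _

lemma cutoff_le_one (c : ℝ) (n : ℕ) (s : ℝ) : cutoff c n s ≤ 1 := by
  refine max_le ?_ zero_le_one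
  have : 0 ≤ ((n : ℝ) + 1) * max (s - c) 0 := by positivity
  linarith

lemma cutoff_of_le {c s : ℝ} (h : s ≤ c) (n : ℕ) : cutoff c n s = 1 := by
  simp [cutoff, max_eq_right (sub_nonpos.2 h)]

lemma tendsto_cutoff {c s : ℝ} (h : c < s) : Tendsto (fun n => cutoff c n s) atTop (𝓝 0) := by
  have hlim : Tendsto (fun n : ℕ => ((n : ℝ) + 1) * (s - c)) atTop atTop :=
    (tendsto_atTop_add_const_right _ _ tendsto_natCast_atTop_atTop).atTop_mul_const (sub_pos.2 h)
  refine tendsto_const_nhds.congr' ?_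
  filter_upwards [hlim.eventually_ge_atTop 1] with n hn
  rw [cutoff, max_eq_left (sub_pos.2 h).le, max_eq_right (by linarith)]

/-- The cutoffs of a self-adjoint operator converge strongly to the spectral projection. -/
lemma tendsto_cfc_cutoff {T : U →L[ℂ] U} (hT : IsSelfAdjoint T) (c : ℝ) (x : U) :
    Tendsto (fun n => (cfc (cutoff c n) T : U →L[ℂ] U) x) atTop (𝓝 (spectralProj T c x)) := by
  set R : U →L[ℂ] U := cfc (fun s : ℝ => max (s - c) 0) T with hR
  have hRsa : IsSelfAdjoint R := cfc_predicate _ _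
  set K : Submodule ℂ U := LinearMap.ker R.toLinearMap with hK
  have hKclosed : IsClosed (K : Set U) := R.isClosed_ker
  have hPdef : spectralProj T c = K.starProjection := rfl
  -- The cutoff equals `1` minus a continuous multiple of the positive part of `s - c`, so it acts
  -- as the identity on the kernel of `R`.
  have hfix : ∀ (n : ℕ) (y : U), y ∈ K → (cfc (cutoff c n) T : U →L[ℂ] U) y = y := by
    intro n y hy
    have hpos : ∀ s : ℝ, max (max (s - c) 0) (1 / ((n : ℝ) + 1)) ≠ 0 := fun s =>
      (lt_of_lt_of_le (by positivity) (le_max_right _ _)).ne'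
    have hg : Continuous fun s : ℝ => 1 / max (max (s - c) 0) (1 / ((n : ℝ) + 1)) :=
      Continuous.div (by fun_prop) (by fun_prop) hpos
    have key : cutoff c n = fun s => 1 -
        (1 / max (max (s - c) 0) (1 / ((n : ℝ) + 1))) * max (s - c) 0 := by
      funext s
      have hu : 0 ≤ max (s - c) 0 := le_max_right _ _
      simp only [cutoff]
      generalize max (s - c) 0 = u at hu
      have hn : (0 : ℝ) < (n : ℝ) + 1 := by positivity
      rcases le_total u (1 / ((n : ℝ) + 1)) with h | h
      · have h' : ((n : ℝ) + 1) * u ≤ 1 := by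
          rw [le_div_iff₀ hn] at h; linarith
        rw [max_eq_right h, max_eq_left (by linarith)]
        field_simp
      · have h' : 1 ≤ ((n : ℝ) + 1) * u := by
          rw [div_le_iff₀ hn] at h; linarith
        have hu0 : 0 < u := lt_of_lt_of_le (by positivity) h
        rw [max_eq_left h, max_eq_right (by linarith)]
        field_simp
        simp
    have hm : Continuous fun s : ℝ => max (s - c) 0 := by fun_prop
    rw [key, cfc_sub (fun _ : ℝ => (1 : ℝ))
      (fun s : ℝ => (1 / max (max (s - c) 0) (1 / ((n : ℝ) + 1))) * max (s - c) 0) T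
      continuousOn_const (hg.mul hm).continuousOn, cfc_const_one ℝ T,
      cfc_mul _ _ T hg.continuousOn (by fun_prop), sub_apply,
      mul_apply_eq_comp, ← hR]
    have : R y = 0 := hy
    rw [this, map_zero, sub_zero]
    rfl
  have hnorm : ∀ n : ℕ, ‖(cfc (cutoff c n) T : U →L[ℂ] U)‖ ≤ 1 := fun n =>
    norm_cfc_le zero_le_one fun s _ => by
      rw [Real.norm_of_nonneg (cutoff_nonneg c n s)]
      exact cutoff_le_one c n s
  -- The function `max (1 - (n + 1) u) 0 * u` is at most `1 / (n + 1)`. Thus the cutoffs tend to `0`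
  -- on the range of `R`, and on its closure `Kᗮ` because they are contractions.
  have hnormR : ∀ n : ℕ, ‖(cfc (cutoff c n) T : U →L[ℂ] U) * R‖ ≤ 1 / ((n : ℝ) + 1) := by
    intro n
    rw [hR, ← cfc_mul _ _ T (continuous_cutoff c n).continuousOn (by fun_prop)]
    refine norm_cfc_le (by positivity) fun s _ => ?_
    rw [Real.norm_of_nonneg (mul_nonneg (cutoff_nonneg c n s) (le_max_right _ _))]
    have hu : 0 ≤ max (s - c) 0 := le_max_right _ _
    simp only [cutoff]
    generalize max (s - c) 0 = u at hu
    have hn : (0 : ℝ) < (n : ℝ) + 1 := by positivity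
    rw [le_div_iff₀ hn]
    rcases le_total (1 - ((n : ℝ) + 1) * u) 0 with h | h
    · rw [max_eq_right h]; simp
    · rw [max_eq_left h]
      have h3 : 0 ≤ ((n : ℝ) + 1) * u := by positivity
      nlinarith
  have hperp : ∀ y ∈ Kᗮ, Tendsto (fun n => (cfc (cutoff c n) T : U →L[ℂ] U) y) atTop (𝓝 0) := by
    intro y hy
    have hy' : y ∈ (LinearMap.range R.toLinearMap).topologicalClosure := by
      rw [hK, ContinuousLinearMap.orthogonal_ker] at hy
      rwa [← ContinuousLinearMap.star_eq_adjoint, hRsa.star_eq] at hy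
    rw [Metric.tendsto_atTop]
    intro ε hε
    obtain ⟨_, ⟨z, rfl⟩, hz⟩ := Metric.mem_closure_iff.1 hy' (ε / 2) (half_pos hε)
    obtain ⟨N, hN⟩ := exists_nat_gt (2 * ‖z‖ / ε)
    refine ⟨N, fun n hn => ?_⟩
    rw [dist_zero_right]
    have h1 : (cfc (cutoff c n) T : U →L[ℂ] U) y =
        (cfc (cutoff c n) T : U →L[ℂ] U) (y - R z) + ((cfc (cutoff c n) T : U →L[ℂ] U) * R) z := by
      rw [map_sub, mul_apply_eq_comp]
      abel
    rw [h1]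
    have hz' : ‖y - R z‖ < ε / 2 := by rwa [dist_eq_norm] at hz
    have h2 : ‖(cfc (cutoff c n) T : U →L[ℂ] U) (y - R z)‖ ≤ ‖y - R z‖ :=
      (ContinuousLinearMap.le_of_opNorm_le _ (hnorm n) _).trans_eq (one_mul _)
    have h3 : ‖((cfc (cutoff c n) T : U →L[ℂ] U) * R) z‖ ≤ 1 / ((n : ℝ) + 1) * ‖z‖ :=
      ContinuousLinearMap.le_of_opNorm_le _ (hnormR n) _
    have h4 : 1 / ((n : ℝ) + 1) * ‖z‖ ≤ ε / 2 := by
      have hn' : 2 * ‖z‖ / ε < (n : ℝ) + 1 := by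
        have : (N : ℝ) ≤ n := by exact_mod_cast hn
        linarith
      rw [div_lt_iff₀ hε] at hn'
      rw [one_div, inv_mul_le_iff₀ (by positivity)]
      linarith
    linarith [norm_add_le ((cfc (cutoff c n) T : U →L[ℂ] U) (y - R z))
      (((cfc (cutoff c n) T : U →L[ℂ] U) * R) z)]
  have hdecomp : ∀ n, (cfc (cutoff c n) T : U →L[ℂ] U) x =
      spectralProj T c x + (cfc (cutoff c n) T : U →L[ℂ] U) (x - spectralProj T c x) := by
    intro n
    rw [map_sub, hfix n (spectralProj T c x) (by
      rw [hPdef]; exact K.starProjection_apply_mem x)]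
    abel
  simp_rw [hdecomp]
  have h := (hperp (x - spectralProj T c x) (by
    rw [hPdef]; exact K.sub_starProjection_mem_orthogonal x)).const_add (spectralProj T c x)
  simpa using h

/-- The cutoffs decrease to the indicator function of `(-∞, c]`, and their operators converge
strongly to the spectral projection. Strong convergence suffices, the trace being a finite sum of
vector functionals. -/
lemma measureReal_Iic_eq (j : U →ₗᵢ[ℂ] L2pow G ι) {T : U →L[ℂ] U} (hT : IsSelfAdjoint T)
    {μ : Measure ℝ} [IsFiniteMeasure μ]
    (hμ : ∀ f : ℝ → ℝ, ContinuousOn f (spectrum ℝ T) → ∫ s, f s ∂μ = (vnTrace j (cfc f T)).re)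
    (c : ℝ) : μ.real (Set.Iic c) = (vnTrace j (spectralProj T c)).re := by
  have h1 : Tendsto (fun n => ∫ s, cutoff c n s ∂μ) atTop (𝓝 (μ.real (Set.Iic c))) := by
    have h := tendsto_integral_of_dominated_convergence (μ := μ) (F := fun n s => cutoff c n s)
      (f := (Set.Iic c).indicator 1) (fun _ => (1 : ℝ))
      (fun n => (continuous_cutoff c n).aestronglyMeasurable) (integrable_const _)
      (fun n => Eventually.of_forall fun s => by
        rw [Real.norm_of_nonneg (cutoff_nonneg c n s)]
        exact cutoff_le_one c n s)
      (Eventually.of_forall fun s => by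
        rcases le_or_gt s c with hs | hs
        · rw [Set.indicator_of_mem (show s ∈ Set.Iic c from hs)]
          simp_rw [cutoff_of_le hs]
          exact tendsto_const_nhds
        · rw [Set.indicator_of_notMem (show s ∉ Set.Iic c from not_le.2 hs)]
          exact tendsto_cutoff hs)
    rwa [integral_indicator_one measurableSet_Iic] at h
  have h2 : Tendsto (fun n => (vnTrace j (cfc (cutoff c n) T)).re) atTop
      (𝓝 (vnTrace j (spectralProj T c)).re) := by
    simp_rw [vnTrace_eq]
    refine (Complex.continuous_re.tendsto _).comp (tendsto_finsetSum _ fun i _ => ?_)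
    exact Tendsto.inner tendsto_const_nhds (tendsto_cfc_cutoff hT c _)
  refine tendsto_nhds_unique h1 (h2.congr fun n => ?_)
  rw [hμ _ (continuous_cutoff c n).continuousOn]

/-- The measure `dF_A` is the image of the spectral measure of `A* A` under the square root. -/
lemma spectralDensityMeasure_eq_map (j : U →ₗᵢ[ℂ] L2pow G ι) (A : U →L[ℂ] U') {μ : Measure ℝ}
    [IsFiniteMeasure μ]
    (hμ : ∀ f : ℝ → ℝ, ContinuousOn f (spectrum ℝ (ContinuousLinearMap.adjoint A ∘L A)) →
      ∫ s, f s ∂μ = (vnTrace j (cfc f (ContinuousLinearMap.adjoint A ∘L A))).re) :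
    spectralDensityMeasure j A = μ.map Real.sqrt := by
  have hsa : IsSelfAdjoint (ContinuousLinearMap.adjoint A ∘L A) :=
    (ContinuousLinearMap.isPositive_adjoint_comp_self A).isSelfAdjoint
  set ν : Measure ℝ := μ.map Real.sqrt with hν
  have hmeas : Measurable Real.sqrt := Real.continuous_sqrt.measurable
  have hF : ∀ r, spectralDensity j A r = ν.real (Set.Iic r) := by
    intro r
    rw [Measure.real, hν, Measure.map_apply hmeas measurableSet_Iic]
    unfold spectralDensity
    split_ifs with hr
    · have : Real.sqrt ⁻¹' Set.Iic r = ∅ := by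
        ext s
        simp only [Set.mem_preimage, Set.mem_Iic, Set.mem_empty_iff_false, iff_false, not_le]
        exact hr.trans_le (Real.sqrt_nonneg s)
      simp [this]
    · rw [← measureReal_Iic_eq j hsa hμ, Measure.real]
      congr 2
      -- The equivalence of `√s ≤ r` and `s ≤ r²` for `r ≥ 0` holds for negative `s` too, since the
      -- square root is then `0`.
      ext s
      simp only [Set.mem_preimage, Set.mem_Iic]
      exact (Real.sqrt_le_left (not_lt.1 hr)).symm
  -- A Stieltjes function is built from right limits; right continuity shows that nothing is
  -- changed.
  have hright : ∀ r, Function.rightLim (spectralDensity j A) r = spectralDensity j A r := by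
    intro r
    refine ContinuousWithinAt.rightLim_eq ?_
    rw [← continuousWithinAt_Ioi_iff_Ici]
    rw [show spectralDensity j A = fun r => ν.real (Set.Iic r) from funext hF]
    have h := tendsto_measure_biInter_gt (μ := ν) (s := fun r => Set.Iic r) (a := r)
      (fun r _ => measurableSet_Iic.nullMeasurableSet) (fun i k _ hik => Set.Iic_subset_Iic.2 hik)
      ⟨r + 1, by simp, measure_ne_top _ _⟩
    have hinter : (⋂ x, ⋂ (_ : x > r), Set.Iic x) = Set.Iic r := by
      ext s
      simp only [Set.mem_iInter, Set.mem_Iic]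
      exact ⟨fun h => le_of_forall_gt_imp_ge_of_dense h, fun h x hx => h.trans hx.le⟩
    rw [hinter] at h
    exact (ENNReal.tendsto_toReal (measure_ne_top _ _)).comp h
  symm
  refine Measure.ext_of_Iic _ _ fun r => ?_
  have hbot : Tendsto (spectralDensity_mono j A).stieltjesFunction atBot (𝓝 0) := by
    refine tendsto_const_nhds.congr' ?_
    filter_upwards [eventually_lt_atBot (0 : ℝ)] with r hr
    rw [Monotone.stieltjesFunction_eq, hright, spectralDensity, if_pos hr]
  rw [spectralDensityMeasure, StieltjesFunction.measure_Iic _ hbot, Monotone.stieltjesFunction_eq,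
    hright, hF, sub_zero, Measure.real, ENNReal.ofReal_toReal (measure_ne_top _ _)]

lemma spectrum_adjoint_comp_self_nonneg (A : U →L[ℂ] U') {s : ℝ}
    (hs : s ∈ spectrum ℝ (ContinuousLinearMap.adjoint A ∘L A)) : 0 ≤ s :=
  spectrum_nonneg_of_nonneg ((ContinuousLinearMap.nonneg_iff_isPositive _).2
    (ContinuousLinearMap.isPositive_adjoint_comp_self A)) hs

/-- The Fuglede–Kadison determinant is `1` if the regularized traces of the logarithm tend to
zero. -/
theorem fkDet_eq_one_of_tendsto (j : U →ₗᵢ[ℂ] L2pow G ι) (A : U →L[ℂ] U')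
    (h : Tendsto (fun ε : ℝ => (vnTrace j (CFC.log (ContinuousLinearMap.adjoint A ∘L A +
      algebraMap ℝ (U →L[ℂ] U) ε))).re) (𝓝[>] 0) (𝓝 0)) : fkDet j A = 1 := by
  set T : U →L[ℂ] U := ContinuousLinearMap.adjoint A ∘L A with hTdef
  have hsa : IsSelfAdjoint T :=
    (ContinuousLinearMap.isPositive_adjoint_comp_self A).isSelfAdjoint
  obtain ⟨μ, hfin, hspec, hμ⟩ := exists_spectralMeasure j hsa
  have hmap := spectralDensityMeasure_eq_map j A hμ
  have hB : ∀ᵐ s ∂μ, 0 ≤ s ∧ s ≤ ‖T‖ := by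
    filter_upwards [hspec] with s hs
    refine ⟨spectrum_adjoint_comp_self_nonneg A hs, ?_⟩
    rcases subsingleton_or_nontrivial U with hU | hU
    · have : Subsingleton (U →L[ℂ] U) := ⟨fun a b => by ext x; exact Subsingleton.elim _ _⟩
      exact absurd hs (by simp [spectrum.of_subsingleton])
    · exact (le_abs_self s).trans (spectrum.norm_le_norm_of_mem hs)
  have hlog : ∀ ε : ℝ, 0 < ε → CFC.log (T + algebraMap ℝ (U →L[ℂ] U) ε) =
      cfc (fun s : ℝ => Real.log (s + ε)) T := by
    intro ε hε
    have h1 : T + algebraMap ℝ (U →L[ℂ] U) ε = cfc (fun s : ℝ => s + ε) T := by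
      rw [cfc_add_const ε (fun s : ℝ => s) T, cfc_id' ℝ T]
    have hcont : ContinuousOn Real.log ((fun s : ℝ => s + ε) '' spectrum ℝ T) := by
      rintro y ⟨s, hs, rfl⟩
      refine (Real.continuousAt_log ?_).continuousWithinAt
      have := spectrum_adjoint_comp_self_nonneg A hs
      dsimp only
      linarith
    rw [CFC.log, h1, ← cfc_comp' Real.log (fun s : ℝ => s + ε) T hcont]
  have hεlim : Tendsto (fun n : ℕ => 1 / ((n : ℝ) + 1)) atTop (𝓝[>] 0) :=
    tendsto_nhdsWithin_iff.2 ⟨tendsto_one_div_add_atTop_nhds_zero_nat,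
      Eventually.of_forall fun n => Set.mem_Ioi.2 (by positivity)⟩
  have hseq : Tendsto (fun n : ℕ => ∫ s, Real.log (s + 1 / ((n : ℝ) + 1)) ∂μ) atTop (𝓝 0) := by
    refine (h.comp hεlim).congr fun n => ?_
    have hn : (0 : ℝ) < 1 / ((n : ℝ) + 1) := by positivity
    rw [Function.comp_apply, hlog _ hn, hμ]
    intro s hs
    refine ContinuousAt.continuousWithinAt ?_
    have := spectrum_adjoint_comp_self_nonneg A hs
    exact ContinuousAt.log (by fun_prop) (by linarith)
  obtain ⟨hpos, hint, hzero⟩ := integral_log_of_tendsto μ hB hseq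
  have hsqrt : Measurable Real.sqrt := Real.continuous_sqrt.measurable
  -- There is no mass at `0`, so integrating over `(0, ∞)` only, as in the determinant, loses
  -- nothing.
  have hae : ∀ᵐ r ∂(μ.map Real.sqrt), r ∈ Set.Ioi (0 : ℝ) := by
    refine (ae_map_iff (p := fun r => r ∈ Set.Ioi (0 : ℝ)) hsqrt.aemeasurable
      measurableSet_Ioi).2 ?_
    filter_upwards [hpos] with s hs
    exact Real.sqrt_pos.2 hs
  have hcomp : (fun s => Real.log (Real.sqrt s)) =ᵐ[μ] fun s => Real.log s / 2 := by
    filter_upwards [hpos] with s hs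
    exact Real.log_sqrt hs.le
  unfold fkDet
  rw [hmap, IntegrableOn, Measure.restrict_eq_self_of_ae_mem hae, if_pos,
    integral_map hsqrt.aemeasurable Real.measurable_log.aestronglyMeasurable,
    integral_congr_ae hcomp, integral_div, hzero, zero_div, Real.exp_zero]
  rw [integrable_map_measure Real.measurable_log.aestronglyMeasurable hsqrt.aemeasurable]
  exact (hint.div_const 2).congr hcomp.symm

/-- The Fuglede–Kadison determinant of the zero operator is `1`. -/
theorem fkDet_zero (j : U →ₗᵢ[ℂ] L2pow G ι) : fkDet j (0 : U →L[ℂ] U') = 1 := by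
  have hT : ContinuousLinearMap.adjoint (0 : U →L[ℂ] U') ∘L (0 : U →L[ℂ] U') = 0 := by simp
  have hsa : IsSelfAdjoint (ContinuousLinearMap.adjoint (0 : U →L[ℂ] U') ∘L (0 : U →L[ℂ] U')) :=
    (ContinuousLinearMap.isPositive_adjoint_comp_self _).isSelfAdjoint
  obtain ⟨μ, hfin, hspec, hμ⟩ := exists_spectralMeasure j hsa
  have hmap := spectralDensityMeasure_eq_map j (0 : U →L[ℂ] U') hμ
  have hs0 : ∀ᵐ s ∂μ, s = 0 := by
    filter_upwards [hspec] with s hs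
    rw [hT] at hs
    rcases subsingleton_or_nontrivial U with hU | hU
    · have : Subsingleton (U →L[ℂ] U) := ⟨fun a b => by ext x; exact Subsingleton.elim _ _⟩
      exact absurd hs (by simp [spectrum.of_subsingleton])
    · rw [spectrum.zero_eq] at hs
      exact hs
  -- All the mass sits at `0`, outside the domain of integration.
  have hnull : (μ.map Real.sqrt).restrict (Set.Ioi 0) = 0 := by
    rw [Measure.restrict_eq_zero,
      Measure.map_apply Real.continuous_sqrt.measurable measurableSet_Ioi]
    refine measure_eq_zero_iff_ae_notMem.2 ?_
    filter_upwards [hs0] with s hs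
    simp [hs]
  unfold fkDet
  rw [hmap, IntegrableOn, hnull, if_pos (integrable_zero_measure), integral_zero_measure,
    Real.exp_zero]

end SpectralMeasure

/-! ### Left and right translations on `L²(G)` and `L²(G)^n` -/

section Translations

variable {G : Type*} [Group G] {ι : Type*} [Fintype ι]

lemma leftMul_delta (g x : G) : leftMul g (delta x) = delta (g * x) :=
  pushforward_delta (g * ·) (mul_right_injective g) x

lemma leftMul_one : leftMul (1 : G) = 1 := ext_delta fun x => by simp [leftMul_delta]

lemma leftMul_mul (g h : G) : leftMul (g * h) = leftMul g * leftMul h :=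
  ext_delta fun x => by simp [leftMul_delta, mul_assoc]

lemma leftMul_mul_apply (g h : G) (ξ : L2 G) : leftMul (g * h) ξ = leftMul g (leftMul h ξ) := by
  rw [leftMul_mul]
  rfl

lemma inner_leftMul (g : G) (ξ η : L2 G) :
    inner ℂ (leftMul g ξ) (leftMul g η) = inner ℂ ξ η :=
  LinearIsometry.inner_map_map _ _ _

lemma leftMul_leftMul_inv (g : G) (ξ : L2 G) : leftMul g (leftMul g⁻¹ ξ) = ξ := by
  rw [← leftMul_mul_apply, mul_inv_cancel, leftMul_one]
  rfl

lemma star_leftMul (g : G) : star (leftMul g) = leftMul g⁻¹ := by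
  rw [ContinuousLinearMap.star_eq_adjoint]
  symm
  rw [ContinuousLinearMap.eq_adjoint_iff]
  intro ξ η
  rw [← inner_leftMul g, leftMul_leftMul_inv]

lemma rshift_leftMul (s g : G) (ξ : L2 G) : rshift s (leftMul g ξ) = leftMul g (rshift s ξ) := by
  have : (rshift s).toContinuousLinearMap * leftMul g =
      leftMul g * (rshift s).toContinuousLinearMap :=
    ext_delta fun x => by simp [leftMul_delta, rshift_delta, mul_assoc]
  exact congrArg (fun T : L2 G →L[ℂ] L2 G => T ξ) this

lemma star_rshift (s : G) :
    star (rshift s).toContinuousLinearMap = (rshift s⁻¹).toContinuousLinearMap := by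
  rw [ContinuousLinearMap.star_eq_adjoint]
  symm
  rw [ContinuousLinearMap.eq_adjoint_iff]
  intro ξ η
  have := (rshift s).inner_map_map (rshift s⁻¹ ξ) η
  refine this.symm.trans ?_
  have h : rshift s (rshift s⁻¹ ξ) = ξ := by
    ext x
    simp [rshift_apply]
  rw [h]
  rfl

lemma rightMul_single (g : G) (c : ℂ) :
    rightMul (MonoidAlgebra.single g c) = c • (rshift g).toContinuousLinearMap := by
  rw [rightMul, MonoidAlgebra.coeff_single, Finsupp.sum_single_index (by simp)]
  rfl

lemma rightMul_add (a b : MonoidAlgebra ℂ G) : rightMul (a + b) = rightMul a + rightMul b := by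
  rw [rightMul, MonoidAlgebra.coeff_add, Finsupp.sum_add_index' (by simp) (by simp [add_smul])]
  rfl

lemma rightMul_zero : rightMul (0 : MonoidAlgebra ℂ G) = 0 := by
  simp [rightMul]

lemma rightMul_leftMul (a : MonoidAlgebra ℂ G) (g : G) (ξ : L2 G) :
    rightMul a (leftMul g ξ) = leftMul g (rightMul a ξ) := by
  induction a using MonoidAlgebra.induction_linear with
  | zero => simp [rightMul_zero]
  | add a b ha hb => simp [rightMul_add, ha, hb]
  | single h c => simp [rightMul_single, rshift_leftMul]

lemma rightMul_one_sub_single (g : G) :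
    rightMul (1 - MonoidAlgebra.single g 1) = 1 - (rshift g).toContinuousLinearMap := by
  rw [sub_eq_add_neg, rightMul_add, MonoidAlgebra.one_def, ← MonoidAlgebra.single_neg,
    rightMul_single, rightMul_single]
  ext ξ : 1
  simp [sub_eq_add_neg, rshift_one]

lemma matrixOp_apply {X Y κ : Type*} [Fintype κ] (T : ι → κ → L2 X →L[ℂ] L2 Y) (v : L2pow X ι)
    (j : κ) : matrixOp T v j = ∑ i, T i j (v i) := by
  simp [matrixOp]

lemma diagOp_apply {X Y : Type*} (T : L2 X →L[ℂ] L2 Y) (v : L2pow X ι) (i : ι) :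
    diagOp T v i = T (v i) := by
  classical
  rw [diagOp, matrixOp_apply, Finset.sum_eq_single i]
  · simp
  · intro b _ hb
    simp [hb]
  · simp

lemma diagOp_leftMul_mul_apply (g h : G) (v : L2pow G ι) :
    diagOp (leftMul (g * h)) v = diagOp (leftMul g) (diagOp (leftMul h) v) := by
  ext i : 1
  simp only [diagOp_apply, leftMul_mul_apply]

lemma unitVec_apply_self (i : ι) : unitVec G i i = delta 1 := by
  simp [unitVec]

lemma unitVec_apply_of_ne {i k : ι} (h : k ≠ i) : unitVec G i k = 0 := by
  simp [unitVec, h]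

lemma inner_unitVec (i : ι) (v : L2pow G ι) :
    inner ℂ (unitVec G i) v = inner ℂ (delta 1) (v i) := by
  rw [PiLp.inner_apply, Finset.sum_eq_single i]
  · rw [unitVec_apply_self]
  · intro k _ hk
    rw [unitVec_apply_of_ne hk, inner_zero_left]
  · simp

end Translations

/-! ### The group von Neumann algebra and its trace -/

section GroupVonNeumann

variable (G : Type*) [Group G]

/-- The group von Neumann algebra: the bounded operators on `L²(G)` that commute with left
translations. -/
def vN : StarSubalgebra ℂ (L2 G →L[ℂ] L2 G) :=
  StarSubalgebra.centralizer ℂ (Set.range leftMul)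

/-- Norm closedness makes `vN G` a C*-algebra, so logarithms can be taken inside it, where the
functional `opTrace` is a trace. -/
instance : IsClosed (vN G : Set (L2 G →L[ℂ] L2 G)) := by
  rw [vN, StarSubalgebra.coe_centralizer]
  exact Set.isClosed_centralizer _

instance : CStarAlgebra (vN G) := StarSubalgebra.cstarAlgebra _

variable {G}

lemma mem_vN_iff {X : L2 G →L[ℂ] L2 G} :
    X ∈ vN G ↔ ∀ (g : G) (ξ : L2 G), X (leftMul g ξ) = leftMul g (X ξ) := by
  rw [vN, StarSubalgebra.mem_centralizer_iff]
  constructor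
  · intro h g ξ
    exact (congrArg (fun T : L2 G →L[ℂ] L2 G => T ξ) (h _ ⟨g, rfl⟩).1).symm
  · rintro h _ ⟨g, rfl⟩
    rw [star_leftMul]
    exact ⟨ContinuousLinearMap.ext fun ξ => (h g ξ).symm,
      ContinuousLinearMap.ext fun ξ => (h g⁻¹ ξ).symm⟩

lemma rshift_mem_vN (s : G) : (rshift s).toContinuousLinearMap ∈ vN G :=
  mem_vN_iff.2 fun g ξ => rshift_leftMul s g ξ

/-- The trace of the group von Neumann algebra, as a functional on all bounded operators. -/
def opTrace : (L2 G →L[ℂ] L2 G) →L[ℂ] ℂ :=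
  (innerSL ℂ (delta (1 : G))) ∘L ContinuousLinearMap.apply ℂ (L2 G) (delta (1 : G))

lemma opTrace_apply (X : L2 G →L[ℂ] L2 G) : opTrace X = inner ℂ (delta 1) (X (delta 1)) := rfl

lemma opTrace_one : opTrace (1 : L2 G →L[ℂ] L2 G) = 1 := by
  rw [opTrace_apply, inner_delta]
  exact delta_apply_self 1

lemma opTrace_star_mul_self (X : L2 G →L[ℂ] L2 G) : 0 ≤ (opTrace (star X * X)).re := by
  rw [opTrace_apply, ContinuousLinearMap.star_eq_adjoint, mul_apply_eq_comp,
    ContinuousLinearMap.adjoint_inner_right]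
  exact inner_self_nonneg (𝕜 := ℂ)

/-- By equivariance the matrix entries of `X` are those of the single vector `X (delta 1)`, and the
adjoint becomes conjugation combined with inversion in `G`. -/
lemma star_vN_apply_delta_one {X : L2 G →L[ℂ] L2 G} (hX : X ∈ vN G) (g : G) :
    (star X (delta 1)) g = star ((X (delta 1)) g⁻¹) := by
  rw [← inner_delta, ContinuousLinearMap.star_eq_adjoint, ContinuousLinearMap.adjoint_inner_right,
    ← inner_delta, ← inner_leftMul g⁻¹, leftMul_delta, ← mem_vN_iff.1 hX, leftMul_delta]
  simp

lemma opTrace_mul_eq_tsum {X : L2 G →L[ℂ] L2 G} (hX : X ∈ vN G) (Y : L2 G →L[ℂ] L2 G) :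
    opTrace (X * Y) = ∑' g : G, (X (delta 1)) g⁻¹ * (Y (delta 1)) g := by
  have h : opTrace (X * Y) = inner ℂ (star X (delta 1)) (Y (delta 1)) := by
    rw [ContinuousLinearMap.star_eq_adjoint, ContinuousLinearMap.adjoint_inner_left]
    rfl
  rw [h, lp.inner_eq_tsum]
  refine tsum_congr fun g => ?_
  rw [star_vN_apply_delta_one hX, RCLike.inner_apply]
  simp [mul_comm]

/-- The sum of `x(g⁻¹) y(g)` is symmetric under `g ↦ g⁻¹`. -/
lemma opTrace_mul_comm {X Y : L2 G →L[ℂ] L2 G} (hX : X ∈ vN G) (hY : Y ∈ vN G) :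
    opTrace (X * Y) = opTrace (Y * X) := by
  rw [opTrace_mul_eq_tsum hX, opTrace_mul_eq_tsum hY, ← (Equiv.inv G).tsum_eq]
  refine tsum_congr fun g => ?_
  simp [mul_comm]

lemma opTrace_rshift {s : G} (h : s ≠ 1) : opTrace (rshift s).toContinuousLinearMap = 0 := by
  rw [opTrace_apply, inner_delta, LinearIsometry.coe_toContinuousLinearMap, rshift_delta, one_mul,
    delta_apply_of_ne h.symm]

lemma rshift_pow (s : G) (n : ℕ) :
    (rshift s).toContinuousLinearMap ^ n = (rshift (s ^ n)).toContinuousLinearMap := by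
  induction n with
  | zero =>
    refine ext_delta fun x => ?_
    simp [rshift_delta]
  | succ n ih =>
    rw [pow_succ', ih]
    refine ext_delta fun x => ?_
    simp [rshift_delta, pow_succ, mul_assoc]

end GroupVonNeumann

/-! ### Similarity of Hilbert modules and the determinant of `1 - R_h` -/

section Similarity

open ContinuousLinearMap Filter Topology

variable {G : Type*} {ι : Type*} [Fintype ι]
variable {U : Type*} [NormedAddCommGroup U] [InnerProductSpace ℂ U]

/-- The coordinates of an operator from `L²(G)` to a subspace of `L²(G)^n`. -/
def coordOp (j : U →ₗᵢ[ℂ] L2pow G ι) (O : L2 G →L[ℂ] U) (i : ι) : L2 G →L[ℂ] L2 G :=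
  PiLp.proj 2 (fun _ : ι => L2 G) i ∘L j.toContinuousLinearMap ∘L O

lemma coordOp_apply (j : U →ₗᵢ[ℂ] L2pow G ι) (O : L2 G →L[ℂ] U) (i : ι) (ξ : L2 G) :
    coordOp j O i ξ = j (O ξ) i := rfl

lemma sum_star_coordOp_mul [CompleteSpace U] (j : U →ₗᵢ[ℂ] L2pow G ι) (O : L2 G →L[ℂ] U) :
    ∑ i, star (coordOp j O i) * coordOp j O i = adjoint O ∘L O := by
  ext1 ξ
  refine ext_inner_right ℂ fun η => ?_
  rw [sum_apply, sum_inner, ContinuousLinearMap.comp_apply,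
    adjoint_inner_left, ← j.inner_map_map, PiLp.inner_apply]
  refine Finset.sum_congr rfl fun i _ => ?_
  rw [star_eq_adjoint, mul_apply_eq_comp, adjoint_inner_left]
  rfl

variable [Group G]

lemma coordOp_mem_vN {j : U →ₗᵢ[ℂ] L2pow G ι} {O : L2 G →L[ℂ] U}
    (hO : ∀ (g : G) (ξ : L2 G), j (O (leftMul g ξ)) = diagOp (leftMul g) (j (O ξ))) (i : ι) :
    coordOp j O i ∈ vN G :=
  mem_vN_iff.2 fun g ξ => by rw [coordOp_apply, hO, diagOp_apply, coordOp_apply]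

variable [CompleteSpace U]

/-- The operator `O* O` is the sum of `O_i* O_i` over the coordinates `O_i`, each of which commutes
with left translations. -/
lemma adjoint_comp_self_mem_vN {j : U →ₗᵢ[ℂ] L2pow G ι} {O : L2 G →L[ℂ] U}
    (hO : ∀ (g : G) (ξ : L2 G), j (O (leftMul g ξ)) = diagOp (leftMul g) (j (O ξ))) :
    adjoint O ∘L O ∈ vN G := by
  rw [← sum_star_coordOp_mul j O]
  exact sum_mem fun i _ => mul_mem (star_mem (coordOp_mem_vN hO i)) (coordOp_mem_vN hO i)

/-- Unitary equivalences of Hilbert modules preserve the von Neumann trace. -/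
lemma vnTrace_conj {j : U →ₗᵢ[ℂ] L2pow G ι} (e : L2 G ≃ₗᵢ[ℂ] U)
    (he : ∀ (g : G) (ξ : L2 G), j (e (leftMul g ξ)) = diagOp (leftMul g) (j (e ξ)))
    {X : L2 G →L[ℂ] L2 G} (hX : X ∈ vN G) : vnTrace j (e.conjStarAlgEquiv X) = opTrace X := by
  set E : L2 G →L[ℂ] U := (e.toContinuousLinearEquiv : L2 G →L[ℂ] U) with hE
  have hmem : ∀ i, coordOp j E i ∈ vN G := coordOp_mem_vN he
  have hadj : ∀ i, e.symm (adjoint j.toContinuousLinearMap (unitVec G i)) =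
      star (coordOp j E i) (delta 1) := by
    intro i
    refine ext_inner_right ℂ fun ξ => ?_
    rw [star_eq_adjoint, adjoint_inner_left, ← e.inner_map_map, e.apply_symm_apply,
      adjoint_inner_left, inner_unitVec]
    rfl
  have hone : adjoint E ∘L E = 1 := by
    ext1 ξ
    refine ext_inner_right ℂ fun η => ?_
    rw [ContinuousLinearMap.comp_apply, adjoint_inner_left]
    exact e.inner_map_map ξ η
  -- The `i`-th diagonal entry is the trace of `E_i X E_i*`. The trace property turns it into that
  -- of `E_i* E_i X`, and the sum of the `E_i* E_i` is `1`.
  have hterm : ∀ i, inner ℂ (unitVec G i) (j (e.conjStarAlgEquiv X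
      (adjoint j.toContinuousLinearMap (unitVec G i)))) =
      opTrace ((star (coordOp j E i) * coordOp j E i) * X) := by
    intro i
    rw [mul_assoc, opTrace_mul_comm (star_mem (hmem i)) (mul_mem (hmem i) hX), inner_unitVec,
      opTrace_apply, mul_assoc, mul_apply_eq_comp, mul_apply_eq_comp, ← hadj]
    rfl
  rw [vnTrace, Finset.sum_congr rfl fun i _ => hterm i, ← map_sum, ← Finset.sum_mul,
    sum_star_coordOp_mul, hone, one_mul]

/-- The trace of the group von Neumann algebra. -/
def vNTrace (G : Type*) [Group G] : vN G →L[ℂ] ℂ where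
  toLinearMap := (opTrace (G := G)).toLinearMap ∘ₗ (vN G).subtype.toLinearMap
  cont := (opTrace (G := G)).continuous.comp continuous_subtype_val

lemma continuousOn_log_spectrum {M : Type*} [CStarAlgebra M] (b : M) {ε : ℝ} (hε : 0 < ε) :
    ContinuousOn Real.log (spectrum ℝ (star b * b + algebraMap ℝ M ε)) := by
  let : PartialOrder M := CStarAlgebra.spectralOrder M
  let : StarOrderedRing M := CStarAlgebra.spectralOrderedRing M
  have h1 : IsStrictlyPositive (star b * b + algebraMap ℝ M ε) :=
    (isStrictlyPositive_algebraMap hε).nonneg_add (star_mul_self_nonneg b)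
  intro y hy
  exact (Real.continuousAt_log (h1.spectrum_pos hy).ne').continuousWithinAt

-- The regularized logarithms are estimated in `vN G`, while the determinant uses those of operators
-- on `U`; star homomorphisms respect the functional calculus and so carry one to the other.
open scoped CStarAlgebra in
lemma map_log_star_mul_self_add {M N : Type*} [CStarAlgebra M] [CStarAlgebra N] (φ : M →⋆ₐ[ℂ] N)
    (b : M) {ε : ℝ} (hε : 0 < ε) :
    φ (CFC.log (star b * b + algebraMap ℝ M ε)) =
      CFC.log (star (φ b) * φ b + algebraMap ℝ N ε) := by
  have hsa : IsSelfAdjoint (star b * b + algebraMap ℝ M ε) :=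
    (IsSelfAdjoint.star_mul_self b).add (IsSelfAdjoint.algebraMap _ (IsSelfAdjoint.all ε))
  have h1 : star (φ b) * φ b + algebraMap ℝ N ε = φ (star b * b + algebraMap ℝ M ε) := by
    rw [map_add, map_mul, map_star, IsScalarTower.algebraMap_apply ℝ ℂ M,
      AlgHomClass.commutes, IsScalarTower.algebraMap_apply ℝ ℂ N]
  rw [h1]
  exact StarAlgHom.map_cfc φ Real.log _ (continuousOn_log_spectrum b hε) (map_continuous φ) hsa
    (hsa.map φ)

lemma fkDet_conj_eq_one {j : U →ₗᵢ[ℂ] L2pow G ι} (e : L2 G ≃ₗᵢ[ℂ] U)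
    (he : ∀ (g : G) (ξ : L2 G), j (e (leftMul g ξ)) = diagOp (leftMul g) (j (e ξ))) (B : vN G)
    (h : Tendsto (fun ε : ℝ => (vNTrace G (CFC.log (star B * B + algebraMap ℝ (vN G) ε))).re)
      (𝓝[>] 0) (𝓝 0)) : fkDet j (e.conjStarAlgEquiv (B : L2 G →L[ℂ] L2 G)) = 1 := by
  refine fkDet_eq_one_of_tendsto j _ (h.congr' ?_)
  filter_upwards [self_mem_nhdsWithin] with ε hε
  have h2 := map_log_star_mul_self_add
    ((e.conjStarAlgEquiv : (L2 G →L[ℂ] L2 G) →⋆ₐ[ℂ] (U →L[ℂ] U)).comp (vN G).subtype) B hε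
  have h3 := vnTrace_conj e he (SetLike.coe_mem (CFC.log (star B * B + algebraMap ℝ (vN G) ε)))
  refine congrArg Complex.re (h3.symm.trans (congrArg (vnTrace j) h2))

/-- The positive square root of `O* O`, for an isomorphism `O` of Hilbert spaces, and its
inverse. -/
lemma exists_sqrt_adjoint_comp_self {E : Type*} [NormedAddCommGroup E] [InnerProductSpace ℂ E]
    [CompleteSpace E] (O : E ≃L[ℂ] U) :
    ∃ S T : E →L[ℂ] E, IsSelfAdjoint S ∧ IsSelfAdjoint T ∧ S * T = 1 ∧ T * S = 1 ∧
      S * S = adjoint (O : E →L[ℂ] U) ∘L (O : E →L[ℂ] U) ∧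
      ∀ X, Commute (adjoint (O : E →L[ℂ] U) ∘L (O : E →L[ℂ] U)) X → Commute S X := by
  set P : E →L[ℂ] U := (O : E →L[ℂ] U) with hP
  set P' : U →L[ℂ] E := (O.symm : U →L[ℂ] E) with hP'
  have hPP' : P ∘L P' = ContinuousLinearMap.id ℂ U := by ext x; simp [hP, hP']
  -- The inverse of `Z = O* O` can be written down as `Y = O⁻¹ (O⁻¹)*`; the inverse of the square
  -- root `S` of `Z` is then `S * Y`.
  have hP'P : P' ∘L P = ContinuousLinearMap.id ℂ E := by ext x; simp [hP, hP']
  set Z : E →L[ℂ] E := adjoint P ∘L P with hZ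
  set Y : E →L[ℂ] E := P' ∘L adjoint P' with hY
  have hZY : Z * Y = 1 := by
    change (adjoint P ∘L P) ∘L (P' ∘L adjoint P') = 1
    rw [ContinuousLinearMap.comp_assoc, ← ContinuousLinearMap.comp_assoc P, hPP',
      ContinuousLinearMap.id_comp, ← adjoint_comp, hP'P]
    exact star_one (E →L[ℂ] E)
  have hYZ : Y * Z = 1 := by
    change (P' ∘L adjoint P') ∘L (adjoint P ∘L P) = 1
    rw [ContinuousLinearMap.comp_assoc, ← ContinuousLinearMap.comp_assoc (adjoint P'),
      ← adjoint_comp, hPP']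
    have : adjoint (ContinuousLinearMap.id ℂ U) = ContinuousLinearMap.id ℂ U :=
      star_one (U →L[ℂ] U)
    rw [this, ContinuousLinearMap.id_comp, hP'P]
    rfl
  have hZsa : IsSelfAdjoint Z := (isPositive_adjoint_comp_self P).isSelfAdjoint
  have hYsa : IsSelfAdjoint Y := by
    have h1 : star Y * Z = 1 := by
      rw [← hZsa.star_eq, ← star_mul, hZY, star_one]
    exact left_inv_eq_right_inv h1 hZY
  set S : E →L[ℂ] E := cfc Real.sqrt Z with hS
  have hSsa : IsSelfAdjoint S := cfc_predicate Real.sqrt Z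
  have hSS : S * S = Z := by
    rw [hS, ← cfc_mul Real.sqrt Real.sqrt Z]
    conv_rhs => rw [← cfc_id' ℝ Z]
    exact cfc_congr fun s hs => Real.mul_self_sqrt (spectrum_adjoint_comp_self_nonneg P hs)
  have hYS : Y * S = S * Y := by
    have h1 : Z * S = S * Z := by rw [← hSS, mul_assoc]
    calc Y * S = Y * (S * Z) * Y := by rw [mul_assoc, mul_assoc S, hZY, mul_one]
      _ = S * Y := by rw [← h1, ← mul_assoc, hYZ, one_mul]
  refine ⟨S, S * Y, hSsa, ?_, ?_, ?_, hSS, fun X hX => ?_⟩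
  · rw [isSelfAdjoint_iff, star_mul, hSsa.star_eq, hYsa.star_eq, hYS]
  · rw [← mul_assoc, hSS, hZY]
  · rw [← hYS, mul_assoc, hSS, hYZ]
  · exact hX.cfc (by rwa [hZsa.star_eq]) Real.sqrt

lemma rshift_mem_unitary (h : G) :
    (⟨(rshift h).toContinuousLinearMap, rshift_mem_vN h⟩ : vN G) ∈ unitary (vN G) := by
  rw [Unitary.mem_iff]
  constructor <;> refine Subtype.ext ?_
  · change star (rshift h).toContinuousLinearMap * (rshift h).toContinuousLinearMap = 1
    rw [star_rshift]
    exact ext_delta fun x => by simp [rshift_delta]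
  · change (rshift h).toContinuousLinearMap * star (rshift h).toContinuousLinearMap = 1
    rw [star_rshift]
    exact ext_delta fun x => by simp [rshift_delta]

/-- The Fuglede–Kadison determinant of an operator that is similar to right multiplication by
`1 - h`, for an element `h` of infinite order. -/
theorem fkDet_eq_one_of_similar (j : U →ₗᵢ[ℂ] L2pow G ι) (O : L2 G ≃L[ℂ] U)
    (hO : ∀ (g : G) (ξ : L2 G), j (O (leftMul g ξ)) = diagOp (leftMul g) (j (O ξ)))
    {h : G} (hh : ∀ n : ℕ, h ^ (n + 1) ≠ 1) :
    fkDet j ((O : L2 G →L[ℂ] U) ∘L (1 - (rshift h).toContinuousLinearMap) ∘L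
      (O.symm : U →L[ℂ] L2 G)) = 1 := by
  set P : L2 G →L[ℂ] U := (O : L2 G →L[ℂ] U) with hP
  set Z : L2 G →L[ℂ] L2 G := adjoint P ∘L P with hZ
  have hZmem : Z ∈ vN G := adjoint_comp_self_mem_vN hO
  obtain ⟨S, T, hSsa, hTsa, hST, hTS, hSS, hcomm⟩ := exists_sqrt_adjoint_comp_self O
  have hSL : ∀ g, S * leftMul g = leftMul g * S := fun g =>
    hcomm _ (ContinuousLinearMap.ext fun ξ => mem_vN_iff.1 hZmem g ξ)
  have hSmem : S ∈ vN G :=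
    mem_vN_iff.2 fun g ξ => congrArg (fun A : L2 G →L[ℂ] L2 G => A ξ) (hSL g)
  have hTmem : T ∈ vN G := by
    suffices hTL : ∀ g, T * leftMul g = leftMul g * T from
      mem_vN_iff.2 fun g ξ => congrArg (fun A : L2 G →L[ℂ] L2 G => A ξ) (hTL g)
    intro g
    calc T * leftMul g = T * (leftMul g * S) * T := by
          rw [mul_assoc, mul_assoc, hST, mul_one]
      _ = leftMul g * T := by rw [← hSL, ← mul_assoc, hTS, one_mul]
  have hTS_apply : ∀ ξ, T (S ξ) = ξ := fun ξ =>
    congrArg (fun A : L2 G →L[ℂ] L2 G => A ξ) hTS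
  -- Polar decomposition: `O T`, with `T` the inverse of the square root of `O* O`, is unitary. It
  -- is equivariant because `T` lies in `vN G`.
  have hinner : ∀ ξ η, inner ℂ (O (T ξ)) (O (T η)) = inner ℂ ξ η := by
    intro ξ η
    have h1 : inner ℂ (O (T ξ)) (O (T η)) = inner ℂ (T ξ) (Z (T η)) :=
      (adjoint_inner_right P (T ξ) (P (T η))).symm
    have h2 : T * (Z * T) = 1 := by
      rw [hZ, hP, ← hSS, mul_assoc, hST, mul_one, hTS]
    have h3 : inner ℂ (T ξ) (Z (T η)) = inner ℂ ξ (T (Z (T η))) := by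
      rw [← adjoint_inner_right, ← star_eq_adjoint, hTsa.star_eq]
    rw [h1, h3]
    exact congrArg (fun A : L2 G →L[ℂ] L2 G => inner ℂ ξ (A η)) h2
  let e₀ : L2 G →ₗᵢ[ℂ] U :=
    { toLinearMap := (P ∘L T).toLinearMap
      norm_map' := fun ξ => by
        rw [@norm_eq_sqrt_re_inner ℂ _ _ _ _ ξ, @norm_eq_sqrt_re_inner ℂ]
        exact congrArg (fun z => √(RCLike.re z)) (hinner ξ ξ) }
  have he₀ : ∀ ξ, e₀ ξ = O (T ξ) := fun ξ => rfl
  have hsurj : Function.Surjective e₀ := fun x =>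
    ⟨S (O.symm x), by rw [he₀, hTS_apply, O.apply_symm_apply]⟩
  let e : L2 G ≃ₗᵢ[ℂ] U := LinearIsometryEquiv.ofSurjective e₀ hsurj
  have he : ∀ ξ, e ξ = O (T ξ) := fun ξ => rfl
  have heq : ∀ (g : G) (ξ : L2 G), j (e (leftMul g ξ)) = diagOp (leftMul g) (j (e ξ)) := by
    intro g ξ
    rw [he, he, mem_vN_iff.1 hTmem, hO]
  let S' : vN G := ⟨S, hSmem⟩
  let T' : vN G := ⟨T, hTmem⟩
  let u : vN G := ⟨(rshift h).toContinuousLinearMap, rshift_mem_vN h⟩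
  -- As `O = e S`, conjugation by `O` is conjugation by `S` followed by the unitary equivalence `e`.
  have hA : P ∘L (1 - (rshift h).toContinuousLinearMap) ∘L (O.symm : U →L[ℂ] L2 G) =
      e.conjStarAlgEquiv ((S' * (1 - u) * T' : vN G) : L2 G →L[ℂ] L2 G) := by
    ext1 x
    obtain ⟨ξ, rfl⟩ := e.surjective x
    have h1 : e.conjStarAlgEquiv ((S' * (1 - u) * T' : vN G) : L2 G →L[ℂ] L2 G) (e ξ) =
        e (S ((1 - (rshift h).toContinuousLinearMap) (T ξ))) :=
      congrArg (fun η => e (((S' * (1 - u) * T' : vN G) : L2 G →L[ℂ] L2 G) η))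
        (e.symm_apply_apply ξ)
    rw [h1, he (S _), hTS_apply, ContinuousLinearMap.comp_apply, ContinuousLinearMap.comp_apply, he]
    exact congrArg (fun η => O ((1 - (rshift h).toContinuousLinearMap) η))
      (O.symm_apply_apply (T ξ))
  rw [hA]
  refine fkDet_conj_eq_one e heq _ (tendsto_re_apply_log (τ := vNTrace G)
    (fun a b => opTrace_mul_comm a.2 b.2) opTrace_one (fun a => opTrace_star_mul_self _)
    (u := u) (rshift_mem_unitary h) (fun n => ?_) (fun n => ?_) (S := S') (T := T')
    (Subtype.ext hSsa) (Subtype.ext hTsa) (Subtype.ext hST) (Subtype.ext hTS))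
  · change opTrace ((rshift h).toContinuousLinearMap ^ (n + 1)) = 0
    rw [rshift_pow, opTrace_rshift (hh n)]
  · change opTrace (star (rshift h).toContinuousLinearMap ^ (n + 1)) = 0
    rw [star_rshift, rshift_pow, opTrace_rshift]
    rw [inv_pow]
    exact inv_ne_one.2 (hh n)

end Similarity

/-! ### Right multiplication by group ring elements, and change of group -/

section RightMultiplication

variable {F G : Type*} [Group F] [Group G]

lemma leftMul_apply (s : G) (ξ : L2 G) (g : G) : leftMul s ξ g = ξ (s⁻¹ * g) := by
  have := pushforward_apply (s * ·) (mul_right_injective s) ξ (s⁻¹ * g)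
  simpa [leftMul] using this

lemma rightMul_delta_one (a : MonoidAlgebra ℂ G) :
    rightMul a (delta 1) = a.coeff.sum fun g c => c • delta g := by
  rw [rightMul, Finsupp.sum, Finsupp.sum, sum_apply]
  refine Finset.sum_congr rfl fun g _ => ?_
  change a.coeff g • rshift g (delta 1) = _
  rw [rshift_delta, one_mul]

lemma rightMul_delta_one_apply (a : MonoidAlgebra ℂ G) (g : G) :
    rightMul a (delta 1) g = a.coeff g := by
  classical
  induction a using MonoidAlgebra.induction_linear with
  | zero => simp [rightMul_zero]
  | add a b ha hb => simp [rightMul_add, ha, hb]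
  | single h c =>
    rw [rightMul_single, MonoidAlgebra.coeff_single]
    change c * rshift h (delta 1) g = _
    rw [rshift_delta, one_mul]
    by_cases hg : g = h
    · rw [hg, delta_apply_self, Finsupp.single_eq_same, mul_one]
    · rw [delta_apply_of_ne hg, Finsupp.single_eq_of_ne hg, mul_zero]

lemma rightMul_single_mul_delta_one (s : G) (a : MonoidAlgebra ℂ G) :
    rightMul (MonoidAlgebra.single s 1 * a) (delta 1) = leftMul s (rightMul a (delta 1)) := by
  induction a using MonoidAlgebra.induction_linear with
  | zero => simp [rightMul_zero]
  | add a b ha hb => simp [rightMul_add, ha, hb, mul_add]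
  | single h c =>
    simp [rightMul_single, MonoidAlgebra.single_mul_single, rshift_delta, leftMul_delta]

lemma rightMul_mapDomain_delta_one (κ : F →* G) (hκ : Function.Injective κ)
    (a : MonoidAlgebra ℂ F) :
    rightMul (MonoidAlgebra.mapDomain κ a) (delta 1) =
      pushforward κ hκ (rightMul a (delta 1)) := by
  induction a using MonoidAlgebra.induction_linear with
  | zero => simp [rightMul_zero]
  | add a b ha hb => simp [rightMul_add, ha, hb, MonoidAlgebra.mapDomain_add]
  | single h c =>
    simp [rightMul_single, MonoidAlgebra.mapDomain_single, rshift_delta, pushforward_delta]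

lemma pushforward_leftMul (κ : F →* G) (hκ : Function.Injective κ) (s : F) (ξ : L2 F) :
    pushforward κ hκ (leftMul s ξ) = leftMul (κ s) (pushforward κ hκ ξ) := by
  have : (pushforward κ hκ).toContinuousLinearMap ∘L leftMul s =
      leftMul (κ s) ∘L (pushforward κ hκ).toContinuousLinearMap :=
    ext_delta fun x => by simp [leftMul_delta, pushforward_delta]
  exact congrArg (fun T : L2 F →L[ℂ] L2 G => T ξ) this

lemma rightMulMatrix_apply {ι : Type*} [Fintype ι] (M : Matrix ι ι (MonoidAlgebra ℂ G))
    (v : L2pow G ι) (i : ι) : rightMulMatrix M v i = ∑ k, rightMul (M k i) (v k) :=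
  matrixOp_apply _ _ _

lemma rightMulMatrix_leftMul {ι : Type*} [Fintype ι] (M : Matrix ι ι (MonoidAlgebra ℂ G)) (g : G)
    (v : L2pow G ι) :
    rightMulMatrix M (diagOp (leftMul g) v) = diagOp (leftMul g) (rightMulMatrix M v) := by
  ext1 i
  rw [diagOp_apply, rightMulMatrix_apply, rightMulMatrix_apply, map_sum]
  refine Finset.sum_congr rfl fun k _ => ?_
  rw [diagOp_apply, rightMul_leftMul]

end RightMultiplication

/-! ### Relative chains in `L²(G_φ)^{n_H}`, the operator `L` and the orbit operator -/

section Embedding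

variable {V : Type*} [Quiver V]

namespace BasedHomotopyEquiv

variable {f : BasedHomotopyEquiv V} {H : Subgraph V} (lift : f.LiftChoice H)

lemma coords_coeff (x : f.RelC1 H) (e : RelEdge H) (g : f.F) :
    (coords lift x e).coeff g = (((x : f.C1) (f.edgeAct g ⟨e.1, lift e⟩) : ℚ) : ℂ) := rfl

/-- The relative 1-chains are spanned by the translates of the chosen lifts. -/
lemma relC1_induction {p : f.RelC1 H → Prop} (zero : p 0) (add : ∀ x y, p x → p y → p (x + y))
    (basis : ∀ (q : ℚ) (g : f.F) (e : RelEdge H), p (q • f.relAct H g (basisChain lift e)))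
    (x : f.RelC1 H) : p x := by
  obtain ⟨z, rfl⟩ := (Finsupp.supportedEquivFinsupp (M := ℚ) (R := ℚ)
    (f.relCoverEdges H)).symm.surjective x
  induction z using Finsupp.induction_linear with
  | zero => rwa [map_zero]
  | add y z hy hz => rw [map_add]; exact add _ _ hy hz
  | single e q =>
    obtain ⟨⟨e, w⟩, he⟩ := e
    convert basis q (w ≫ inv (lift ⟨e, he⟩)) ⟨e, he⟩ using 1
    refine Subtype.ext ?_
    rw [Finsupp.supportedEquivFinsupp_symm_single]
    change Finsupp.single _ _ = q • Finsupp.mapDomain _ (Finsupp.single _ _)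
    rw [Finsupp.mapDomain_single, Finsupp.smul_single, smul_eq_mul, mul_one]
    simp [edgeAct]

lemma inl_mul_t (x : f.F) :
    (SemidirectProduct.inl x : f.G) * f.t = f.t * SemidirectProduct.inl (f.Phi x) := by
  rw [← t_inv_mul_mul_t, mul_assoc, mul_inv_cancel_left]

variable [Finite (Quiver.Total V)]

lemma toL2_apply (x : f.RelC1 H) (e : RelEdge H) :
    toL2 lift x e = rightMul (coords lift x e) (delta 1) :=
  (rightMul_delta_one _).symm

lemma toL2_apply_apply (x : f.RelC1 H) (e : RelEdge H) (g : f.F) :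
    toL2 lift x e g = (((x : f.C1) (f.edgeAct g ⟨e.1, lift e⟩) : ℚ) : ℂ) := by
  rw [toL2_apply, rightMul_delta_one_apply, coords_coeff]

lemma toL2_add (x y : f.RelC1 H) : toL2 lift (x + y) = toL2 lift x + toL2 lift y := by
  ext e g
  simp [toL2_apply_apply]

lemma toL2_smul (q : ℚ) (x : f.RelC1 H) : toL2 lift (q • x) = (q : ℂ) • toL2 lift x := by
  ext e g
  simp [toL2_apply_apply]

lemma toL2_relAct (h : f.F) (x : f.RelC1 H) :
    toL2 lift (f.relAct H h x) = diagOp (leftMul h) (toL2 lift x) := by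
  ext e g
  rw [toL2_apply_apply, diagOp_apply, leftMul_apply, toL2_apply_apply, relAct_apply, edgeAct_mul]

lemma toL2_basisChain (e : RelEdge H) : toL2 lift (basisChain lift e) = unitVec f.F e := by
  classical
  ext e' g
  rw [toL2_apply_apply]
  change (((Finsupp.single (⟨e.1, lift e⟩ : f.CoverEdge) (1 : ℚ))
    (f.edgeAct g ⟨e'.1, lift e'⟩) : ℚ) : ℂ) = _
  by_cases he : e' = e
  · subst he
    rw [unitVec_apply_self]
    by_cases hg : g = 1
    · subst hg
      rw [edgeAct_one, Finsupp.single_eq_same, delta_apply_self, Rat.cast_one]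
    · rw [delta_apply_of_ne hg, Finsupp.single_eq_of_ne, Rat.cast_zero]
      intro h
      simp only [edgeAct, Sigma.mk.injEq, heq_eq_eq, true_and] at h
      exact hg ((cancel_mono (lift e')).1 (h.trans (Category.id_comp _).symm))
  · rw [unitVec_apply_of_ne he, Finsupp.single_eq_of_ne]
    · simp
    · intro h
      exact he (Subtype.ext (congrArg Sigma.fst h))

/-- A relative 1-chain as an element of `L²(G_φ)^{n_H}`. -/
def emb (x : f.RelC1 H) : L2pow f.G (RelEdge H) := inclF (toL2 lift x)

lemma emb_apply (x : f.RelC1 H) (e : RelEdge H) :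
    emb lift x e = rightMul (MonoidAlgebra.mapDomain (SemidirectProduct.inl : f.F →* f.G)
      (coords lift x e)) (delta 1) := by
  rw [emb, inclF, diagOp_apply, toL2_apply,
    rightMul_mapDomain_delta_one _ SemidirectProduct.inl_injective]
  rfl

lemma emb_add (x y : f.RelC1 H) : emb lift (x + y) = emb lift x + emb lift y := by
  rw [emb, toL2_add, map_add]
  rfl

lemma emb_smul (q : ℚ) (x : f.RelC1 H) : emb lift (q • x) = (q : ℂ) • emb lift x := by
  rw [emb, toL2_smul, map_smul]
  rfl

lemma emb_relAct (h : f.F) (x : f.RelC1 H) :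
    emb lift (f.relAct H h x) = diagOp (leftMul (SemidirectProduct.inl h)) (emb lift x) := by
  ext1 e
  rw [emb, toL2_relAct, diagOp_apply, emb, inclF, diagOp_apply, diagOp_apply, diagOp_apply]
  exact pushforward_leftMul _ SemidirectProduct.inl_injective _ _

lemma emb_basisChain (e : RelEdge H) : emb lift (basisChain lift e) = unitVec f.G e := by
  ext1 e'
  rw [emb, toL2_basisChain, inclF, diagOp_apply]
  by_cases he : e' = e
  · subst he
    rw [unitVec_apply_self, unitVec_apply_self]
    exact pushforward_delta _ SemidirectProduct.inl_injective _
  · rw [unitVec_apply_of_ne he, unitVec_apply_of_ne he, map_zero]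

lemma opL_leftMul (g : f.G) (v : L2pow f.G (RelEdge H)) :
    opL lift (diagOp (leftMul g) v) = diagOp (leftMul g) (opL lift v) :=
  rightMulMatrix_leftMul _ _ _

lemma opL_unitVec (e : RelEdge H) : opL lift (unitVec f.G e) =
    diagOp (leftMul f.t) (emb lift (f.relChainMap H (basisChain lift e))) := by
  ext1 i
  refine (rightMulMatrix_apply _ _ _).trans ?_
  rw [Finset.sum_eq_single e, unitVec_apply_self,
    rightMul_single_mul_delta_one, diagOp_apply, emb_apply]
  · rfl
  · intro k _ hk
    rw [unitVec_apply_of_ne hk, map_zero]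
  · simp

/-- The operator `L_{f,H}` is `A_{f,H}` followed by translation by `t`. -/
lemma opL_emb (x : f.RelC1 H) :
    opL lift (emb lift x) = diagOp (leftMul f.t) (emb lift (f.relChainMap H x)) := by
  induction x using relC1_induction lift with
  | zero =>
    have h : emb lift (0 : f.RelC1 H) = 0 := by
      simpa using emb_smul lift 0 0
    rw [map_zero, h, map_zero, map_zero]
  | add x y hx hy => simp only [map_add, emb_add, hx, hy]
  | basis q g e =>
    -- On the translate of a basis element by `g` both sides agree because `A_{f,H}` replaces `g` by
    -- `Φ(g)` and `g t = t Φ(g)` in `G_φ`.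
    rw [map_smul, emb_smul, emb_smul, map_smul, map_smul, emb_relAct, opL_leftMul, emb_basisChain,
      opL_unitVec, relChainMap_relAct, emb_relAct, ← diagOp_leftMul_mul_apply,
      ← diagOp_leftMul_mul_apply, inl_mul_t]

/-- The operator from `L²(G_φ)` to `L²(G_φ)^{n_H}` that sends the basis vector at `g` to the
translate by `g` of a relative 1-chain. -/
def orbitOp (ρ : f.RelC1 H) : L2 f.G →L[ℂ] L2pow f.G (RelEdge H) :=
  ((PiLp.continuousLinearEquiv 2 ℂ (fun _ : RelEdge H => L2 f.G)).symm :
      (RelEdge H → L2 f.G) →L[ℂ] L2pow f.G (RelEdge H)) ∘L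
    ContinuousLinearMap.pi fun e => rightMul (MonoidAlgebra.mapDomain
      (SemidirectProduct.inl : f.F →* f.G) (coords lift ρ e))

lemma orbitOp_apply (ρ : f.RelC1 H) (ξ : L2 f.G) (e : RelEdge H) :
    orbitOp lift ρ ξ e = rightMul (MonoidAlgebra.mapDomain
      (SemidirectProduct.inl : f.F →* f.G) (coords lift ρ e)) ξ := rfl

lemma orbitOp_leftMul (ρ : f.RelC1 H) (g : f.G) (ξ : L2 f.G) :
    orbitOp lift ρ (leftMul g ξ) = diagOp (leftMul g) (orbitOp lift ρ ξ) := by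
  ext1 e
  rw [orbitOp_apply, rightMul_leftMul, diagOp_apply, orbitOp_apply]

lemma orbitOp_delta (ρ : f.RelC1 H) (g : f.G) :
    orbitOp lift ρ (delta g) = diagOp (leftMul g) (emb lift ρ) := by
  have h : orbitOp lift ρ (delta 1) = emb lift ρ := by
    ext1 e
    rw [orbitOp_apply, emb_apply]
  rw [← h, ← orbitOp_leftMul, leftMul_delta, mul_one]

/-- On basis vectors: `L(gρ) = g t A_{f,H}ρ = g t ρ`, which is the image of `δ_{gt}`. -/
lemma opL_orbitOp {ρ : f.RelC1 H} (hρ : f.relChainMap H ρ = ρ) (ξ : L2 f.G) :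
    opL lift (orbitOp lift ρ ξ) = orbitOp lift ρ (rshift f.t ξ) := by
  have : opL lift ∘L orbitOp lift ρ = orbitOp lift ρ ∘L (rshift f.t).toContinuousLinearMap := by
    refine ext_delta fun g => ?_
    simp only [ContinuousLinearMap.comp_apply, LinearIsometry.coe_toContinuousLinearMap,
      rshift_delta, orbitOp_delta, opL_leftMul, opL_emb, hρ, diagOp_leftMul_mul_apply]
  exact congrArg (fun T : L2 f.G →L[ℂ] L2pow f.G (RelEdge H) => T ξ) this

lemma opL_pow_orbitOp {ρ : f.RelC1 H} (hρ : f.relChainMap H ρ = ρ) (k : ℕ) (ξ : L2 f.G) :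
    (opL lift ^ k) (orbitOp lift ρ ξ) = orbitOp lift ρ (rshift (f.t ^ k) ξ) := by
  induction k generalizing ξ with
  | zero => simp [rshift_one]
  | succ k ih =>
    rw [pow_succ, mul_apply_eq_comp, opL_orbitOp lift hρ, ih, ← rshift_mul, ← pow_succ']

lemma one_sub_opL_pow_orbitOp {ρ : f.RelC1 H} (hρ : f.relChainMap H ρ = ρ) (k : ℕ) (ξ : L2 f.G) :
    (1 - opL lift ^ k) (orbitOp lift ρ ξ) =
      orbitOp lift ρ ((1 - (rshift (f.t ^ k)).toContinuousLinearMap) ξ) := by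
  simp [opL_pow_orbitOp lift hρ]

end BasedHomotopyEquiv

end Embedding

/-! ### Passing to absolute values to remove signs -/

section Modulus

variable {G : Type*}

/-- The pointwise absolute value of a square summable function. -/
def modulus (ξ : L2 G) : L2 G :=
  ⟨fun x => (‖ξ x‖ : ℂ), memℓp_of_norm_le ξ _ fun x => by simp⟩

lemma modulus_apply (ξ : L2 G) (x : G) : modulus ξ x = (‖ξ x‖ : ℂ) := rfl

lemma norm_le_of_norm_apply_le {ξ η : L2 G} (h : ∀ x, ‖ξ x‖ ≤ ‖η x‖) : ‖ξ‖ ≤ ‖η‖ := by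
  refine (sq_le_sq₀ (norm_nonneg _) (norm_nonneg _)).1 ?_
  exact hasSum_le (fun x => pow_le_pow_left₀ (norm_nonneg _) (h x) 2) (hasSum_norm_sq _)
    (hasSum_norm_sq _)

lemma norm_le_norm_modulus (ξ : L2 G) : ‖ξ‖ ≤ ‖modulus ξ‖ :=
  norm_le_of_norm_apply_le fun x => by simp [modulus_apply]

variable [Group G]

/-- Pointwise reverse triangle inequality: whatever the phases `a` and `b`, a small value of `a ξ +
b R_s ξ` forces `|ξ|` and its translate to be close. -/
lemma norm_rshift_modulus_sub_le {a b : ℂ} (ha : ‖a‖ = 1) (hb : ‖b‖ = 1) (s : G) (ξ : L2 G) :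
    ‖rshift s (modulus ξ) - modulus ξ‖ ≤ ‖a • ξ + b • rshift s ξ‖ := by
  refine norm_le_of_norm_apply_le fun x => ?_
  have h1 : (rshift s (modulus ξ) - modulus ξ) x = ((‖ξ (x * s⁻¹)‖ - ‖ξ x‖ : ℝ) : ℂ) := by
    rw [lp.coeFn_sub, Pi.sub_apply, rshift_apply, modulus_apply, modulus_apply]
    push_cast
    rfl
  have h2 : (a • ξ + b • rshift s ξ) x = b * ξ (x * s⁻¹) - (-(a * ξ x)) := by
    rw [lp.coeFn_add, Pi.add_apply, lp.coeFn_smul, lp.coeFn_smul, Pi.smul_apply, Pi.smul_apply,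
      rshift_apply, smul_eq_mul, smul_eq_mul]
    ring
  rw [h1, h2, Complex.norm_real, Real.norm_eq_abs]
  have := abs_norm_sub_norm_le (b * ξ (x * s⁻¹)) (-(a * ξ x))
  rwa [norm_neg, norm_mul, norm_mul, ha, hb, one_mul, one_mul] at this

lemma norm_rshift_modulus_sub_le_rightMul {F : Type*} [Group F] (κ : F →* G) {a b : ℂ}
    (ha : ‖a‖ = 1) (hb : ‖b‖ = 1) (g y : F) (ξ : L2 G) :
    ‖rshift (κ g) (modulus ξ) - modulus ξ‖ ≤ ‖rightMul (MonoidAlgebra.mapDomain κ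
      (MonoidAlgebra.single y a + MonoidAlgebra.single (g⁻¹ * y) b)) ξ‖ := by
  have heval : rightMul (MonoidAlgebra.mapDomain κ
      (MonoidAlgebra.single y a + MonoidAlgebra.single (g⁻¹ * y) b)) ξ =
      rshift (κ y) (a • ξ + b • rshift (κ g)⁻¹ ξ) := by
    rw [MonoidAlgebra.mapDomain_add, MonoidAlgebra.mapDomain_single,
      MonoidAlgebra.mapDomain_single, rightMul_add, rightMul_single, rightMul_single, map_mul,
      map_inv, map_add, map_smul, map_smul, ← rshift_mul]
    rfl
  rw [heval, LinearIsometry.norm_map, ← norm_rshift_inv_sub]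
  exact norm_rshift_modulus_sub_le ha hb _ _

end Modulus

/-! ### The orbit operator of a Nielsen chain is an isomorphism onto the induced space -/

section LowerBound

variable {V : Type*} [Quiver V]

namespace BasedHomotopyEquiv

variable {f : BasedHomotopyEquiv V} {H : Subgraph V} (lift : f.LiftChoice H)

/-- Every relative edge of the universal cover is a translate of a chosen lift. -/
lemma exists_edgeAct_lift {e : f.CoverEdge} (he : e ∈ f.relCoverEdges H) :
    ∃ (i : RelEdge H) (y : f.F), f.edgeAct y ⟨i.1, lift i⟩ = e := by
  obtain ⟨e, w⟩ := e
  refine ⟨⟨e, he⟩, w ≫ inv (lift ⟨e, he⟩), ?_⟩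
  simp [edgeAct]

variable [Finite (Quiver.Total V)]

/-- The distinguished edge lies in a coordinate in which `ρ` is a single group element with
coefficient `±1`. That coordinate of the orbit operator is an isometry, whence the constant `1`. -/
lemma exists_bound_of_nonGeometric {ρ : f.RelC1 H} (hρ : f.IsNonGeometricNielsen H ρ) :
    ∃ C : ℝ, 0 ≤ C ∧ ∀ ξ : L2 f.G, ‖ξ‖ ≤ C * ‖orbitOp lift ρ ξ‖ := by
  obtain ⟨-, e, he, hone, hzero⟩ := hρ
  obtain ⟨i, y, rfl⟩ := exists_edgeAct_lift lift he
  set a : ℂ := (((ρ : f.C1) (f.edgeAct y ⟨i.1, lift i⟩) : ℚ) : ℂ) with ha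
  have hnorm : ‖a‖ = 1 := by
    rcases hone with h | h <;> simp [ha, h]
  have hcoords : coords lift ρ i = MonoidAlgebra.single y a := by
    refine MonoidAlgebra.ext (Finsupp.ext fun g => ?_)
    rw [coords_coeff, MonoidAlgebra.coeff_single]
    by_cases hg : g = y
    · rw [hg, Finsupp.single_eq_same]
    · rw [Finsupp.single_eq_of_ne hg]
      have h1 : g * y⁻¹ ≠ 1 := fun h => hg (mul_inv_eq_one.1 h)
      have h2 := hzero _ h1
      rw [← edgeAct_mul, inv_mul_cancel_right] at h2
      rw [h2, Rat.cast_zero]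
  refine ⟨1, zero_le_one, fun ξ => ?_⟩
  rw [one_mul]
  refine le_trans (le_of_eq ?_) (PiLp.norm_apply_le _ i)
  rw [orbitOp_apply, hcoords, MonoidAlgebra.mapDomain_single, rightMul_single,
    smul_apply, norm_smul, hnorm, one_mul, LinearIsometry.coe_toContinuousLinearMap,
    LinearIsometry.norm_map]

/-- At an edge shared by `ρ` and `gρ`, no other translate of `ρ` is present, so the corresponding
coordinate of `ρ` has exactly two terms, with coefficients `±1`, that differ by the factor `g⁻¹`. -/
lemma norm_rshift_modulus_sub_le_orbitOp (hconn : IsConnectedGraph V) {ρ : f.RelC1 H}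
    (hρ : f.IsGeometricNielsen H ρ) {g : f.F} (hg : g ≠ 1)
    (hmeet : (supp ρ ∩ supp (f.relAct H g ρ)).Nonempty) (ξ : L2 f.G) :
    ‖rshift (SemidirectProduct.inl g) (modulus ξ) - modulus ξ‖ ≤ ‖orbitOp lift ρ ξ‖ := by
  obtain ⟨e, he1, heg⟩ := hmeet
  have mem_supp : ∀ (x : f.RelC1 H) (e : f.CoverEdge), e ∈ supp x ↔ (x : f.C1) e ≠ 0 :=
    fun x e => Finsupp.mem_support_iff
  have hrel : e ∈ f.relCoverEdges H := ρ.2 he1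
  have hone : f.relAct H 1 ρ = ρ := by
    ext e
    rw [relAct_apply, inv_one, edgeAct_one]
  have hinter : ∀ h : f.F, h ≠ 1 → e ∈ supp (f.relAct H h ρ) →
      supp (f.relAct H 1 ρ) ∩ supp (f.relAct H h ρ) = {e} := by
    intro h hh hmem
    have hin : e ∈ supp (f.relAct H 1 ρ) ∩ supp (f.relAct H h ρ) := ⟨by rwa [hone], hmem⟩
    rcases hρ.single 1 h hh.symm with h0 | ⟨e', h1⟩
    · rw [h0] at hin
      exact absurd hin (Set.notMem_empty e)
    · rw [h1] at hin
      rw [h1, Set.mem_singleton_iff.1 hin]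
  -- A third translate through `e` would give `e` a second pair, `{1, h}` besides `{1, g}`.
  have honly : ∀ h : f.F, h ≠ 1 → h ≠ g → (ρ : f.C1) (f.edgeAct h⁻¹ e) = 0 := by
    intro h hh hhg
    by_contra hne
    obtain ⟨g₁, g₂, -, -, huniq⟩ := hρ.pair e hrel
    have h1 := huniq 1 g hg.symm (hinter g hg heg)
    have h2 := huniq 1 h hh.symm (hinter h hh ((mem_supp _ _).2 (by rwa [relAct_apply])))
    have h3 : h ∈ ({1, g} : Set f.F) := by
      rw [h1, ← h2]
      exact Or.inr rfl
    rcases h3 with h3 | h3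
    · exact hh h3
    · exact hhg h3
  obtain ⟨i, y, rfl⟩ := exists_edgeAct_lift lift hrel
  set a : ℂ := (((ρ : f.C1) (f.edgeAct y ⟨i.1, lift i⟩) : ℚ) : ℂ) with ha
  set b : ℂ := (((ρ : f.C1) (f.edgeAct (g⁻¹ * y) ⟨i.1, lift i⟩) : ℚ) : ℂ) with hb
  have hunit : ∀ e, (ρ : f.C1) e ≠ 0 → ‖(((ρ : f.C1) e : ℚ) : ℂ)‖ = 1 := by
    intro e he
    rcases f.fixedSegment_coeff hconn hρ.fixedSegment e with h | h | h
    · exact absurd h he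
    · simp [h]
    · simp [h]
  have hna : ‖a‖ = 1 := hunit _ ((mem_supp _ _).1 he1)
  have hnb : ‖b‖ = 1 := by
    refine hunit _ ?_
    rw [edgeAct_mul, ← relAct_apply]
    exact (mem_supp _ _).1 heg
  have hcoords : coords lift ρ i =
      MonoidAlgebra.single y a + MonoidAlgebra.single (g⁻¹ * y) b := by
    refine MonoidAlgebra.ext (Finsupp.ext fun z => ?_)
    have hyy : y ≠ g⁻¹ * y := fun h => hg (inv_eq_one.1 (right_eq_mul.1 h))
    rw [coords_coeff, MonoidAlgebra.coeff_add, MonoidAlgebra.coeff_single,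
      MonoidAlgebra.coeff_single, Finsupp.add_apply]
    by_cases hz : z = y
    · rw [hz, Finsupp.single_eq_same, Finsupp.single_eq_of_ne hyy, add_zero]
    by_cases hz' : z = g⁻¹ * y
    · rw [hz', Finsupp.single_eq_same, Finsupp.single_eq_of_ne hyy.symm, zero_add]
    rw [Finsupp.single_eq_of_ne hz, Finsupp.single_eq_of_ne hz', add_zero]
    have h1 := honly (y * z⁻¹) (fun h => hz (mul_inv_eq_one.1 h).symm)
      (fun h => hz' (by rw [← h]; group))
    rw [← edgeAct_mul, mul_inv_rev, inv_inv, inv_mul_cancel_right] at h1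
    rw [h1, Rat.cast_zero]
  refine le_trans ?_ (PiLp.norm_apply_le _ i)
  rw [orbitOp_apply, hcoords]
  exact norm_rshift_modulus_sub_le_rightMul _ hna hnb g y ξ

/-- The two non-commuting elements both move `|ξ|` by at most the norm of the image of `ξ`; the
spectral gap then bounds the norm of `|ξ|`, which is at least that of `ξ`. -/
lemma exists_bound_of_geometric (hconn : IsConnectedGraph V) {ρ : f.RelC1 H}
    (hρ : f.IsGeometricNielsen H ρ) :
    ∃ C : ℝ, 0 ≤ C ∧ ∀ ξ : L2 f.G, ‖ξ‖ ≤ C * ‖orbitOp lift ρ ξ‖ := by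
  obtain ⟨g₁, g₂, hcomm, hmeet₁, hmeet₂⟩ := hρ.noncommuting
  have hg₁ : g₁ ≠ 1 := by rintro rfl; simp at hcomm
  have hg₂ : g₂ ≠ 1 := by rintro rfl; simp at hcomm
  obtain ⟨C, hC, hgap⟩ := exists_spectral_gap (wordHom f.base)
    (fun _ _ h => word_injective hconn h)
    (SemidirectProduct.inl : f.F →* f.G) SemidirectProduct.inl_injective hcomm
  refine ⟨C * 2, by positivity, fun ξ => (norm_le_norm_modulus ξ).trans ((hgap _).trans ?_)⟩
  have h₁ := norm_rshift_modulus_sub_le_orbitOp lift hconn hρ hg₁ hmeet₁ ξ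
  have h₂ := norm_rshift_modulus_sub_le_orbitOp lift hconn hρ hg₂ hmeet₂ ξ
  rw [mul_assoc, two_mul]
  gcongr

lemma exists_bound_of_nielsen (hconn : IsConnectedGraph V) {ρ : f.RelC1 H}
    (hρ : f.IsNielsen H ρ) :
    ∃ C : ℝ, 0 ≤ C ∧ ∀ ξ : L2 f.G, ‖ξ‖ ≤ C * ‖orbitOp lift ρ ξ‖ :=
  hρ.elim (exists_bound_of_nonGeometric lift) (exists_bound_of_geometric lift hconn)

lemma orbitOp_mem_inducedSpace {W : Submodule ℚ (f.RelC1 H)} {ρ : f.RelC1 H}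
    (hW : ∀ g : f.F, f.relAct H g ρ ∈ W) (ξ : L2 f.G) :
    orbitOp lift ρ ξ ∈ inducedSpace lift W := by
  have hclosed : IsClosed (inducedSpace lift W : Set (L2pow f.G (RelEdge H))) :=
    Submodule.isClosed_topologicalClosure _
  suffices h : (Submodule.span ℂ (Set.range (delta : f.G → L2 f.G))).topologicalClosure ≤
      (inducedSpace lift W).comap (orbitOp lift ρ).toLinearMap from
    h (closure_span_delta f.G ▸ Submodule.mem_top)
  refine Submodule.topologicalClosure_minimal _ (Submodule.span_le.2 ?_)
    (hclosed.preimage (orbitOp lift ρ).continuous)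
  rintro _ ⟨g, rfl⟩
  obtain ⟨l, y, rfl⟩ : ∃ (l : ℤ) (y : f.F), g = f.t ^ l * SemidirectProduct.inl y := by
    -- Here `l` is the exponent of `t` in `g`, so `t^(-l) g` lies in `𝔽`.
    refine ⟨Multiplicative.toAdd g.right, (f.t ^ (-Multiplicative.toAdd g.right) * g).left, ?_⟩
    rw [← mul_right_inj (f.t ^ (-Multiplicative.toAdd g.right)), ← mul_assoc, ← zpow_add,
      neg_add_cancel, zpow_zero, one_mul]
    refine SemidirectProduct.ext rfl ?_
    rw [SemidirectProduct.mul_right, SemidirectProduct.right_inl, t, ← map_zpow,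
      SemidirectProduct.right_inr, ← ofAdd_zsmul]
    simp
  refine Submodule.le_topologicalClosure _ (Submodule.mem_iSup_of_mem l ?_)
  refine ⟨toL2 lift (f.relAct H y ρ), Submodule.le_topologicalClosure _
    (Submodule.subset_span ⟨_, hW y, rfl⟩), ?_⟩
  change diagOp (leftMul (f.t ^ l)) (emb lift (f.relAct H y ρ)) = orbitOp lift ρ (delta _)
  rw [emb_relAct, ← diagOp_leftMul_mul_apply, orbitOp_delta]

/-- Being bounded below, the orbit operator has closed range. The range contains all translates of
`ρ`, hence also the closure that defines the induced space. -/
lemma inducedSpace_le_range_orbitOp (ρ : f.RelC1 H) {C : ℝ} (hC : 0 ≤ C)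
    (hbound : ∀ ξ : L2 f.G, ‖ξ‖ ≤ C * ‖orbitOp lift ρ ξ‖) :
    inducedSpace lift (Submodule.span ℚ (Set.range fun g : f.F => f.relAct H g ρ)) ≤
      LinearMap.range (orbitOp lift ρ).toLinearMap := by
  have hclosed : IsClosed (LinearMap.range (orbitOp lift ρ).toLinearMap :
      Set (L2pow f.G (RelEdge H))) := by
    have := ((orbitOp lift ρ).antilipschitz_of_bound (K := ⟨C, hC⟩) hbound).isClosed_range
      (orbitOp lift ρ).uniformContinuous
    rwa [LinearMap.coe_range]
  refine Submodule.topologicalClosure_minimal _ (iSup_le fun l => ?_) hclosed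
  rw [Submodule.map_le_iff_le_comap]
  refine Submodule.topologicalClosure_minimal _ (Submodule.span_le.2 ?_)
    (hclosed.preimage (ContinuousLinearMap.continuous _))
  rintro _ ⟨x, hx, rfl⟩
  change diagOp (leftMul (f.t ^ l)) (emb lift x) ∈
    LinearMap.range (orbitOp lift ρ).toLinearMap
  suffices h : emb lift x ∈ LinearMap.range (orbitOp lift ρ).toLinearMap by
    obtain ⟨ξ, hξ⟩ := h
    rw [← hξ]
    exact ⟨leftMul (f.t ^ l) ξ, orbitOp_leftMul lift ρ _ _⟩
  induction hx using Submodule.span_induction with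
  | mem x hx =>
    obtain ⟨g, rfl⟩ := hx
    exact ⟨delta (SemidirectProduct.inl g), by
      rw [emb_relAct, ← orbitOp_delta]
      rfl⟩
  | zero =>
    have h : emb lift (0 : f.RelC1 H) = 0 := by
      simpa using emb_smul lift 0 0
    rw [h]
    exact Submodule.zero_mem _
  | add x y _ _ hx hy =>
    rw [emb_add]
    exact Submodule.add_mem _ hx hy
  | smul q x _ hx =>
    rw [emb_smul]
    exact Submodule.smul_mem _ _ hx

/-- For a Nielsen 1-chain, the orbit operator is an isomorphism onto the induced quasi-fixed
subspace. -/
lemma exists_orbitEquiv (hconn : IsConnectedGraph V) {ρ : f.RelC1 H} (hρ : f.IsNielsen H ρ)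
    {W : Submodule ℚ (f.RelC1 H)}
    (hW : W = Submodule.span ℚ (Set.range fun g : f.F => f.relAct H g ρ)) :
    ∃ O : L2 f.G ≃L[ℂ] inducedSpace lift W,
      ∀ ξ, (O ξ : L2pow f.G (RelEdge H)) = orbitOp lift ρ ξ := by
  obtain ⟨C, hC, hbound⟩ := exists_bound_of_nielsen lift hconn hρ
  have hmem : ∀ ξ, orbitOp lift ρ ξ ∈ inducedSpace lift W :=
    orbitOp_mem_inducedSpace lift fun g => hW ▸ Submodule.subset_span ⟨g, rfl⟩
  let O₀ : L2 f.G →L[ℂ] inducedSpace lift W :=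
    (orbitOp lift ρ).codRestrict (inducedSpace lift W) hmem
  have hker : LinearMap.ker O₀.toLinearMap = ⊥ := by
    refine LinearMap.ker_eq_bot'.2 fun ξ hξ => ?_
    have h0 : orbitOp lift ρ ξ = 0 := congrArg Subtype.val hξ
    have := hbound ξ
    rw [h0, norm_zero, mul_zero] at this
    exact norm_le_zero_iff.1 this
  have hrange : LinearMap.range O₀.toLinearMap = ⊤ := by
    refine LinearMap.range_eq_top.2 fun w => ?_
    obtain ⟨w, hw⟩ := w
    obtain ⟨ξ, hξ⟩ := inducedSpace_le_range_orbitOp lift ρ hC hbound (hW ▸ hw)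
    exact ⟨ξ, Subtype.ext hξ⟩
  exact ⟨ContinuousLinearEquiv.ofBijective O₀ hker hrange, fun ξ => rfl⟩

end BasedHomotopyEquiv

end LowerBound

/-! ### The model operator `1 - t^k` on the infinite cyclic group -/

section Cyclic

variable {G : Type*} [Group G]

lemma rshift_one_toContinuousLinearMap :
    (rshift (1 : G)).toContinuousLinearMap = 1 :=
  ContinuousLinearMap.ext fun ξ => rshift_one ξ

lemma regularEmbedding_leftMul (g : G) (ξ : L2 G) :
    regularEmbedding G (leftMul g ξ) = diagOp (leftMul g) (regularEmbedding G ξ) := by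
  ext1 i
  rw [diagOp_apply]
  rfl

lemma pow_pow_succ_ne_one {t : G} (ht : ∀ n : ℕ, t ^ (n + 1) ≠ 1) {k : ℕ} (hk : k ≠ 0) (n : ℕ) :
    (t ^ k) ^ (n + 1) ≠ 1 := by
  obtain ⟨m, hm⟩ := Nat.exists_eq_succ_of_ne_zero (mul_ne_zero hk n.succ_ne_zero)
  rw [← pow_mul, hm]
  exact ht m

lemma cyclicOp_eq (t : G) (k : ℕ) : cyclicOp t k =
    1 - (rshift (⟨t, Subgroup.mem_zpowers t⟩ ^ k : Subgroup.zpowers t)).toContinuousLinearMap :=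
  rightMul_one_sub_single _

/-- The determinant of right multiplication by `1 - t^k` on `L²(⟨t⟩)` is `1`. -/
lemma fkDet_cyclicOp {t : G} (ht : ∀ n : ℕ, t ^ (n + 1) ≠ 1) (k : ℕ) :
    fkDet (regularEmbedding (Subgroup.zpowers t)) (cyclicOp t k) = 1 := by
  rw [cyclicOp_eq]
  -- For `k = 0` the operator is zero and its determinant is an empty integral; for other `k` the
  -- similarity theorem applies with the identity as similarity.
  rcases eq_or_ne k 0 with rfl | hk
  · rw [pow_zero, rshift_one_toContinuousLinearMap, sub_self, fkDet_zero]
  · refine fkDet_eq_one_of_similar (regularEmbedding (Subgroup.zpowers t))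
      (ContinuousLinearEquiv.refl ℂ _) regularEmbedding_leftMul
      (pow_pow_succ_ne_one (fun n hn => ht n ?_) hk)
    simpa using congrArg Subtype.val hn

/-- The inclusion of `L²(⟨t⟩)` intertwines right translations by powers of `t`, and right
translations of `L²(G)` commute with left ones. -/
lemma isInduced_cyclicOp (t : G) (k : ℕ) :
    IsInduced (Subgroup.zpowers t) (cyclicOp t k)
      (1 - (rshift (t ^ k)).toContinuousLinearMap) := by
  refine ⟨fun g ξ => ?_, fun ξ => ?_⟩
  · change leftMul g ξ - rshift (t ^ k) (leftMul g ξ) = leftMul g (ξ - rshift (t ^ k) ξ)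
    rw [rshift_leftMul, map_sub]
  · rw [cyclicOp_eq]
    set ι := pushforward (fun x : Subgroup.zpowers t => (x : G)) Subtype.val_injective with hι
    have : (1 - (rshift (t ^ k)).toContinuousLinearMap) ∘L ι.toContinuousLinearMap =
        ι.toContinuousLinearMap ∘L (1 - (rshift (⟨t, Subgroup.mem_zpowers t⟩ ^ k :
          Subgroup.zpowers t)).toContinuousLinearMap) := by
      refine ext_delta fun x => ?_
      simp [hι, pushforward_delta, rshift_delta]
    exact congrArg (fun T : L2 (Subgroup.zpowers t) →L[ℂ] L2 G => T ξ) this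

end Cyclic

/-! ### Infinite order of `t`, and the trivial quasi-fixed space -/

section QuasiFixed

variable {V : Type*} [Quiver V]

namespace BasedHomotopyEquiv

variable {f : BasedHomotopyEquiv V}

lemma t_pow_succ_ne_one (n : ℕ) : f.t ^ (n + 1) ≠ 1 := by
  intro h
  have h1 := congrArg SemidirectProduct.right h
  rw [t, ← map_pow, SemidirectProduct.right_inr, SemidirectProduct.one_right, ← ofAdd_nsmul] at h1
  have h2 : (n + 1) • (1 : ℤ) = 0 := h1
  simp at h2
  omega

variable {H : Subgraph V} [Finite (Quiver.Total V)] (lift : f.LiftChoice H)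

lemma inducedSpace_bot : inducedSpace lift (⊥ : Submodule ℚ (f.RelC1 H)) = ⊥ := by
  have h0 : toL2 lift (0 : f.RelC1 H) = 0 := by
    simpa using toL2_smul lift 0 0
  have h1 : completed lift (⊥ : Submodule ℚ (f.RelC1 H)) = ⊥ := by
    rw [completed, Submodule.bot_coe, Set.image_singleton, h0, Submodule.span_zero_singleton]
    exact isClosed_singleton.submodule_topologicalClosure_eq
  rw [inducedSpace, h1]
  simp only [Submodule.map_bot, iSup_bot]
  exact isClosed_singleton.submodule_topologicalClosure_eq

end BasedHomotopyEquiv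

end QuasiFixed

end FreeByCyclic

end

/-! ### The theorem -/

open FreeByCyclic BasedHomotopyEquiv in
theorem mainTheorem6 {V : Type*} [Quiver V] [Finite V] [Finite (Quiver.Total V)]
    (hconn : IsConnectedGraph V) (f : BasedHomotopyEquiv V) (H : Subgraph V)
    (hH : H.IsInvariant f.toGraphMorphism) (Vh Vqf : Submodule ℚ (f.RelC1 H))
    (hflare : f.ChainFlare H Vh Vqf) (lift : f.LiftChoice H) :
    ∃ hW : ∀ k : ℕ, ∀ w ∈ inducedSpace lift Vqf,
        (1 - opL lift ^ k) w ∈ inducedSpace lift Vqf,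
      (∀ k : ℕ,
        0 < fkDet (inducedSpace lift Vqf).subtypeₗᵢ
            (restrictOp (1 - opL lift ^ k) (inducedSpace lift Vqf) (hW k)) ∧
        Real.log (fkDet (inducedSpace lift Vqf).subtypeₗᵢ
            (restrictOp (1 - opL lift ^ k) (inducedSpace lift Vqf) (hW k))) = 0) ∧
      (inducedSpace lift Vqf ≠ ⊥ →
        ∃ O : L2 f.G ≃L[ℂ] inducedSpace lift Vqf,
          (∀ (g : f.G) (ξ : L2 f.G),
            (O (leftMul g ξ) : L2pow f.G (RelEdge H)) = diagOp (leftMul g) (O ξ)) ∧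
          ∀ k : ℕ, ∃ Q : L2 f.G →L[ℂ] L2 f.G,
            IsInduced (Subgroup.zpowers f.t) (cyclicOp f.t k) Q ∧
            restrictOp (1 - opL lift ^ k) (inducedSpace lift Vqf) (hW k) =
              (O : L2 f.G →L[ℂ] inducedSpace lift Vqf) ∘L Q ∘L
                (O.symm : inducedSpace lift Vqf →L[ℂ] L2 f.G)) ∧
      ∀ k : ℕ, fkDet (regularEmbedding (Subgroup.zpowers f.t)) (cyclicOp f.t k) = 1 := by
  rcases eq_or_ne Vqf ⊥ with hbot | hne
  · have hWbot : inducedSpace lift Vqf = ⊥ := by rw [hbot, inducedSpace_bot]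
    have hW : ∀ k : ℕ, ∀ w ∈ inducedSpace lift Vqf,
        (1 - opL lift ^ k) w ∈ inducedSpace lift Vqf := by
      intro k w hw
      rw [hWbot, Submodule.mem_bot] at hw
      rw [hw, map_zero]
      exact Submodule.zero_mem _
    refine ⟨hW, fun k => ?_, fun h => absurd hWbot h,
      fkDet_cyclicOp t_pow_succ_ne_one⟩
    have hzero : restrictOp (1 - opL lift ^ k) (inducedSpace lift Vqf) (hW k) = 0 := by
      refine ContinuousLinearMap.ext fun w => Subtype.ext ?_
      exact (Submodule.mem_bot ℂ).1 (hWbot.le (SetLike.coe_mem _))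
    rw [hzero, fkDet_zero]
    exact ⟨one_pos, Real.log_one⟩
  · obtain ⟨ρ, hρ, hspan⟩ := hflare.generated hne
    have hfix : f.relChainMap H ρ = ρ :=
      relChainMap_fixedSegment f hconn hH (hρ.elim And.left fun h => h.fixedSegment)
    obtain ⟨O, hO⟩ := exists_orbitEquiv lift hconn hρ hspan
    -- Every `w` is an orbit vector, so the intertwining relation gives both the invariance of the
    -- space and the conjugation formula.
    have hconj : ∀ (k : ℕ) (w : inducedSpace lift Vqf),
        (1 - opL lift ^ k) (w : L2pow f.G (RelEdge H)) =
          O ((1 - (rshift (f.t ^ k)).toContinuousLinearMap) (O.symm w)) := by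
      intro k w
      rw [hO, ← one_sub_opL_pow_orbitOp lift hfix, ← hO, O.apply_symm_apply]
    have hW : ∀ k : ℕ, ∀ w ∈ inducedSpace lift Vqf,
        (1 - opL lift ^ k) w ∈ inducedSpace lift Vqf := by
      intro k w hw
      rw [hconj k ⟨w, hw⟩]
      exact SetLike.coe_mem _
    have hrestrict : ∀ k : ℕ, restrictOp (1 - opL lift ^ k) (inducedSpace lift Vqf) (hW k) =
        (O : L2 f.G →L[ℂ] inducedSpace lift Vqf) ∘L
          (1 - (rshift (f.t ^ k)).toContinuousLinearMap) ∘L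
            (O.symm : inducedSpace lift Vqf →L[ℂ] L2 f.G) := fun k =>
      ContinuousLinearMap.ext fun w => Subtype.ext (hconj k w)
    have hequiv : ∀ (g : f.G) (ξ : L2 f.G),
        (O (leftMul g ξ) : L2pow f.G (RelEdge H)) = diagOp (leftMul g) (O ξ) := by
      intro g ξ
      rw [hO, hO, orbitOp_leftMul]
    refine ⟨hW, fun k => ?_, fun _ => ⟨O, hequiv, fun k => ⟨_, isInduced_cyclicOp f.t k,
      hrestrict k⟩⟩, fkDet_cyclicOp t_pow_succ_ne_one⟩
    have hdet : fkDet (inducedSpace lift Vqf).subtypeₗᵢ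
        (restrictOp (1 - opL lift ^ k) (inducedSpace lift Vqf) (hW k)) = 1 := by
      rcases eq_or_ne k 0 with rfl | hk
      · have hzero : restrictOp (1 - opL lift ^ 0) (inducedSpace lift Vqf) (hW 0) = 0 := by
          refine ContinuousLinearMap.ext fun w => Subtype.ext ?_
          exact congrArg (fun T : L2pow f.G (RelEdge H) →L[ℂ] L2pow f.G (RelEdge H) => T w)
            (sub_eq_zero.2 (pow_zero (opL lift)).symm)
        rw [hzero, fkDet_zero]
      · rw [hrestrict]
        exact fkDet_eq_one_of_similar (inducedSpace lift Vqf).subtypeₗᵢ O hequiv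
          (pow_pow_succ_ne_one t_pow_succ_ne_one hk)
    rw [hdet]
    exact ⟨one_pos, Real.log_one⟩
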